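/- Let $Q$ be an $n$-dimensional smooth manifold with a Riemannian metric $\langle\!\langle\cdot,\cdot\rangle\!\rangle$ (the kinetic energy) and a smooth potential $U:Q\to\mathbb R$, let $D\subset TQ$ be a smooth vector subbundle of rank $r\ge 2$ (the constraint distribution), and let $G$ be a Lie group acting smoothly, freely and properly on $Q$, by isometries, leaving $U$ and $D$ invariant, and such that $T_qQ=D_q\oplus(\mathfrak g\cdot q)$ for every $q\in Q$, where $\mathfrak g\cdot q$ is the tangent space of the orbit (a $G$-Chaplygin system). Put $S=Q/G$, an $r$-dimensional manifold, with projection $\pi:Q\to S$, let $\mathcal P:TQ\to D$ be the orthogonal projector, and let $\mathrm{hor}$ denote the horizontal lift of tangent vectors and vector fields on $S$ to $D$. The gyroscopic tensor of the system is $$\mathcal T(Y,Z)(s)=T_q\pi\big(\mathcal P[\mathrm{hor}\,Y,\mathrm{hor}\,Z](q)\big)-[Y,Z](s),\qquad \pi(q)=s,\quad Y,Z\in\mathfrak X(S),$$ its gyroscopic coefficients in local coordinates $(s^1,\dots,s^r)$ of $S$ are defined by $\mathcal T(\partial_{s^i},\partial_{s^j})=\sum_k C_{ij}^k\,\partial_{s^k}$,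 and its contraction is the 1-form $\Theta(Y)=\sum_j\langle X^j,\mathcal T(X_j,Y)\rangle$ on $S$, where $\{X_j\}$ is a local frame and $\{X^j\}$ the dual frame. For $\varphi,\psi:D^*\to\mathbb R$ such that $\varphi\circ i_D^*$ and $\psi\circ i_D^*$ are smooth, let $\{\varphi,\psi\}_{D^*}=\{\varphi\circ i_D^*,\psi\circ i_D^*\}_{T^*Q}\circ\mathcal P^*$, where $i_D^*:T^*Q\to D^*$ is the restriction map, and let $h_c=h\circ\mathcal P^*$, where $h(\alpha)=\frac12\|\alpha\|^2+U(q)$ for $\alpha\in T_q^*Q$. The nonholonomic vector field on $D^*$ is the derivation $X_{nh}[\varphi]=\{\varphi,h_c\}_{D^*}$. The reduced vector field $\overline X_{nh}$ on $T^*S\cong D^*/G$ (the class of $\beta\in D_q^*$ being identified with the covector $u\mapsto\beta(\mathrm{hor}_q u)$ at $\pi(q)$) is the one to which $X_{nh}$ projects. Let $\nu=\Omega_{can}^r$ be the Liouville volume form on $T^*S$ and $\tau_S:T^*S\to S$ the projection. The reduced equations of motion preserve a volume form $\mu$ on $T^*S$ if $\mathcal L_{\overline X_{nh}}\mu=0$.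 For $\phi\in C^\infty(S)$ the system is $\phi$-simple if $\mathcal T(Y,Z)=Z[\phi]\,Y-Y[\phi]\,Z$ for all $Y,Z\in\mathfrak X(S)$. Hypothesis (H) is the following condition on the gyroscopic coefficients in local coordinates: $$C_{ij}^k=0\ \text{ for pairwise distinct } i,j,k,\qquad C_{ij}^j=C_{ik}^k\ \text{ for all } j,k\ne i .$$ Fix any collection of smooth charts of $S$ whose domains cover $S$, and say that (H) holds if it holds in all the charts of this collection. Then: (1) (H) holds if and only if $\mathcal T(Y,Z)=\frac1{r-1}\big(\Theta(Z)Y-\Theta(Y)Z\big)$ for all $Y,Z\in\mathfrak X(S)$. (2) For every $\phi\in C^\infty(S)$, the system is $\phi$-simple if and only if (H) holds and the reduced equations of motion preserve the volume form $\exp\big((r-1)\,\phi\circ\tau_S\big)\,\nu$ on $T^*S$. -/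

import Mathlib

open scoped Manifold ContDiff Topology

noncomputable section

/-! ### Differential forms and Lie derivatives on a manifold -/

section Forms

variable {E H M : Type*} [NormedAddCommGroup E] [NormedSpace ℝ E] [TopologicalSpace H]
  (I : ModelWithCorners ℝ E H) [TopologicalSpace M] [ChartedSpace H M]

/-- The exterior derivative `dθ (u, v)` at `x` of a 1-form `θ` on a manifold without boundary:
the form is read in the preferred chart at `x`, where
`dθ (u, v) = (Dθ u) v - (Dθ v) u`. -/
def extDerivOneForm (θ : ∀ x : M, TangentSpace I x →L[ℝ] ℝ) (x : M) (u v : TangentSpace I x) : ℝ :=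
  let c := extChartAt I x
  let θc : E → (E →L[ℝ] ℝ) := fun y => (θ (c.symm y)).comp (mfderiv 𝓘(ℝ, E) I c.symm y)
  let uc : E := mfderiv I 𝓘(ℝ, E) c x u
  let vc : E := mfderiv I 𝓘(ℝ, E) c x v
  fderiv ℝ θc (c x) uc vc - fderiv ℝ θc (c x) vc uc

/-- The Lie derivative along `X` of a covariant tensor field `μ` (with arguments indexed by `ι`),
evaluated on vector fields `Y i`:
`(L_X μ)(Y) = X[μ(Y)] - ∑ i, μ(…, [X, Y i], …)`. -/
def lieDerivForm {ι : Type*} [Fintype ι] [DecidableEq ι] (X : ∀ x : M, TangentSpace I x)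
    (μ : ∀ x : M, (ι → TangentSpace I x) → ℝ) (Y : ι → ∀ x : M, TangentSpace I x) (x : M) : ℝ :=
  (show ℝ from mfderiv I 𝓘(ℝ, ℝ) (fun y => μ y (fun i => Y i y)) x (X x)) -
    ∑ i, μ x (Function.update (fun j => Y j x) i (VectorField.mlieBracket I X (Y i) x))

/-- The form `μ` is invariant under (the flow of) the vector field `X`: `L_X μ = 0`. -/
def IsInvariantForm {ι : Type*} [Fintype ι] [DecidableEq ι] [IsManifold I 1 M]
    (X : ∀ x : M, TangentSpace I x) (μ : ∀ x : M, (ι → TangentSpace I x) → ℝ) : Prop :=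
  ∀ (x : M) (Y : ι → ∀ x : M, TangentSpace I x),
    (∀ i, ContMDiffAt I I.tangent ∞ (fun y => (⟨y, Y i y⟩ : TangentBundle I M)) x) →
      lieDerivForm I X μ Y x = 0

end Forms

/-! ### The cotangent bundle and its canonical structures -/

/-- The cotangent bundle `T*M` of an `m`-dimensional manifold, with Mathlib's vector bundle and
manifold structure. -/
abbrev CotangentBundle (m : ℕ) (M : Type*) [TopologicalSpace M]
    [ChartedSpace (EuclideanSpace ℝ (Fin m)) M] [IsManifold (𝓡 m) ∞ M] : Type _ :=
  Bundle.TotalSpace (EuclideanSpace ℝ (Fin m) →L[ℝ] ℝ)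
    (fun x : M => TangentSpace (𝓡 m) x →L[ℝ] Bundle.Trivial M ℝ x)

/-- The model with corners of `T*M` when `M` has dimension `m`. -/
abbrev cotangentModel (m : ℕ) :
    ModelWithCorners ℝ (EuclideanSpace ℝ (Fin m) × (EuclideanSpace ℝ (Fin m) →L[ℝ] ℝ))
      (ModelProd (EuclideanSpace ℝ (Fin m)) (EuclideanSpace ℝ (Fin m) →L[ℝ] ℝ)) :=
  (𝓡 m).prod 𝓘(ℝ, EuclideanSpace ℝ (Fin m) →L[ℝ] ℝ)

section Cotangent

variable {m : ℕ} {M : Type*} [TopologicalSpace M] [ChartedSpace (EuclideanSpace ℝ (Fin m)) M]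
  [IsManifold (𝓡 m) ∞ M]

/-- The Liouville 1-form `λ (α) (U) = α (T τ U)` on `T*M`. -/
def liouvilleForm (α : CotangentBundle m M) : TangentSpace (cotangentModel m) α →L[ℝ] ℝ :=
  ContinuousLinearMap.comp (show TangentSpace (𝓡 m) α.1 →L[ℝ] ℝ from α.2)
    (mfderiv (cotangentModel m) (𝓡 m) (fun β : CotangentBundle m M => β.1) α)

/-- The canonical symplectic form `Ω_can = -dλ` on `T*M`. -/
def canonicalForm (α : CotangentBundle m M) (u v : TangentSpace (cotangentModel m) α) : ℝ :=
  -extDerivOneForm (cotangentModel m) liouvilleForm α u v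

/-- The Hamiltonian vector `X_f` at `α`: the vector `w` with `Ω_can (w, ·) = df`. -/
def hamiltonianVector (f : CotangentBundle m M → ℝ) (α : CotangentBundle m M) :
    TangentSpace (cotangentModel m) α :=
  Classical.epsilon fun w => ∀ v : TangentSpace (cotangentModel m) α,
    canonicalForm α w v = (show ℝ from mfderiv (cotangentModel m) 𝓘(ℝ, ℝ) f α v)

/-- The canonical Poisson bracket `{f, g} = X_g[f]` on `T*M` (so `{q, p} = 1`). -/
def poissonBracket (f g : CotangentBundle m M → ℝ) (α : CotangentBundle m M) : ℝ :=
  show ℝ from mfderiv (cotangentModel m) 𝓘(ℝ, ℝ) f α (hamiltonianVector g α)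

/-- The Liouville volume form `ν = Ω_can ∧ ⋯ ∧ Ω_can` (`m` factors) on `T*M`, evaluated on `2m`
vectors indexed by `Fin m × Fin 2` in lexicographic order. -/
def liouvilleVolume (α : CotangentBundle m M)
    (v : Fin m × Fin 2 → TangentSpace (cotangentModel m) α) : ℝ :=
  (1 / 2 ^ m : ℝ) * ∑ σ : Equiv.Perm (Fin m × Fin 2),
    ((Equiv.Perm.sign σ : ℤ) : ℝ) * ∏ i : Fin m, canonicalForm α (v (σ (i, 0))) (v (σ (i, 1)))

end Cotangent

/-! ### Chaplygin systems -/

/-- A `G`-Chaplygin system with `r` degrees of freedom on the `n`-dimensional manifold `Q`. The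
manifold `S`, together with `proj : Q → S`, is the orbit space `Q / G`: `proj` is a surjective
submersion whose fibres are the `G`-orbits. -/
structure ChaplyginSystem (n k r : ℕ) (Q G S : Type*)
    [TopologicalSpace Q] [ChartedSpace (EuclideanSpace ℝ (Fin n)) Q] [IsManifold (𝓡 n) ∞ Q]
    [TopologicalSpace G] [ChartedSpace (EuclideanSpace ℝ (Fin k)) G] [Group G]
    [LieGroup (𝓡 k) ∞ G]
    [TopologicalSpace S] [ChartedSpace (EuclideanSpace ℝ (Fin r)) S] [IsManifold (𝓡 r) ∞ S]
    [MulAction G Q] [ContMDiffSMul (𝓡 k) (𝓡 n) ∞ G Q] [ProperSMul G Q] where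
  /-- the kinetic energy metric -/
  metric : Bundle.ContMDiffRiemannianMetric (𝓡 n) ∞ (EuclideanSpace ℝ (Fin n))
    (fun q : Q => TangentSpace (𝓡 n) q)
  /-- the potential energy -/
  U : Q → ℝ
  /-- the constraint distribution, a smooth subbundle of rank `r` -/
  D : ∀ q : Q, Submodule ℝ (TangentSpace (𝓡 n) q)
  /-- the orbit projection -/
  proj : Q → S
  contMDiff_U : ContMDiff (𝓡 n) 𝓘(ℝ, ℝ) ∞ U
  exists_frame : ∀ q₀ : Q, ∃ W : Set Q, IsOpen W ∧ q₀ ∈ W ∧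
    ∃ V : Fin r → ∀ q : Q, TangentSpace (𝓡 n) q,
      (∀ i, ContMDiffOn (𝓡 n) (𝓡 n).tangent ∞
        (fun q => (⟨q, V i q⟩ : TangentBundle (𝓡 n) Q)) W) ∧
      ∀ q ∈ W, LinearIndependent ℝ (fun i => V i q) ∧
        Submodule.span ℝ (Set.range fun i => V i q) = D q
  free : ∀ (g : G) (q : Q), g • q = q → g = 1
  contMDiff_proj : ContMDiff (𝓡 n) (𝓡 r) ∞ proj
  surjective_proj : Function.Surjective proj
  surjective_mfderiv_proj : ∀ q, Function.Surjective (mfderiv (𝓡 n) (𝓡 r) proj q)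
  proj_eq_iff : ∀ q q' : Q, proj q = proj q' ↔ ∃ g : G, g • q = q'
  /-- `G` acts by isometries -/
  metric_smul : ∀ (g : G) (q : Q) (u v : TangentSpace (𝓡 n) q),
    metric.inner (g • q) (mfderiv (𝓡 n) (𝓡 n) (fun x : Q => g • x) q u)
      (mfderiv (𝓡 n) (𝓡 n) (fun x : Q => g • x) q v) = metric.inner q u v
  U_smul : ∀ (g : G) (q : Q), U (g • q) = U q
  D_smul : ∀ (g : G) (q : Q),
    (D q).map (mfderiv (𝓡 n) (𝓡 n) (fun x : Q => g • x) q).toLinearMap = D (g • q)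
  /-- `T_q Q = D_q ⊕ 𝔤 · q`, where `𝔤 · q` is the tangent space of the orbit -/
  isCompl : ∀ q : Q, IsCompl (D q)
    (LinearMap.range (mfderiv (𝓡 k) (𝓡 n) (fun g : G => g • q) 1).toLinearMap)

namespace ChaplyginSystem

variable {n k r : ℕ} {Q G S : Type*}
  [TopologicalSpace Q] [ChartedSpace (EuclideanSpace ℝ (Fin n)) Q] [IsManifold (𝓡 n) ∞ Q]
  [TopologicalSpace G] [ChartedSpace (EuclideanSpace ℝ (Fin k)) G] [Group G]
  [LieGroup (𝓡 k) ∞ G]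
  [TopologicalSpace S] [ChartedSpace (EuclideanSpace ℝ (Fin r)) S] [IsManifold (𝓡 r) ∞ S]
  [MulAction G Q] [ContMDiffSMul (𝓡 k) (𝓡 n) ∞ G Q] [ProperSMul G Q]
  (C : ChaplyginSystem n k r Q G S)

/-- The tangent map `T_q π` restricted to `D_q`. -/
def projD (q : Q) : C.D q →ₗ[ℝ] TangentSpace (𝓡 r) (C.proj q) :=
  (mfderiv (𝓡 n) (𝓡 r) C.proj q).toLinearMap.comp (C.D q).subtype

theorem finrank_D (q : Q) : Module.finrank ℝ (C.D q) = r := by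
  obtain ⟨W, -, hq, V, -, hV⟩ := C.exists_frame q
  obtain ⟨hli, hsp⟩ := hV q hq
  rw [← hsp, finrank_span_eq_card hli, Fintype.card_fin]

theorem mfderiv_proj_orbit (q : Q)
    (ξ : TangentSpace (𝓡 k) (1 : G)) :
    mfderiv (𝓡 n) (𝓡 r) C.proj q
      (show TangentSpace (𝓡 n) q from mfderiv (𝓡 k) (𝓡 n) (fun g : G => g • q) 1 ξ) = 0 := by
  have h1 : MDifferentiableAt (𝓡 k) (𝓡 n) (fun g : G => g • q) 1 := by
    have h : ContMDiff (𝓡 k) (𝓡 n) ∞ (fun g : G => g • q) :=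
      (ContMDiffSMul.contMDiff_smul (I := 𝓡 k) (I' := 𝓡 n) (n := ∞) (G := G) (M := Q)).comp
        (contMDiff_id.prodMk contMDiff_const)
    exact h.mdifferentiableAt (by simp)
  have h2 : MDifferentiableAt (𝓡 n) (𝓡 r) C.proj ((1 : G) • q) :=
    C.contMDiff_proj.mdifferentiableAt (by simp)
  have h3 : C.proj ∘ (fun g : G => g • q) = fun _ => C.proj q := by
    funext g
    exact ((C.proj_eq_iff q (g • q)).2 ⟨g, rfl⟩).symm
  have h4 := mfderiv_comp (1 : G) h2 h1
  rw [h3, mfderiv_const] at h4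
  have h5 := congrArg (fun L => L ξ) h4
  have h6 : ∀ q' : Q, q' = q → ∀ v : EuclideanSpace ℝ (Fin n),
      (mfderiv (𝓡 n) (𝓡 r) C.proj q' : EuclideanSpace ℝ (Fin n) → EuclideanSpace ℝ (Fin r)) v =
      (mfderiv (𝓡 n) (𝓡 r) C.proj q : EuclideanSpace ℝ (Fin n) → EuclideanSpace ℝ (Fin r)) v := by
    rintro q' rfl v
    rfl
  exact (h6 _ (one_smul G q) _).symm.trans h5.symm

instance (q : Q) : FiniteDimensional ℝ (TangentSpace (𝓡 n) q) :=
  inferInstanceAs (FiniteDimensional ℝ (EuclideanSpace ℝ (Fin n)))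

instance (q : Q) : T2Space (TangentSpace (𝓡 n) q) :=
  inferInstanceAs (T2Space (EuclideanSpace ℝ (Fin n)))

theorem bijective_projD (q : Q) : Function.Bijective (C.projD q) := by
  have hsurj : Function.Surjective (C.projD q) := by
    intro u
    obtain ⟨v, rfl⟩ := C.surjective_mfderiv_proj q u
    have hv : v ∈ C.D q ⊔
        LinearMap.range (mfderiv (𝓡 k) (𝓡 n) (fun g : G => g • q) 1).toLinearMap := by
      rw [(C.isCompl q).sup_eq_top]
      trivial
    obtain ⟨d, hd, w, ⟨ξ, rfl⟩, rfl⟩ := Submodule.mem_sup.1 hv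
    refine ⟨⟨d, hd⟩, ?_⟩
    rw [map_add]
    exact ((congrArg (mfderiv (𝓡 n) (𝓡 r) C.proj q d + ·)
      (C.mfderiv_proj_orbit q ξ)).trans (add_zero _)).symm
  have hrank : Module.finrank ℝ (C.D q) =
      Module.finrank ℝ (TangentSpace (𝓡 r) (C.proj q)) := by
    rw [C.finrank_D q]
    exact (finrank_euclideanSpace_fin (𝕜 := ℝ) (n := r)).symm
  exact ⟨(LinearMap.injective_iff_surjective_of_finrank_eq_finrank hrank).2 hsurj, hsurj⟩

/-- The horizontal lift `T_{π q} S → D_q`, inverse to `T_q π` restricted to `D_q`. -/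
def hor (q : Q) : TangentSpace (𝓡 r) (C.proj q) →L[ℝ] C.D q :=
  LinearMap.toContinuousLinearMap
    (LinearEquiv.ofBijective (C.projD q) (C.bijective_projD q)).symm.toLinearMap

/-- The horizontal lift of a vector field on `S`. -/
def horField (Y : ∀ s : S, TangentSpace (𝓡 r) s) (q : Q) : TangentSpace (𝓡 n) q :=
  C.hor q (Y (C.proj q))

/-- The orthogonal complement of `D_q` for the kinetic energy metric. -/
def Dperp (q : Q) : Submodule ℝ (TangentSpace (𝓡 n) q) where
  carrier := {v | ∀ w ∈ C.D q, C.metric.inner q v w = 0}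
  add_mem' ha hb w hw := by simp [ha w hw, hb w hw]
  zero_mem' w _ := by simp
  smul_mem' c v hv w hw := by simp [hv w hw]

theorem isCompl_Dperp (q : Q) : IsCompl (C.D q) (C.Dperp q) := by
  let B : LinearMap.BilinForm ℝ (TangentSpace (𝓡 n) q) :=
    LinearMap.mk₂ ℝ (fun u v => C.metric.inner q u v) (by simp) (by simp) (by simp) (by simp)
  have hB : ∀ u v, B u v = C.metric.inner q u v := fun u v => rfl
  have hperp : C.Dperp q = B.orthogonal (C.D q) := by
    ext v
    constructor
    · intro h w hw
      exact (C.metric.symm q w v).trans (h w hw)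
    · intro h w hw
      exact (C.metric.symm q v w).trans (h w hw)
  rw [hperp]
  have hsymm : B.IsSymm := ⟨fun u v => C.metric.symm q u v⟩
  refine LinearMap.BilinForm.isCompl_orthogonal_of_restrict_nondegenerate hsymm.isRefl ?_
  have hz : ∀ u : C.D q, B (u : TangentSpace (𝓡 n) q) (u : TangentSpace (𝓡 n) q) = 0 → u = 0 := by
    intro u hu
    by_contra hne
    exact (C.metric.pos q u fun h => hne (Subtype.ext h)).ne' hu
  exact ⟨fun u hu => hz u (hu u), fun u hu => hz u (hu u)⟩

/-- The orthogonal projector `P : T_q Q → D_q`. -/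
def orthProj (q : Q) : TangentSpace (𝓡 n) q →L[ℝ] C.D q :=
  LinearMap.toContinuousLinearMap
    (Submodule.projectionOnto (C.D q) (C.Dperp q) (C.isCompl_Dperp q))

/-! #### The gyroscopic tensor -/

/-- The gyroscopic tensor: `T(Y,Z)(s) = T_q π (P [hor Y, hor Z](q)) - [Y,Z](s)`, where `q` is a
point over `s` (on which the value does not depend). -/
def gyro (Y Z : ∀ s : S, TangentSpace (𝓡 r) s) (s : S) : TangentSpace (𝓡 r) s :=
  let q : Q := Function.surjInv C.surjective_proj s
  (show TangentSpace (𝓡 r) s from C.projD q (C.orthProj q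
    (VectorField.mlieBracket (𝓡 n) (C.horField Y) (C.horField Z) q))) -
    VectorField.mlieBracket (𝓡 r) Y Z s

end ChaplyginSystem

section Coordinates

variable {r : ℕ} {S : Type*} [TopologicalSpace S] [ChartedSpace (EuclideanSpace ℝ (Fin r)) S]

/-- The coordinate vector field `∂/∂sⁱ` of a chart `e` of `S` (used on the domain of `e`). -/
def coordField (e : OpenPartialHomeomorph S (EuclideanSpace ℝ (Fin r))) (i : Fin r) (s : S) :
    TangentSpace (𝓡 r) s :=
  (mfderiv (𝓡 r) (𝓡 r) e s).inverse
    (show TangentSpace (𝓡 r) (e s) from EuclideanSpace.single i (1 : ℝ))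

/-- The coordinate covector `dsʲ` of a chart `e`, applied to a tangent vector `v` at `s`. -/
def coordCovector (e : OpenPartialHomeomorph S (EuclideanSpace ℝ (Fin r))) (j : Fin r) (s : S)
    (v : TangentSpace (𝓡 r) s) : ℝ :=
  (show EuclideanSpace ℝ (Fin r) from mfderiv (𝓡 r) (𝓡 r) e s v) j

end Coordinates

namespace ChaplyginSystem

variable {n k r : ℕ} {Q G S : Type*}
  [TopologicalSpace Q] [ChartedSpace (EuclideanSpace ℝ (Fin n)) Q] [IsManifold (𝓡 n) ∞ Q]
  [TopologicalSpace G] [ChartedSpace (EuclideanSpace ℝ (Fin k)) G] [Group G]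
  [LieGroup (𝓡 k) ∞ G]
  [TopologicalSpace S] [ChartedSpace (EuclideanSpace ℝ (Fin r)) S] [IsManifold (𝓡 r) ∞ S]
  [MulAction G Q] [ContMDiffSMul (𝓡 k) (𝓡 n) ∞ G Q] [ProperSMul G Q]
  (C : ChaplyginSystem n k r Q G S)

/-- The gyroscopic coefficients `C_{ij}^l` in a chart `e`:
`T(∂/∂sⁱ, ∂/∂sʲ) = ∑ l, C_{ij}^l ∂/∂sˡ`. -/
def gyroCoeff (e : OpenPartialHomeomorph S (EuclideanSpace ℝ (Fin r))) (i j l : Fin r) (s : S) :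
    ℝ :=
  coordCovector e l s (C.gyro (coordField e i) (coordField e j) s)

/-- The 1-form `Θ(Y) = ∑ j, ⟨Xʲ, T(X_j, Y)⟩`, computed at `s` with the coordinate frame of the
preferred chart at `s` (the value does not depend on the frame). -/
def theta (Y : ∀ s : S, TangentSpace (𝓡 r) s) (s : S) : ℝ :=
  ∑ j : Fin r, coordCovector (chartAt _ s) j s (C.gyro (coordField (chartAt _ s) j) Y s)

/-- `Y` is a smooth vector field on `S`. -/
def IsSmoothField (Y : ∀ s : S, TangentSpace (𝓡 r) s) : Prop :=
  ContMDiff (𝓡 r) (𝓡 r).tangent ∞ (fun s => (⟨s, Y s⟩ : TangentBundle (𝓡 r) S))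

/-- The system is `φ`-simple: `T(Y,Z) = Z[φ] Y - Y[φ] Z` for all vector fields `Y`, `Z` on `S`. -/
def IsSimple (φ : S → ℝ) : Prop :=
  ∀ Y Z : ∀ s : S, TangentSpace (𝓡 r) s, IsSmoothField Y → IsSmoothField Z → ∀ s : S,
    C.gyro Y Z s = (show ℝ from mfderiv (𝓡 r) 𝓘(ℝ, ℝ) φ s (Z s)) • Y s -
      (show ℝ from mfderiv (𝓡 r) 𝓘(ℝ, ℝ) φ s (Y s)) • Z s

/-- Hypothesis (H) on the gyroscopic coefficients, in the coordinates given by the chart `e`. -/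
def HypHIn (e : OpenPartialHomeomorph S (EuclideanSpace ℝ (Fin r))) : Prop :=
  ∀ s ∈ e.source,
    (∀ i j l : Fin r, l ≠ i → i ≠ j → j ≠ l → C.gyroCoeff e i j l s = 0) ∧
    (∀ i j l : Fin r, j ≠ i → l ≠ i → C.gyroCoeff e i j j s = C.gyroCoeff e i l l s)

/-- Hypothesis (H'): `T(Y,Z) = (Θ(Z) Y - Θ(Y) Z) / (r - 1)` for all vector fields `Y`, `Z`. -/
def HypH' : Prop :=
  ∀ Y Z : ∀ s : S, TangentSpace (𝓡 r) s, IsSmoothField Y → IsSmoothField Z → ∀ s : S,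
    C.gyro Y Z s = (1 / ((r : ℝ) - 1)) • (C.theta Z s • Y s - C.theta Y s • Z s)

/-! #### Nonholonomic dynamics and its reduction -/

/-- The (total space of the) dual `D*` of the constraint distribution. -/
structure DualD where
  /-- the base point -/
  pt : Q
  /-- the covector -/
  cov : C.D pt →L[ℝ] ℝ

/-- `i_D^* : T*Q → D*`, restriction of covectors to `D`. -/
def restrictD (α : CotangentBundle n Q) : C.DualD :=
  ⟨α.1, ContinuousLinearMap.comp (show TangentSpace (𝓡 n) α.1 →L[ℝ] ℝ from α.2)
    (C.D α.1).subtypeL⟩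

/-- `P^* : D* → T*Q`. -/
def extendD (β : C.DualD) : CotangentBundle n Q :=
  ⟨β.pt, β.cov.comp (C.orthProj β.pt)⟩

/-- The nonholonomic bracket `{φ, ψ}_{D*} = {φ ∘ i_D^*, ψ ∘ i_D^*}_{T*Q} ∘ P^*`. -/
def nhBracket (φ ψ : C.DualD → ℝ) (β : C.DualD) : ℝ :=
  poissonBracket (φ ∘ C.restrictD) (ψ ∘ C.restrictD) (C.extendD β)

/-- The Hamiltonian `h(α) = ½ ‖α‖² + U(q)` on `T*Q`; here `‖α‖² = α(α^♯)` is the norm dual to the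
kinetic energy metric. -/
def hamiltonian (α : CotangentBundle n Q) : ℝ :=
  let a : TangentSpace (𝓡 n) α.1 →L[ℝ] ℝ := α.2
  (1 / 2) * a ((C.metric.inner α.1).inverse a) + C.U α.1

/-- The constrained Hamiltonian `h_c = h ∘ P^*` on `D*`. -/
def constrainedHamiltonian (β : C.DualD) : ℝ := C.hamiltonian (C.extendD β)

/-- The orbit projection `D* → D*/G`, where `D*/G` is identified with `T*S` through
`[β] ↦ (u ↦ β (hor_q u))`. -/
def reduceD (β : C.DualD) : CotangentBundle r S :=
  ⟨C.proj β.pt, β.cov.comp (C.hor β.pt)⟩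

/-- The reduced vector field on `T*S`: the nonholonomic vector field on `D*` is the derivation
`X_nh[ψ] = {ψ, h_c}_{D*}`, and the reduced vector field is the one that is related to it by the
orbit projection `Π : D* → T*S`, i.e. `X[φ] (Π β) = {φ ∘ Π, h_c}_{D*} (β)`. -/
def reducedField (a : CotangentBundle r S) : TangentSpace (cotangentModel r) a :=
  Classical.epsilon fun w => ∀ β : C.DualD, C.reduceD β = a →
    ∀ φ : CotangentBundle r S → ℝ, ContMDiffAt (cotangentModel r) 𝓘(ℝ, ℝ) ∞ φ a →
      (show ℝ from mfderiv (cotangentModel r) 𝓘(ℝ, ℝ) φ a w) =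
        C.nhBracket (φ ∘ C.reduceD) C.constrainedHamiltonian β

/-- The reduced dynamics preserves the basic measure `exp(σ ∘ τ) ν` on `T*S`. -/
def PreservesBasic (σ : S → ℝ) : Prop :=
  IsInvariantForm (cotangentModel r) C.reducedField
    (fun (a : CotangentBundle r S) v => Real.exp (σ a.1) * liouvilleVolume a v)

end ChaplyginSystem

end

/-! Every condition in the theorem reduces to one about a single antisymmetric bilinear map on each
tangent space of `S`. In charts the bracket of two horizontal lifts is the lift of the bracket plus
a term that depends only on the values of the two fields. Applying `T_q π ∘ P` cancels the lifted
bracket, so the gyroscopic expression is a tensor (`gyroBilin_eq`). Invariance of horizontal lifts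
under `G` makes it independent of the point of the fibre (`gyroTensor_proj`). Since every tangent
vector of `S` extends to a global smooth field, conditions on fields become conditions on vectors.

Part (1) is then linear algebra (`coeff_conditions_iff_eq_trace`). `Θ(y)` is the trace of `x ↦ T(x,
y)`. Under (H) the `r - 1` terms `j ≠ i` of `Θ(∂_i)` all equal `-C_{ij}^j`, so `C_{ij}^j =
-Θ(∂_i)/(r - 1)`, and with antisymmetry these are the only coefficients that can be nonzero. The
resulting formula mentions no basis, which is why the choice of charts is irrelevant. Taking traces
also shows that `T(y, z) = f(z) y - f(y) z` holds exactly when that formula holds and `Θ = (r - 1)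
f` (`eq_smul_sub_smul_iff`).

Part (2) therefore amounts to the fact that `exp(σ ∘ τ) ν` is preserved exactly when `dσ = Θ`
(`preservesBasic_iff`). In cotangent coordinates the reduced Hamiltonian is `H = ½ p(K p) + U`,
where `K` is the inverse of the reduced metric, and the reduced equations are `ẋ = K p`, `ṗ = -∂H/∂x
- p(T(·, ẋ))` (`chartDeriv_reducedField`). The Hamiltonian part has zero divergence. Differentiating
the gyroscopic force in `p` gives two terms: one has trace `-Θ(ẋ)`, the other pairs the skew form `p
∘ T` with the symmetric `K` and has trace zero (`trace_fderiv_of_reduced_equations`). Hence `L_X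
(e^σ ν) = e^σ (dσ(ẋ) - Θ(ẋ)) ν`. As `K` is invertible, `ẋ` takes every value at each point of `S`,
so the bracket vanishes identically exactly when `dσ = Θ`. Apply this to `σ = (r - 1) φ`. -/

noncomputable section

/-! ### Linear algebra: top-degree forms, powers of a two-form, and skew bilinear maps determined by
their trace. -/

section LinearAlgebra

/-- For a top-degree alternating form, the derivation induced by an endomorphism is multiplication
by its trace. -/
theorem AlternatingMap.sum_update_apply_eq_trace {ι V : Type*} [Fintype ι] [DecidableEq ι]
    [AddCommGroup V] [Module ℝ V] (b : Module.Basis ι ℝ V) (ν : V [⋀^ι]→ₗ[ℝ] ℝ) (A : V →ₗ[ℝ] V)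
    (v : ι → V) :
    ∑ i, ν (Function.update v i (A (v i))) = LinearMap.trace ℝ V A * ν v := by
  let g : V [⋀^ι]→ₗ[ℝ] ℝ :=
    { toMultilinearMap := ∑ i, ν.toMultilinearMap.compLinearMap
        (Function.update (fun _ => LinearMap.id) i A)
      map_eq_zero_of_eq' := by
        intro v i j hij hne
        have hterm : ∀ k, (fun l => (Function.update (fun _ => LinearMap.id) k A :
            ι → V →ₗ[ℝ] V) l (v l)) = Function.update v k (A (v k)) := by
          intro k
          ext l
          rcases eq_or_ne l k with rfl | h <;> simp [*]
        simp only [FunLike.coe_sum, Finset.sum_apply,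
          MultilinearMap.compLinearMap_apply, hterm, AlternatingMap.coe_multilinearMap,
          MultilinearMap.toFun_eq_coe]
        -- If `v i = v j`, every term with `k` outside `{i, j}` still has two equal arguments and
        -- vanishes; the two remaining terms differ by a transposition and cancel.
        rw [← Finset.sum_subset (Finset.subset_univ {i, j}), Finset.sum_pair hne]
        · have hs : Function.update v j (A (v j)) =
              Function.update v i (A (v i)) ∘ Equiv.swap i j := by
            ext l
            rcases eq_or_ne l i with rfl | hi
            · simp [hne, hne.symm, hij]
            rcases eq_or_ne l j with rfl | hj
            · simp [hij]
            · simp [Equiv.swap_apply_of_ne_of_ne hi hj, hi, hj]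
          rw [hs, ν.map_swap _ hne, add_neg_cancel]
        · intro k _ hk
          simp only [Finset.mem_insert, Finset.mem_singleton, not_or] at hk
          exact ν.map_eq_zero_of_eq _
            (by rw [Function.update_of_ne (Ne.symm hk.1), Function.update_of_ne (Ne.symm hk.2),
              hij])
            hne }
  have hg : ∀ v, g v = ∑ i, ν (Function.update v i (A (v i))) := by
    intro v
    change (∑ i, ν.toMultilinearMap.compLinearMap
        (Function.update (fun _ => LinearMap.id) i A)) v = _
    simp only [FunLike.coe_sum, Finset.sum_apply, MultilinearMap.compLinearMap_apply,
      AlternatingMap.coe_multilinearMap]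
    refine Finset.sum_congr rfl fun k _ => congrArg ν ?_
    ext l
    rcases eq_or_ne l k with rfl | h <;> simp [*]
  -- Top-degree forms are multiples of `b.det`, so it is enough to compare both sides on the basis.
  have hb : g b = LinearMap.trace ℝ V A * ν b := by
    rw [hg, LinearMap.trace_eq_matrix_trace ℝ b, Matrix.trace, Finset.sum_mul]
    refine Finset.sum_congr rfl fun i _ => ?_
    rw [Matrix.diag_apply, LinearMap.toMatrix_apply]
    conv_lhs => rw [← b.sum_repr (A (b i))]
    rw [AlternatingMap.map_update_sum, Finset.sum_eq_single i]
    · rw [AlternatingMap.map_update_smul, Function.update_eq_self, smul_eq_mul]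
    · intro k _ hk
      rw [AlternatingMap.map_update_smul, AlternatingMap.map_update_self _ _ hk.symm, smul_zero]
    · simp
  rw [← hg, g.eq_smul_basis_det b, hb, ν.eq_smul_basis_det b]
  simp only [AlternatingMap.smul_apply, smul_eq_mul, Module.Basis.det_self, mul_one, mul_assoc]

variable {V : Type*} [AddCommGroup V] [Module ℝ V]

/-- The multilinear map `v ↦ ∏ i, B (v (i, 0)) (v (i, 1))`. -/
def pairProduct (m : ℕ) (B : V →ₗ[ℝ] V →ₗ[ℝ] ℝ) :
    MultilinearMap ℝ (fun _ : Fin m × Fin 2 => V) ℝ where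
  toFun v := ∏ i, B (v (i, 0)) (v (i, 1))
  map_update_add' := by
    rintro inst v ⟨i, k⟩ x y
    -- The multilinearity axioms quantify over the decidability instance; it is fixed here so that
    -- the updates reduce.
    obtain rfl : inst = instDecidableEqProd := Subsingleton.elim _ _
    have h : ∀ z, ∏ j ∈ Finset.univ \ {i}, B (Function.update v (i, k) z (j, 0))
        (Function.update v (i, k) z (j, 1)) = ∏ j ∈ Finset.univ \ {i}, B (v (j, 0)) (v (j, 1)) :=
      fun z => Finset.prod_congr rfl fun j hj => by
        have hj : j ≠ i := by simpa using hj
        simp [Function.update_of_ne, hj]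
    simp only [Finset.prod_eq_mul_prod_sdiff_singleton_of_mem (Finset.mem_univ i), h, ← add_mul]
    fin_cases k <;> simp [Function.update_of_ne]
  map_update_smul' := by
    rintro inst v ⟨i, k⟩ c x
    obtain rfl : inst = instDecidableEqProd := Subsingleton.elim _ _
    have h : ∀ z, ∏ j ∈ Finset.univ \ {i}, B (Function.update v (i, k) z (j, 0))
        (Function.update v (i, k) z (j, 1)) = ∏ j ∈ Finset.univ \ {i}, B (v (j, 0)) (v (j, 1)) :=
      fun z => Finset.prod_congr rfl fun j hj => by
        have hj : j ≠ i := by simpa using hj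
        simp [Function.update_of_ne, hj]
    simp only [Finset.prod_eq_mul_prod_sdiff_singleton_of_mem (Finset.mem_univ i), h, smul_eq_mul,
      ← mul_assoc]
    fin_cases k <;> simp [Function.update_of_ne]

/-- The exterior power `B ∧ ⋯ ∧ B` (`m` factors) of a bilinear form. -/
def wedgePower (m : ℕ) (B : V →ₗ[ℝ] V →ₗ[ℝ] ℝ) : V [⋀^Fin m × Fin 2]→ₗ[ℝ] ℝ :=
  (1 / 2 ^ m : ℝ) • MultilinearMap.alternatization (pairProduct m B)

theorem wedgePower_apply (m : ℕ) (B : V →ₗ[ℝ] V →ₗ[ℝ] ℝ) (v : Fin m × Fin 2 → V) :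
    wedgePower m B v = (1 / 2 ^ m : ℝ) * ∑ σ : Equiv.Perm (Fin m × Fin 2),
      ((Equiv.Perm.sign σ : ℤ) : ℝ) * ∏ i : Fin m, B (v (σ (i, 0))) (v (σ (i, 1))) := by
  simp only [wedgePower, AlternatingMap.smul_apply, MultilinearMap.alternatization_apply,
    smul_eq_mul, MultilinearMap.domDomCongr_apply, pairProduct, MultilinearMap.coe_mk]
  congr 1
  refine Finset.sum_congr rfl fun σ _ => ?_
  rw [Units.smul_def, zsmul_eq_mul]

/-- In a symplectic frame no cancellation occurs. A permutation contributes only if it sends pairs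
to pairs; it is then a permutation `π` of the pairs composed with flips inside them. The sign of `π`
enters once for each element of a pair, hence squared, and the signs of the flips match the values
of `B`. So every term is nonnegative, and the identity contributes a positive one. This is how the
Liouville form is seen to be nonzero. -/
theorem wedgePower_pos {m : ℕ} {B : V →ₗ[ℝ] V →ₗ[ℝ] ℝ} {p : Fin m × Fin 2 → V}
    (h01 : ∀ i j, B (p (i, 0)) (p (j, 1)) = if i = j then 1 else 0)
    (h10 : ∀ i j, B (p (i, 1)) (p (j, 0)) = if i = j then -1 else 0)
    (h00 : ∀ i j, B (p (i, 0)) (p (j, 0)) = 0) (h11 : ∀ i j, B (p (i, 1)) (p (j, 1)) = 0) :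
    0 < wedgePower m B p := by
  rw [wedgePower_apply]
  refine mul_pos (by positivity) (Finset.sum_pos' (fun σ _ => ?_) ⟨1, Finset.mem_univ _, ?_⟩)
  swap
  · simp [h01]
  by_cases hz : ∃ i, B (p (σ (i, 0))) (p (σ (i, 1))) = 0
  · obtain ⟨i, hi⟩ := hz
    rw [Finset.prod_eq_zero (Finset.mem_univ i) hi, mul_zero]
  push Not at hz
  have hfactor : ∀ x y : Fin m × Fin 2, B (p x) (p y) ≠ 0 → x.1 = y.1 ∧
      ((x.2 = 0 ∧ y.2 = 1 ∧ B (p x) (p y) = 1) ∨ (x.2 = 1 ∧ y.2 = 0 ∧ B (p x) (p y) = -1)) := by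
    rintro ⟨i, k⟩ ⟨j, l⟩ h
    fin_cases k <;> fin_cases l <;> simp_all
  choose h1 h2 using fun i => hfactor _ _ (hz i)
  let f : Fin m → Equiv.Perm (Fin 2) := fun i =>
    if (σ (i, 0)).2 = 0 then 1 else Equiv.swap 0 1
  have hf : ∀ i k, (σ (i, k)).2 = f i k := by
    intro i k
    rcases h2 i with ⟨ha, hb, -⟩ | ⟨ha, hb, -⟩ <;> fin_cases k <;> simp [f, ha, hb]
  have hfst : ∀ i k, (σ (i, k)).1 = (σ (i, 0)).1 := by
    intro i k
    fin_cases k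
    · rfl
    · exact (h1 i).symm
  -- If two pairs had the same image pair, the image of `(i, 0)` would also be the image of some
  -- `(j, k)`, because `f j` is onto `Fin 2`.
  have hinj : Function.Injective fun i => (σ (i, 0)).1 := by
    intro i j hij
    obtain ⟨k, hk⟩ := (f j).surjective (f i 0)
    have : σ (i, 0) = σ (j, k) :=
      Prod.ext (hij.trans (hfst j k).symm) (by rw [hf, hf, hk])
    exact congrArg Prod.fst (σ.injective this)
  let π : Equiv.Perm (Fin m) := Equiv.ofBijective _ (Finite.injective_iff_bijective.1 hinj)
  have hσ : σ = Equiv.prodCongrLeft (fun _ => π) * Equiv.prodCongrRight f := by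
    ext1 ⟨i, k⟩
    exact Prod.ext (hfst i k) (hf i k)
  have hprod : ∀ i, B (p (σ (i, 0))) (p (σ (i, 1))) = ((Equiv.Perm.sign (f i) : ℤ) : ℝ) := by
    intro i
    rcases h2 i with ⟨ha, hb, hc⟩ | ⟨ha, hb, hc⟩ <;> simp [f, ha, hc]
  have hsign : Equiv.Perm.sign σ = Equiv.Perm.sign π * Equiv.Perm.sign π *
      ∏ i, Equiv.Perm.sign (f i) := by
    conv_lhs => rw [hσ]
    rw [Equiv.Perm.sign_mul, Equiv.Perm.sign_prodCongrLeft, Equiv.Perm.sign_prodCongrRight,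
      Fin.prod_univ_two]
  rw [Finset.prod_congr rfl fun i _ => hprod i, hsign]
  push_cast
  rw [show ∀ a b : ℝ, a * a * b * b = (a * b) * (a * b) by intros; ring]
  exact mul_self_nonneg _

/-- If `T` is an antisymmetric bilinear map, the coefficient conditions `C_{ij}^l = 0` for distinct
indices and `C_{ij}^j = C_{il}^l` in a basis are equivalent to `T` being determined by its trace. -/
theorem coeff_conditions_iff_eq_trace {r : ℕ} (hr : 2 ≤ r) (b : Module.Basis (Fin r) ℝ V)
    (T : V →ₗ[ℝ] V →ₗ[ℝ] V) (hT : ∀ x y, T x y = -T y x) :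
    ((∀ i j l : Fin r, l ≠ i → i ≠ j → j ≠ l → b.repr (T (b i) (b j)) l = 0) ∧
      (∀ i j l : Fin r, j ≠ i → l ≠ i →
        b.repr (T (b i) (b j)) j = b.repr (T (b i) (b l)) l)) ↔
    ∀ x y, T x y = (1 / ((r : ℝ) - 1)) • (LinearMap.trace ℝ V (T.flip y) • x -
      LinearMap.trace ℝ V (T.flip x) • y) := by
  have hr1 : (r : ℝ) - 1 ≠ 0 := by
    have : (2 : ℝ) ≤ r := by exact_mod_cast hr
    linarith
  have htr : ∀ y, LinearMap.trace ℝ V (T.flip y) = ∑ i, b.repr (T (b i) y) i := by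
    intro y
    rw [LinearMap.trace_eq_matrix_trace ℝ b, Matrix.trace]
    exact Finset.sum_congr rfl fun i _ => by
      rw [Matrix.diag_apply, LinearMap.toMatrix_apply, LinearMap.flip_apply]
  constructor
  · rintro ⟨h1, h2⟩
    -- `R` packages the right-hand side as a bilinear map, so that it can be compared with `T` on
    -- basis vectors only.
    let R : V →ₗ[ℝ] V →ₗ[ℝ] V := (1 / ((r : ℝ) - 1)) •
      (((LinearMap.trace ℝ V ∘ₗ T.flip).smulRight LinearMap.id).flip -
        (LinearMap.trace ℝ V ∘ₗ T.flip).smulRight LinearMap.id)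
    have hR : ∀ x y, R x y = (1 / ((r : ℝ) - 1)) • (LinearMap.trace ℝ V (T.flip y) • x -
      LinearMap.trace ℝ V (T.flip x) • y) := fun x y => by simp [R]
    have hanti : ∀ i, b.repr (T (b i) (b i)) = 0 := fun i => by
      ext k
      have := congrArg (fun v => b.repr v k) (hT (b i) (b i))
      simp only [map_neg, Finsupp.neg_apply] at this
      simpa using (by linarith : b.repr (T (b i) (b i)) k = 0)
    -- In the trace for `b i` the term `k = i` is zero by antisymmetry and each of the other `r - 1`
    -- terms equals `-C_{ij}^j` by the second condition.
    have hc : ∀ i j, i ≠ j →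
        ((r : ℝ) - 1) * b.repr (T (b i) (b j)) j = -LinearMap.trace ℝ V (T.flip (b i)) := by
      intro i j hij
      have : ∀ k, b.repr (T (b k) (b i)) k =
          if k = i then 0 else -b.repr (T (b i) (b j)) j := by
        intro k
        split_ifs with hk
        · rw [hk, hanti]; rfl
        · rw [hT, map_neg, Finsupp.neg_apply, h2 i k j hk hij.symm]
      rw [htr, Finset.sum_congr rfl fun k _ => this k, Finset.sum_ite, Finset.sum_const_zero,
        Finset.sum_const, Finset.filter_ne' , Finset.card_erase_of_mem (Finset.mem_univ _),
        Finset.card_univ, Fintype.card_fin, nsmul_eq_mul, Nat.cast_sub (by omega)]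
      push_cast
      ring
    have hTR : T = R := by
      refine b.ext fun i => b.ext fun j => b.repr.injective (Finsupp.ext fun l => ?_)
      rw [hR]
      rcases eq_or_ne i j with rfl | hij
      · simp [hanti]
      have e1 := hc i j hij
      have e2 := hc j i hij.symm
      have e3 : b.repr (T (b j) (b i)) i = - b.repr (T (b i) (b j)) i := by
        rw [hT (b j), map_neg, Finsupp.neg_apply]
      rcases eq_or_ne l i with rfl | hli
      · simp only [map_smul, map_sub, Finsupp.smul_apply, Finsupp.sub_apply, b.repr_self,
          Finsupp.single_eq_same, Finsupp.single_eq_of_ne hij, smul_eq_mul]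
        field_simp
        rw [e3] at e2
        linarith
      rcases eq_or_ne l j with rfl | hlj
      · simp only [map_smul, map_sub, Finsupp.smul_apply, Finsupp.sub_apply, b.repr_self,
          Finsupp.single_eq_same, Finsupp.single_eq_of_ne hli, smul_eq_mul]
        field_simp
        linarith
      · rw [h1 i j l hli hij hlj.symm]
        simp [Finsupp.single_eq_of_ne hli, Finsupp.single_eq_of_ne hlj]
    intro x y
    rw [← hR, ← hTR]
  · intro h
    refine ⟨fun i j l hli hij hjl => ?_, fun i j l hji hli => ?_⟩
    · rw [h]
      simp [Finsupp.single_eq_of_ne hli, Finsupp.single_eq_of_ne hjl.symm]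
    · rw [h, h (b i) (b l)]
      simp [Finsupp.single_eq_of_ne hji, Finsupp.single_eq_of_ne hli]

/-- If an antisymmetric bilinear map is determined by its trace, then it is given by the 1-form `f`
if and only if its trace is `(r - 1) f`. -/
theorem eq_smul_sub_smul_iff {r : ℕ} (hr : 2 ≤ r) (b : Module.Basis (Fin r) ℝ V)
    (T : V →ₗ[ℝ] V →ₗ[ℝ] V) (f : V →ₗ[ℝ] ℝ) :
    (∀ x y, T x y = f y • x - f x • y) ↔
    (∀ x y, T x y = (1 / ((r : ℝ) - 1)) • (LinearMap.trace ℝ V (T.flip y) • x -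
      LinearMap.trace ℝ V (T.flip x) • y)) ∧
    ∀ y, LinearMap.trace ℝ V (T.flip y) = ((r : ℝ) - 1) * f y := by
  have hr1 : (r : ℝ) - 1 ≠ 0 := by
    have : (2 : ℝ) ≤ r := by exact_mod_cast hr
    linarith
  have : Module.Finite ℝ V := Module.Finite.of_basis b
  constructor
  · intro h
    have htr : ∀ y, LinearMap.trace ℝ V (T.flip y) = ((r : ℝ) - 1) * f y := by
      intro y
      -- The trace is `r f(y)` from the identity minus `f(y)` from the rank-one map.
      have e : T.flip y = f y • LinearMap.id - f.smulRight y := by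
        ext x
        simp [h]
      rw [e, map_sub, map_smul, LinearMap.trace_id, Module.finrank_eq_card_basis b,
        Fintype.card_fin, LinearMap.trace_smulRight, smul_eq_mul]
      ring
    refine ⟨fun x y => ?_, htr⟩
    rw [h, htr, htr, ← sub_eq_zero]
    rw [smul_sub, smul_smul, smul_smul]
    field_simp
    simp
  · rintro ⟨h, htr⟩ x y
    rw [h, htr, htr, smul_sub, smul_smul, smul_smul]
    field_simp

end LinearAlgebra

/-! ### Derivatives, brackets and exterior derivatives read in the preferred charts. -/

section Charts

variable {E H M : Type*} [NormedAddCommGroup E] [NormedSpace ℝ E] [TopologicalSpace H]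
  {I : ModelWithCorners ℝ E H} [I.Boundaryless] [TopologicalSpace M] [ChartedSpace H M]
  [IsManifold I 1 M]

/-- The derivative at `x` of the preferred chart at `x₀`. -/
def chartDeriv (I : ModelWithCorners ℝ E H) {M : Type*} [TopologicalSpace M] [ChartedSpace H M]
    (x₀ x : M) : TangentSpace I x →L[ℝ] E :=
  mfderiv I 𝓘(ℝ, E) (extChartAt I x₀) x

/-- The derivative at `z` of the inverse of the preferred chart at `x₀`. -/
def chartDerivSymm (I : ModelWithCorners ℝ E H) {M : Type*} [TopologicalSpace M]
    [ChartedSpace H M] (x₀ : M) (z : E) : E →L[ℝ] TangentSpace I ((extChartAt I x₀).symm z) :=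
  mfderiv 𝓘(ℝ, E) I (extChartAt I x₀).symm z

theorem mdifferentiableAt_extChartAt_symm {x₀ : M} {z : E} (hz : z ∈ (extChartAt I x₀).target) :
    MDifferentiableAt 𝓘(ℝ, E) I (extChartAt I x₀).symm z := by
  have := mdifferentiableWithinAt_extChartAt_symm hz
  rwa [I.range_eq_univ, mdifferentiableWithinAt_univ] at this

theorem chartDeriv_chartDerivSymm {x₀ : M} {z : E} (hz : z ∈ (extChartAt I x₀).target) (v : E) :
    chartDeriv I x₀ ((extChartAt I x₀).symm z) (chartDerivSymm I x₀ z v) = v := by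
  have := mfderiv_extChartAt_comp_mfderivWithin_extChartAt_symm hz
  rw [I.range_eq_univ, mfderivWithin_univ] at this
  exact congrArg (fun L : E →L[ℝ] E => L v) this

theorem chartDerivSymm_chartDeriv {x₀ : M} {z : E} (hz : z ∈ (extChartAt I x₀).target)
    (v : TangentSpace I ((extChartAt I x₀).symm z)) :
    chartDerivSymm I x₀ z (chartDeriv I x₀ ((extChartAt I x₀).symm z) v) = v := by
  have := mfderivWithin_extChartAt_symm_comp_mfderiv_extChartAt hz
  rw [I.range_eq_univ, mfderivWithin_univ] at this
  exact congrArg (fun L : E →L[ℝ] E => L v) this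

omit [I.Boundaryless] in
theorem isInvertible_chartDeriv {x₀ x : M} (hx : x ∈ (chartAt H x₀).source) :
    (chartDeriv I x₀ x).IsInvertible :=
  isInvertible_mfderiv_extChartAt (by rwa [extChartAt_source])

omit [I.Boundaryless] in
theorem chartDeriv_injective {x₀ x : M} (hx : x ∈ (chartAt H x₀).source) :
    Function.Injective (chartDeriv I x₀ x) :=
  (isInvertible_chartDeriv hx).injective

omit [I.Boundaryless] in
theorem chartDeriv_surjective {x₀ x : M} (hx : x ∈ (chartAt H x₀).source) :
    Function.Surjective (chartDeriv I x₀ x) :=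
  (isInvertible_chartDeriv hx).surjective

-- The tangent space at `x` is the model space, identified through the preferred chart at `x`
-- itself. Thus a tangent vector at the base point is its own coordinate vector, which is used
-- repeatedly below.
omit [I.Boundaryless] in
theorem chartDeriv_self (x : M) (v : TangentSpace I x) : chartDeriv I x x v = v := by
  rw [chartDeriv, mfderiv_extChartAt_self]
  rfl

variable {F : Type*} [NormedAddCommGroup F] [NormedSpace ℝ F]

theorem differentiableAt_comp_extChartAt_symm {f : M → F} {x₀ x : M}
    (hx : x ∈ (chartAt H x₀).source) (hf : MDifferentiableAt I 𝓘(ℝ, F) f x) :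
    DifferentiableAt ℝ (f ∘ (extChartAt I x₀).symm) (extChartAt I x₀ x) := by
  have hx' : x ∈ (extChartAt I x₀).source := by rwa [extChartAt_source]
  rw [← mdifferentiableAt_iff_differentiableAt]
  refine MDifferentiableAt.comp _ ?_
    (mdifferentiableAt_extChartAt_symm ((extChartAt I x₀).map_source hx'))
  rwa [(extChartAt I x₀).left_inv hx']

/-- The derivative of a vector-valued function on a manifold, computed in a chart. -/
theorem mfderiv_eq_fderiv_chart {f : M → F} {x₀ x : M}
    (hx : x ∈ (chartAt H x₀).source) (hf : MDifferentiableAt I 𝓘(ℝ, F) f x)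
    (v : TangentSpace I x) :
    (mfderiv I 𝓘(ℝ, F) f x v : F) =
      fderiv ℝ (f ∘ (extChartAt I x₀).symm) (extChartAt I x₀ x) (chartDeriv I x₀ x v) := by
  have hx' : x ∈ (extChartAt I x₀).source := by rwa [extChartAt_source]
  have hd := differentiableAt_comp_extChartAt_symm hx hf
  have heq : f =ᶠ[𝓝 x] (f ∘ (extChartAt I x₀).symm) ∘ extChartAt I x₀ := by
    filter_upwards [extChartAt_source_mem_nhds' hx'] with y hy
    exact congrArg f ((extChartAt I x₀).left_inv hy).symm
  rw [heq.mfderiv_eq, mfderiv_comp x hd.mdifferentiableAt (mdifferentiableAt_extChartAt hx),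
    mfderiv_eq_fderiv]
  rfl

variable {E' H' N : Type*} [NormedAddCommGroup E'] [NormedSpace ℝ E'] [TopologicalSpace H']
  {J : ModelWithCorners ℝ E' H'} [TopologicalSpace N] [ChartedSpace H' N]
  [IsManifold J 1 N]

/-- The derivative of a map between manifolds, computed in charts. -/
theorem chartDeriv_mfderiv {f : M → N} {x₀ x : M} {y₀ : N}
    (hx : x ∈ (chartAt H x₀).source) (hy : f x ∈ (chartAt H' y₀).source)
    (hf : MDifferentiableAt I J f x) (v : TangentSpace I x) :
    chartDeriv J y₀ (f x) (mfderiv I J f x v) =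
      fderiv ℝ (extChartAt J y₀ ∘ f ∘ (extChartAt I x₀).symm) (extChartAt I x₀ x)
        (chartDeriv I x₀ x v) := by
  have h := mdifferentiableAt_extChartAt (I := J) hy
  rw [← Function.comp_assoc, ← mfderiv_eq_fderiv_chart hx (h.comp x hf), mfderiv_comp x h hf]
  rfl

/-- The expression of a vector field in the preferred chart at `x₀`. -/
def chartField (I : ModelWithCorners ℝ E H) {M : Type*} [TopologicalSpace M] [ChartedSpace H M]
    (x₀ : M) (X : ∀ x : M, TangentSpace I x) (z : E) : E :=
  chartDeriv I x₀ ((extChartAt I x₀).symm z) (X ((extChartAt I x₀).symm z))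

theorem mpullbackWithin_eq_chartField {x₀ : M} (X : ∀ x : M, TangentSpace I x) {z : E}
    (hz : z ∈ (extChartAt I x₀).target) :
    VectorField.mpullbackWithin 𝓘(ℝ, E) I (extChartAt I x₀).symm X (Set.range I) z =
      chartField I x₀ X z := by
  have hinv := isInvertible_mfderivWithin_extChartAt_symm hz
  refine hinv.injective ?_
  rw [VectorField.mpullbackWithin_apply, hinv.self_apply_inverse]
  rw [I.range_eq_univ, mfderivWithin_univ]
  exact (chartDerivSymm_chartDeriv hz _).symm

/-- The Lie bracket of vector fields, computed in a chart. -/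
theorem chartDeriv_mlieBracket (x₀ : M) (X Y : ∀ x : M, TangentSpace I x) :
    chartDeriv I x₀ x₀ (VectorField.mlieBracket I X Y x₀) =
      VectorField.lieBracket ℝ (chartField I x₀ X) (chartField I x₀ Y) (extChartAt I x₀ x₀) := by
  have hev : ∀ X : ∀ x : M, TangentSpace I x,
      VectorField.mpullbackWithin 𝓘(ℝ, E) I (extChartAt I x₀).symm X (Set.range I)
        =ᶠ[𝓝 (extChartAt I x₀ x₀)] chartField I x₀ X := by
    intro X
    filter_upwards [extChartAt_target_mem_nhds x₀] with z hz
    exact mpullbackWithin_eq_chartField X hz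
  have hinv := isInvertible_chartDeriv (I := I) (mem_chart_source H x₀)
  rw [← VectorField.mlieBracketWithin_univ, VectorField.mlieBracketWithin_apply]
  refine (hinv.self_apply_inverse _).trans ?_
  rw [show (extChartAt I x₀).symm ⁻¹' Set.univ ∩ Set.range I = Set.univ by
    rw [I.range_eq_univ, Set.preimage_univ, Set.univ_inter]]
  exact (congrFun VectorField.lieBracketWithin_univ _).trans
    (Filter.EventuallyEq.lieBracket_vectorField_eq (hev X) (hev Y))

/-- The expression of a 1-form in the preferred chart at `x₀`. -/
def chartForm (I : ModelWithCorners ℝ E H) {M : Type*} [TopologicalSpace M] [ChartedSpace H M]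
    (x₀ : M) (θ : ∀ x : M, TangentSpace I x →L[ℝ] ℝ) (z : E) : E →L[ℝ] ℝ :=
  (θ ((extChartAt I x₀).symm z)).comp (chartDerivSymm I x₀ z)

/-- The exterior derivative of a 1-form can be computed in any of the preferred charts. -/
theorem extDerivOneForm_eq_fderiv_chartForm [IsManifold I 2 M]
    (θ : ∀ x : M, TangentSpace I x →L[ℝ] ℝ) {x₀ x : M} (hx : x ∈ (chartAt H x₀).source)
    (hθ : DifferentiableAt ℝ (chartForm I x₀ θ) (extChartAt I x₀ x)) (u v : TangentSpace I x) :
    extDerivOneForm I θ x u v =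
      fderiv ℝ (chartForm I x₀ θ) (extChartAt I x₀ x) (chartDeriv I x₀ x u)
        (chartDeriv I x₀ x v) -
      fderiv ℝ (chartForm I x₀ θ) (extChartAt I x₀ x) (chartDeriv I x₀ x v)
        (chartDeriv I x₀ x u) := by
  have hx' : x ∈ (extChartAt I x₀).source := by rwa [extChartAt_source]
  set c := extChartAt I x
  set c₀ := extChartAt I x₀
  set ψ : E → E := c₀ ∘ c.symm
  have hψc : ψ (c x) = c₀ x := by simp [ψ, c]
  have hψ : ContDiffAt ℝ 2 ψ (c x) := by
    rw [← contMDiffAt_iff_contDiffAt]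
    refine ContMDiffAt.comp (I' := I) _ ?_ ?_
    · rw [extChartAt_to_inv]
      exact contMDiffAt_extChartAt' hx
    · exact (contMDiffOn_extChartAt_symm x).contMDiffAt (extChartAt_target_mem_nhds x)
  have hev : ∀ᶠ z in 𝓝 (c x), z ∈ c.target ∧ c.symm z ∈ c₀.source :=
    Filter.Eventually.and (extChartAt_target_mem_nhds x)
      ((continuousAt_extChartAt_symm x).tendsto.eventually
        (by rw [extChartAt_to_inv]; exact extChartAt_source_mem_nhds' hx'))
  -- The two chart expressions are related by pullback along the transition map `ψ`. Differentiating
  -- produces a term in the second derivative of `ψ`, which is symmetric and drops out after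
  -- antisymmetrization.
  have hform : chartForm I x θ =ᶠ[𝓝 (c x)]
      fun z => (chartForm I x₀ θ (ψ z)).comp (fderiv ℝ ψ z) := by
    filter_upwards [hev] with z ⟨hz, hz'⟩
    have e1 : c₀.symm (ψ z) = c.symm z := c₀.left_inv hz'
    have hdc := mdifferentiableAt_extChartAt_symm (I := I) (x₀ := x) hz
    have hz'' : c.symm z ∈ (chartAt H x₀).source := by rwa [← extChartAt_source (I := I)]
    have hd0 := mdifferentiableAt_extChartAt (I := I) hz''
    have e2 : ∀ v : E, fderiv ℝ ψ z v = chartDeriv I x₀ (c.symm z) (chartDerivSymm I x z v) := by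
      intro v
      rw [← mfderiv_eq_fderiv, mfderiv_comp z hd0 hdc]
      rfl
    ext v
    have e3 : ∀ (p p' : M) (_ : p = p') (L : E →L[ℝ] E) (w : E),
        (θ p : E →L[ℝ] ℝ) w = (θ p' : E →L[ℝ] ℝ) w := by
      rintro p _ rfl L w
      rfl
    have ht : ψ z ∈ c₀.target := c₀.map_source hz'
    have e4 : (chartDerivSymm I x₀ (ψ z) (fderiv ℝ ψ z v) : E) = chartDerivSymm I x z v := by
      rw [e2]
      have := chartDerivSymm_chartDeriv (I := I) (x₀ := x₀) ht
      rw [e1] at this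
      exact this _
    refine (e3 _ _ e1.symm (ContinuousLinearMap.id ℝ E) _).trans ?_
    exact congrArg (θ (c₀.symm (ψ z)) : E →L[ℝ] ℝ) e4.symm
  have hψd : HasFDerivAt ψ (fderiv ℝ ψ (c x)) (c x) :=
    (hψ.differentiableAt (by norm_num)).hasFDerivAt
  have hψdd : HasFDerivAt (fderiv ℝ ψ) (fderiv ℝ (fderiv ℝ ψ) (c x)) (c x) :=
    ((hψ.fderiv_right (m := 1) (by norm_num)).differentiableAt (by norm_num)).hasFDerivAt
  have hsymm : ∀ a b : E, fderiv ℝ (fderiv ℝ ψ) (c x) a b = fderiv ℝ (fderiv ℝ ψ) (c x) b a :=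
    fun a b => (hψ.isSymmSndFDerivAt (by simp)).eq a b
  rw [← hψc] at hθ
  have hder := (hθ.hasFDerivAt.comp (c x) hψd).clm_comp hψdd
  have hfd : fderiv ℝ (chartForm I x θ) (c x) = _ := hform.fderiv_eq.trans hder.fderiv
  have hcd : ∀ w : TangentSpace I x, chartDeriv I x₀ x w =
      fderiv ℝ ψ (c x) (chartDeriv I x x w) := by
    intro w
    exact mfderiv_eq_fderiv_chart (mem_chart_source H x) (mdifferentiableAt_extChartAt hx) w
  change fderiv ℝ (chartForm I x θ) (c x) (chartDeriv I x x u) (chartDeriv I x x v) -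
    fderiv ℝ (chartForm I x θ) (c x) (chartDeriv I x x v) (chartDeriv I x x u) = _
  rw [hfd, hcd, hcd, ← hψc]
  simp only [add_apply, ContinuousLinearMap.comp_apply,
    ContinuousLinearMap.compL_apply, ContinuousLinearMap.flip_apply, Function.comp_apply]
  rw [hsymm (chartDeriv I x x u)]
  ring

end Charts

/-! ### Coordinate frames of arbitrary charts, and global extension of tangent vectors. -/

section CoordinateFields

variable {r : ℕ} {S : Type*} [TopologicalSpace S] [ChartedSpace (EuclideanSpace ℝ (Fin r)) S]
  [IsManifold (𝓡 r) ∞ S] {e : OpenPartialHomeomorph S (EuclideanSpace ℝ (Fin r))}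

theorem minSmoothness_two_le : minSmoothness ℝ 2 ≤ (∞ : WithTop ℕ∞) := by
  rw [minSmoothness_of_isRCLikeNormedField]
  exact WithTop.coe_le_coe.2 le_top

theorem isManifold_minSmoothness : IsManifold (𝓡 r) (minSmoothness ℝ 2) S :=
  IsManifold.of_le (n := ∞) minSmoothness_two_le

omit [IsManifold (𝓡 r) ∞ S] in
theorem isInvertible_mfderiv_of_mem_maximalAtlas
    (he : e ∈ IsManifold.maximalAtlas (𝓡 r) ∞ S) {s : S} (hs : s ∈ e.source) :
    (mfderiv (𝓡 r) (𝓡 r) e s).IsInvertible := by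
  have hd : e.MDifferentiable (𝓡 r) (𝓡 r) :=
    ⟨(contMDiffOn_of_mem_maximalAtlas he).mdifferentiableOn (by simp),
      (contMDiffOn_symm_of_mem_maximalAtlas he).mdifferentiableOn (by simp)⟩
  exact ⟨hd.mfderiv hs, rfl⟩

theorem contMDiffAt_coordField (he : e ∈ IsManifold.maximalAtlas (𝓡 r) ∞ S) {s : S}
    (hs : s ∈ e.source) (i : Fin r) :
    ContMDiffAt (𝓡 r) (𝓡 r).tangent ∞
      (fun s => (⟨s, coordField e i s⟩ : TangentBundle (𝓡 r) S)) s := by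
  have h1 : ContMDiffAt (𝓡 r) (𝓡 r).tangent ∞ (fun y : EuclideanSpace ℝ (Fin r) =>
      (⟨y, EuclideanSpace.single i (1 : ℝ)⟩ : TangentBundle (𝓡 r) (EuclideanSpace ℝ (Fin r))))
      (e s) := by
    exact contMDiffAt_vectorSpace_iff_contDiffAt.2 contDiffAt_const
  exact h1.mpullback_vectorField_preimage (contMDiffAt_of_mem_maximalAtlas he hs)
    (isInvertible_mfderiv_of_mem_maximalAtlas he hs) (by simp)

/-- The basis of coordinate vectors at a point in the domain of a chart. -/
def coordBasis (he : e ∈ IsManifold.maximalAtlas (𝓡 r) ∞ S) {s : S} (hs : s ∈ e.source) :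
    Module.Basis (Fin r) ℝ (TangentSpace (𝓡 r) s) :=
  Module.Basis.ofEquivFun <|
    (LinearEquiv.ofBijective (mfderiv (𝓡 r) (𝓡 r) e s).toLinearMap
      (isInvertible_mfderiv_of_mem_maximalAtlas he hs).bijective).trans
      (WithLp.linearEquiv 2 ℝ (Fin r → ℝ))

omit [IsManifold (𝓡 r) ∞ S] in
theorem coordBasis_repr (he : e ∈ IsManifold.maximalAtlas (𝓡 r) ∞ S) {s : S} (hs : s ∈ e.source)
    (v : TangentSpace (𝓡 r) s) (j : Fin r) :
    (coordBasis he hs).repr v j = coordCovector e j s v := rfl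

omit [IsManifold (𝓡 r) ∞ S] in
theorem coordBasis_apply (he : e ∈ IsManifold.maximalAtlas (𝓡 r) ∞ S) {s : S} (hs : s ∈ e.source)
    (i : Fin r) : coordBasis he hs i = coordField e i s := by
  have hinv := isInvertible_mfderiv_of_mem_maximalAtlas he hs
  refine hinv.injective ?_
  rw [coordField, hinv.self_apply_inverse]
  have := (coordBasis he hs).equivFun.apply_symm_apply (Pi.single i 1)
  rw [Module.Basis.equivFun_symm_apply] at this
  refine PiLp.ext (p := 2) (α := fun _ : Fin r => ℝ) fun j => ?_
  have h2 := congrFun this j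
  simp only [Pi.single_apply, ite_smul, one_smul, zero_smul, Finset.sum_ite_eq',
    Finset.mem_univ, if_true] at h2
  simp only [PiLp.single_apply]
  exact h2

/-- Every tangent vector extends to a smooth vector field. -/
theorem exists_isSmoothField_eq [T2Space S] (s : S) (v : TangentSpace (𝓡 r) s) :
    ∃ Y : ∀ s : S, TangentSpace (𝓡 r) s, ChaplyginSystem.IsSmoothField Y ∧ Y s = v := by
  obtain ⟨u, hu, hsm⟩ := FiberBundle.exists_contMDiffOn_extend (k := ∞) (𝓡 r)
    (EuclideanSpace ℝ (Fin r)) v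
  obtain ⟨f, hf, hfu⟩ :=
    ((SmoothBumpFunction.nhds_basis_tsupport (I := 𝓡 r) s).mem_iff.1 (interior_mem_nhds.2 hu))
  -- A bump function supported where the local extension is smooth, and equal to one at `s`, makes
  -- the extension global.
  refine ⟨(f : S → ℝ) • FiberBundle.extend (EuclideanSpace ℝ (Fin r)) v, ?_, by simp⟩
  exact ContMDiffOn.smul_section_of_tsupport f.contMDiff.contMDiffOn isOpen_interior hfu
    (hsm.mono interior_subset)

end CoordinateFields

/-! ### Local sections of submersions and descent of smoothness. -/

section Descent

variable {n r : ℕ} {Q S : Type*}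
  [TopologicalSpace Q] [ChartedSpace (EuclideanSpace ℝ (Fin n)) Q] [IsManifold (𝓡 n) ∞ Q]
  [TopologicalSpace S] [ChartedSpace (EuclideanSpace ℝ (Fin r)) S] [IsManifold (𝓡 r) ∞ S]

/-- A submersion has local sections. -/
theorem exists_local_section {p : Q → S} {q : Q} (hp : ContMDiffAt (𝓡 n) (𝓡 r) ∞ p q)
    (hsurj : Function.Surjective (mfderiv (𝓡 n) (𝓡 r) p q)) :
    ∃ σ : S → Q, σ (p q) = q ∧ ContMDiffAt (𝓡 r) (𝓡 n) ∞ σ (p q) ∧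
      ∀ᶠ s in 𝓝 (p q), p (σ s) = s := by
  set c := extChartAt (𝓡 n) q
  set d := extChartAt (𝓡 r) (p q)
  have hd : ContMDiffAt (𝓡 r) 𝓘(ℝ, EuclideanSpace ℝ (Fin r)) ∞ d (p q) := contMDiffAt_extChartAt
  have hc : ContMDiffAt 𝓘(ℝ, EuclideanSpace ℝ (Fin n)) (𝓡 n) ∞ c.symm (c q) :=
    (contMDiffOn_extChartAt_symm q).contMDiffAt (extChartAt_target_mem_nhds q)
  have hcq : c.symm (c q) = q := extChartAt_to_inv q
  have hpc : ContMDiffAt 𝓘(ℝ, EuclideanSpace ℝ (Fin n)) (𝓡 r) ∞ (p ∘ c.symm) (c q) :=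
    ContMDiffAt.comp _ (by rwa [hcq]) hc
  have hP : ContDiffAt ℝ ∞ (d ∘ p ∘ c.symm) (c q) := by
    rw [← contMDiffAt_iff_contDiffAt]
    exact ContMDiffAt.comp _ (by rw [Function.comp_apply, hcq]; exact hd) hpc
  have hPs : Function.Surjective (fderiv ℝ (d ∘ p ∘ c.symm) (c q)) := by
    intro w
    obtain ⟨u, hu⟩ := chartDeriv_surjective (I := 𝓡 r) (mem_chart_source _ (p q)) w
    obtain ⟨v, hv⟩ := hsurj u
    refine ⟨chartDeriv (𝓡 n) q q v, ?_⟩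
    rw [← hu, ← hv]
    exact (chartDeriv_mfderiv (mem_chart_source _ q) (mem_chart_source _ (p q))
      (hp.mdifferentiableAt (by simp)) v).symm
  obtain ⟨R, hR⟩ := ContinuousLinearMap.exists_rightInverse_of_surjective _
    (LinearMap.range_eq_top.2 hPs)
  -- Restricting `p` to the affine slice through `q` spanned by a right inverse `R` of its
  -- derivative gives a map with identity derivative at `0`; the section is its local inverse
  -- followed by the slice.
  set g : EuclideanSpace ℝ (Fin r) → EuclideanSpace ℝ (Fin r) :=
    fun y => (d ∘ p ∘ c.symm) (c q + R y)
  have hg0 : g 0 = d (p q) := by simp only [g, map_zero, add_zero, Function.comp_apply, hcq]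
  have hRd : ContDiff ℝ ∞ (fun y : EuclideanSpace ℝ (Fin r) => c q + R y) :=
    contDiff_const.add R.contDiff
  have hg : ContDiffAt ℝ ∞ g 0 :=
    ContDiffAt.comp (g := d ∘ p ∘ c.symm) 0 (by rw [map_zero, add_zero]; exact hP) hRd.contDiffAt
  have hg' : HasFDerivAt g
      ((ContinuousLinearEquiv.refl ℝ (EuclideanSpace ℝ (Fin r)) :
        EuclideanSpace ℝ (Fin r) →L[ℝ] EuclideanSpace ℝ (Fin r))) 0 := by
    have h1 : HasFDerivAt (fun y : EuclideanSpace ℝ (Fin r) => c q + R y) R 0 :=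
      R.hasFDerivAt.const_add _
    have h2 : HasFDerivAt (d ∘ p ∘ c.symm) (fderiv ℝ (d ∘ p ∘ c.symm) (c q)) (c q + R 0) := by
      rw [map_zero, add_zero]
      exact (hP.differentiableAt (by simp)).hasFDerivAt
    have h3 := h2.comp 0 h1
    rw [hR] at h3
    exact h3
  have hn : (∞ : WithTop ℕ∞) ≠ 0 := by simp
  set gi := hg.localInverse hg' hn
  have hgi0 : gi (d (p q)) = 0 := by
    rw [← hg0]
    exact hg.localInverse_apply_image hg' hn
  have hgi : ContDiffAt ℝ ∞ gi (d (p q)) := by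
    rw [← hg0]
    exact hg.to_localInverse hg' hn
  have hgr : ∀ᶠ y in 𝓝 (d (p q)), g (gi y) = y := by
    rw [← hg0]
    exact (hg.hasStrictFDerivAt' hg' hn).eventually_right_inverse
  have hσq : c.symm (c q + R (gi (d (p q)))) = q := by rw [hgi0, map_zero, add_zero, hcq]
  have hσ : ContMDiffAt (𝓡 r) (𝓡 n) ∞ (fun s => c.symm (c q + R (gi (d s)))) (p q) := by
    have h1 : ContMDiffAt (𝓡 r) 𝓘(ℝ, EuclideanSpace ℝ (Fin n)) ∞
        (fun s => c q + R (gi (d s))) (p q) :=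
      (hRd.contDiffAt.comp _ hgi).comp_contMDiffAt hd
    refine ContMDiffAt.comp _ ?_ h1
    rw [hgi0, map_zero, add_zero]
    exact hc
  refine ⟨fun s => c.symm (c q + R (gi (d s))), hσq, hσ, ?_⟩
  have hcont : ContinuousAt (fun s => p (c.symm (c q + R (gi (d s))))) (p q) :=
    ContinuousAt.comp (by rw [hσq]; exact hp.continuousAt) hσ.continuousAt
  have hsrc : ∀ᶠ s in 𝓝 (p q), p (c.symm (c q + R (gi (d s)))) ∈ d.source :=
    hcont.eventually (by simp only [hσq]; exact extChartAt_source_mem_nhds (p q))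
  filter_upwards [hsrc, extChartAt_source_mem_nhds (I := 𝓡 r) (p q),
    hd.continuousAt.eventually hgr] with s h1 h2 h3
  exact d.injOn h1 h2 h3

/-- A function on the base of a submersion is smooth if its pullback is. -/
theorem contMDiffAt_of_comp_submersion {p : Q → S} {q : Q}
    (hp : ContMDiffAt (𝓡 n) (𝓡 r) ∞ p q)
    (hsurj : Function.Surjective (mfderiv (𝓡 n) (𝓡 r) p q)) {F : Type*} [NormedAddCommGroup F]
    [NormedSpace ℝ F] {f : S → F} (hf : ContMDiffAt (𝓡 n) 𝓘(ℝ, F) ∞ (f ∘ p) q) :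
    ContMDiffAt (𝓡 r) 𝓘(ℝ, F) ∞ f (p q) := by
  obtain ⟨σ, hσq, hσ, hs⟩ := exists_local_section hp hsurj
  rw [← hσq] at hf
  refine (hf.comp _ hσ).congr_of_eventuallyEq ?_
  filter_upwards [hs] with s h
  simp [h]

end Descent

/-! ### Canonical coordinates on the cotangent bundle. -/

section CotangentCharts

variable {m : ℕ} {M : Type*} [TopologicalSpace M] [ChartedSpace (EuclideanSpace ℝ (Fin m)) M]
  [IsManifold (𝓡 m) ∞ M]

/-- The covector underlying a point of the cotangent bundle. -/
def CotangentBundle.cov (a : CotangentBundle m M) : TangentSpace (𝓡 m) a.1 →L[ℝ] ℝ := a.2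

theorem mem_chartAt_cotangent_source {a₀ a : CotangentBundle m M} :
    a ∈ (chartAt (ModelProd (EuclideanSpace ℝ (Fin m)) (EuclideanSpace ℝ (Fin m) →L[ℝ] ℝ))
      a₀).source ↔ a.1 ∈ (chartAt (EuclideanSpace ℝ (Fin m)) a₀.1).source := by
  simp only [FiberBundle.chartedSpace_chartAt, mfld_simps]
  exact ⟨fun h => h.1.1, fun h => ⟨⟨h, Set.mem_univ _⟩, h⟩⟩

theorem extChartAt_cotangent_fst (a₀ a : CotangentBundle m M) :
    (extChartAt (cotangentModel m) a₀ a).1 = extChartAt (𝓡 m) a₀.1 a.1 := by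
  rw [extChartAt, OpenPartialHomeomorph.extend_coe, Function.comp_apply, hom_chart]
  rfl

/-- The chart comes from the bundle of homomorphisms into the trivial line bundle, whose
trivialization is the identity. Only precomposition with the inverse derivative of the base chart
remains, so the chart of `T*M` is the classical pair `(x, p)`. -/
theorem extChartAt_cotangent_snd {a₀ a : CotangentBundle m M}
    (ha : a.1 ∈ (chartAt (EuclideanSpace ℝ (Fin m)) a₀.1).source) (v : EuclideanSpace ℝ (Fin m)) :
    (extChartAt (cotangentModel m) a₀ a).2 v =
      a.cov (chartDerivSymm (𝓡 m) a₀.1 (extChartAt (𝓡 m) a₀.1 a.1) v :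
        EuclideanSpace ℝ (Fin m)) := by
  have h := TangentBundle.symmL_trivializationAt (I := 𝓡 m) ha
  rw [ModelWithCorners.range_eq_univ, mfderivWithin_univ] at h
  rw [extChartAt, OpenPartialHomeomorph.extend_coe, Function.comp_apply, hom_chart]
  change ContinuousLinearMap.inCoordinates _ _ _ _ _ _ _ _ a.2 v = _
  have h2 : ∀ x : ℝ, (trivializationAt ℝ (Bundle.Trivial M ℝ) a₀.1).continuousLinearMapAt ℝ a.1 x
      = x := fun x => by simp
  refine (h2 _).trans ?_
  exact congrArg (fun L : EuclideanSpace ℝ (Fin m) →L[ℝ] EuclideanSpace ℝ (Fin m) => a.cov (L v)) h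

theorem extChartAt_cotangent_target (a₀ : CotangentBundle m M) :
    (extChartAt (cotangentModel m) a₀).target = (extChartAt (𝓡 m) a₀.1).target ×ˢ Set.univ := by
  rw [FiberBundle.extChartAt_target]
  congr 1
  refine Set.inter_eq_left.2 fun z hz => ?_
  have := (extChartAt (𝓡 m) a₀.1).map_target hz
  rw [extChartAt_source] at this
  exact ⟨this, Set.mem_univ _⟩

theorem extChartAt_cotangent_symm_fst {a₀ : CotangentBundle m M}
    {z : EuclideanSpace ℝ (Fin m) × (EuclideanSpace ℝ (Fin m) →L[ℝ] ℝ)}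
    (hz : z.1 ∈ (extChartAt (𝓡 m) a₀.1).target) :
    ((extChartAt (cotangentModel m) a₀).symm z).1 = (extChartAt (𝓡 m) a₀.1).symm z.1 := by
  have hz' : z ∈ (extChartAt (cotangentModel m) a₀).target := by
    rw [extChartAt_cotangent_target]; exact ⟨hz, trivial⟩
  have hs := (extChartAt (cotangentModel m) a₀).map_target hz'
  rw [extChartAt_source, mem_chartAt_cotangent_source, ← extChartAt_source (𝓡 m)] at hs
  refine (extChartAt (𝓡 m) a₀.1).injOn hs ((extChartAt (𝓡 m) a₀.1).map_target hz) ?_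
  rw [← extChartAt_cotangent_fst, (extChartAt (cotangentModel m) a₀).right_inv hz',
    (extChartAt (𝓡 m) a₀.1).right_inv hz]

theorem cov_eq_extChartAt_cotangent_snd {a₀ a : CotangentBundle m M}
    (ha : a.1 ∈ (chartAt (EuclideanSpace ℝ (Fin m)) a₀.1).source) (v : TangentSpace (𝓡 m) a.1) :
    a.cov v = (extChartAt (cotangentModel m) a₀ a).2 (chartDeriv (𝓡 m) a₀.1 a.1 v) := by
  rw [extChartAt_cotangent_snd ha]
  have hs' : a.1 ∈ (extChartAt (𝓡 m) a₀.1).source := by rwa [extChartAt_source]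
  have h2 := chartDerivSymm_chartDeriv (I := 𝓡 m) ((extChartAt (𝓡 m) a₀.1).map_source hs')
  rw [(extChartAt (𝓡 m) a₀.1).left_inv hs'] at h2
  exact congrArg a.cov (h2 v).symm

theorem cov_extChartAt_cotangent_symm {a₀ : CotangentBundle m M}
    {z : EuclideanSpace ℝ (Fin m) × (EuclideanSpace ℝ (Fin m) →L[ℝ] ℝ)}
    (hz : z.1 ∈ (extChartAt (𝓡 m) a₀.1).target)
    (v : TangentSpace (𝓡 m) ((extChartAt (cotangentModel m) a₀).symm z).1) :
    ((extChartAt (cotangentModel m) a₀).symm z).cov v = z.2 (chartDeriv (𝓡 m) a₀.1 _ v) := by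
  have hz' : z ∈ (extChartAt (cotangentModel m) a₀).target := by
    rw [extChartAt_cotangent_target]; exact ⟨hz, trivial⟩
  have hs := (extChartAt (cotangentModel m) a₀).map_target hz'
  rw [extChartAt_source, mem_chartAt_cotangent_source] at hs
  rw [cov_eq_extChartAt_cotangent_snd hs, (extChartAt (cotangentModel m) a₀).right_inv hz']

/-- The Liouville form is `p dx` in canonical coordinates, since the footpoint projection reads as
`Prod.fst`. It is linear in the point, so its derivative is constant and `Ω_can` is the standard
form throughout the chart. -/
theorem chartForm_liouvilleForm {a₀ : CotangentBundle m M}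
    {z : EuclideanSpace ℝ (Fin m) × (EuclideanSpace ℝ (Fin m) →L[ℝ] ℝ)}
    (hz : z.1 ∈ (extChartAt (𝓡 m) a₀.1).target) :
    chartForm (cotangentModel m) a₀ liouvilleForm z =
      z.2.comp (ContinuousLinearMap.fst ℝ (EuclideanSpace ℝ (Fin m)) _) := by
  have hz' : z ∈ (extChartAt (cotangentModel m) a₀).target := by
    rw [extChartAt_cotangent_target]; exact ⟨hz, trivial⟩
  have hs := (extChartAt (cotangentModel m) a₀).map_target hz'
  rw [extChartAt_source] at hs
  refine ContinuousLinearMap.ext fun w => ?_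
  set a := (extChartAt (cotangentModel m) a₀).symm z
  have hproj : MDifferentiableAt (cotangentModel m) (𝓡 m)
      (fun β : CotangentBundle m M => β.1) a :=
    (Bundle.contMDiffAt_proj (n := ∞) _).mdifferentiableAt (by simp)
  change a.cov (mfderiv (cotangentModel m) (𝓡 m) (fun β : CotangentBundle m M => β.1) a
    (chartDerivSymm (cotangentModel m) a₀ z w)) = _
  rw [cov_extChartAt_cotangent_symm hz]
  refine (congrArg z.2 (chartDeriv_mfderiv hs (mem_chartAt_cotangent_source.1 hs) hproj _)).trans ?_
  rw [chartDeriv_chartDerivSymm hz', (extChartAt (cotangentModel m) a₀).right_inv hz']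
  have hev : extChartAt (𝓡 m) a₀.1 ∘ (fun β : CotangentBundle m M => β.1) ∘
      (extChartAt (cotangentModel m) a₀).symm =ᶠ[𝓝 z] Prod.fst := by
    filter_upwards [(isOpen_extChartAt_target a₀).mem_nhds hz'] with y hy
    have hy1 : y.1 ∈ (extChartAt (𝓡 m) a₀.1).target := by
      rw [extChartAt_cotangent_target] at hy
      exact hy.1
    simp only [Function.comp_apply]
    rw [extChartAt_cotangent_symm_fst hy1, (extChartAt (𝓡 m) a₀.1).right_inv hy1]
  rw [hev.fderiv_eq, fderiv_fst]
  rfl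

/-- The standard symplectic form of `V × V*`. -/
def stdForm (m : ℕ) : (EuclideanSpace ℝ (Fin m) × (EuclideanSpace ℝ (Fin m) →L[ℝ] ℝ)) →ₗ[ℝ]
    (EuclideanSpace ℝ (Fin m) × (EuclideanSpace ℝ (Fin m) →L[ℝ] ℝ)) →ₗ[ℝ] ℝ :=
  LinearMap.mk₂ ℝ (fun U V => V.2 U.1 - U.2 V.1)
    (fun _ _ _ => by simp; ring) (fun _ _ _ => by simp; ring)
    (fun _ _ _ => by simp; ring) (fun _ _ _ => by simp; ring)

theorem stdForm_apply (U V : EuclideanSpace ℝ (Fin m) × (EuclideanSpace ℝ (Fin m) →L[ℝ] ℝ)) :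
    stdForm m U V = V.2 U.1 - U.2 V.1 := rfl

/-- The linear map sending `(x, p)` to the covector `(u, w) ↦ p u`. -/
def sndCompFst (m : ℕ) : (EuclideanSpace ℝ (Fin m) × (EuclideanSpace ℝ (Fin m) →L[ℝ] ℝ)) →L[ℝ]
    ((EuclideanSpace ℝ (Fin m) × (EuclideanSpace ℝ (Fin m) →L[ℝ] ℝ)) →L[ℝ] ℝ) :=
  ((ContinuousLinearMap.compL ℝ (EuclideanSpace ℝ (Fin m) × (EuclideanSpace ℝ (Fin m) →L[ℝ] ℝ))
    (EuclideanSpace ℝ (Fin m)) ℝ).flip (ContinuousLinearMap.fst ℝ _ _)).comp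
      (ContinuousLinearMap.snd ℝ _ _)

theorem hasFDerivAt_chartForm_liouvilleForm {a₀ a : CotangentBundle m M}
    (ha : a.1 ∈ (chartAt (EuclideanSpace ℝ (Fin m)) a₀.1).source) :
    HasFDerivAt (chartForm (cotangentModel m) a₀ (liouvilleForm (M := M))) (sndCompFst m)
      (extChartAt (cotangentModel m) a₀ a) := by
  have ha' : a ∈ (extChartAt (cotangentModel m) a₀).source := by
    rw [extChartAt_source]
    exact mem_chartAt_cotangent_source.2 ha
  have h : HasFDerivAt (sndCompFst m) (sndCompFst m) (extChartAt (cotangentModel m) a₀ a) :=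
    by apply ContinuousLinearMap.hasFDerivAt
  refine h.congr_of_eventuallyEq ?_
  filter_upwards [extChartAt_target_mem_nhds' ((extChartAt _ a₀).map_source ha')] with y hy
  rw [extChartAt_cotangent_target] at hy
  exact chartForm_liouvilleForm hy.1

/-- The canonical symplectic form in cotangent coordinates. -/
theorem canonicalForm_eq_stdForm {a₀ a : CotangentBundle m M}
    (ha : a.1 ∈ (chartAt (EuclideanSpace ℝ (Fin m)) a₀.1).source)
    (u v : TangentSpace (cotangentModel m) a) :
    canonicalForm a u v = stdForm m (chartDeriv (cotangentModel m) a₀ a u)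
      (chartDeriv (cotangentModel m) a₀ a v) := by
  have hd := hasFDerivAt_chartForm_liouvilleForm ha
  have h := extDerivOneForm_eq_fderiv_chartForm (I := cotangentModel m) liouvilleForm
    (mem_chartAt_cotangent_source.2 ha) hd.differentiableAt u v
  rw [hd.fderiv] at h
  exact (congrArg Neg.neg h).trans (neg_sub _ _)

/-- The Liouville volume form in cotangent coordinates. -/
theorem liouvilleVolume_eq_wedgePower {a₀ a : CotangentBundle m M}
    (ha : a.1 ∈ (chartAt (EuclideanSpace ℝ (Fin m)) a₀.1).source)
    (v : Fin m × Fin 2 → TangentSpace (cotangentModel m) a) :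
    liouvilleVolume a v =
      wedgePower m (stdForm m) fun i => chartDeriv (cotangentModel m) a₀ a (v i) := by
  rw [wedgePower_apply, liouvilleVolume]
  simp_rw [canonicalForm_eq_stdForm ha]

end CotangentCharts

/-! ### Smoothness of a vector field in terms of its chart expression. -/

section ChartFieldSmooth

variable {E H M : Type*} [NormedAddCommGroup E] [NormedSpace ℝ E] [TopologicalSpace H]
  {I : ModelWithCorners ℝ E H} [I.Boundaryless] [TopologicalSpace M] [ChartedSpace H M]
  [IsManifold I 1 M]

omit [I.Boundaryless] in
theorem trivializationAt_tangent_eventuallyEq (X : ∀ x : M, TangentSpace I x) (x₀ : M) :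
    (fun x => (trivializationAt E (TangentSpace I) x₀ ⟨x, X x⟩).2) =ᶠ[𝓝 x₀]
      fun x => (chartDeriv I x₀ x (X x) : E) := by
  filter_upwards [(chartAt H x₀).open_source.mem_nhds (mem_chart_source H x₀)] with x hx
  have h := TangentBundle.continuousLinearMapAt_trivializationAt (I := I) hx
  have hb : x ∈ (trivializationAt E (TangentSpace I) x₀).baseSet := hx
  refine Eq.trans ?_ (congrArg (fun L : E →L[ℝ] E => L (X x)) h)
  exact ((trivializationAt E (TangentSpace I) x₀).continuousLinearMapAt_apply_of_mem (R := ℝ) hb _).symm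

theorem contDiffAt_chartField {n : WithTop ℕ∞} [IsManifold I n M]
    {X : ∀ x : M, TangentSpace I x} {x₀ : M}
    (hX : ContMDiffAt I I.tangent n (fun x => (⟨x, X x⟩ : TangentBundle I M)) x₀) :
    ContDiffAt ℝ n (chartField I x₀ X) (extChartAt I x₀ x₀) := by
  have h := (Bundle.contMDiffAt_section (F := E) (E := TangentSpace I) x₀).1 hX
  have h' := h.congr_of_eventuallyEq (trivializationAt_tangent_eventuallyEq X x₀).symm
  have h2 := (contMDiffAt_iff_source (x := x₀)).1 h'
  rw [I.range_eq_univ, contMDiffWithinAt_univ] at h2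
  exact contMDiffAt_iff_contDiffAt.1 h2

theorem contMDiffAt_of_contDiffAt_chartField {n : WithTop ℕ∞} [IsManifold I n M]
    {X : ∀ x : M, TangentSpace I x} {x₀ : M}
    (hX : ContDiffAt ℝ n (chartField I x₀ X) (extChartAt I x₀ x₀)) :
    ContMDiffAt I I.tangent n (fun x => (⟨x, X x⟩ : TangentBundle I M)) x₀ := by
  refine (Bundle.contMDiffAt_section (F := E) (E := TangentSpace I) x₀).2 ?_
  refine ContMDiffAt.congr_of_eventuallyEq ?_ (trivializationAt_tangent_eventuallyEq X x₀)
  refine (contMDiffAt_iff_source (x := x₀)).2 ?_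
  rw [I.range_eq_univ, contMDiffWithinAt_univ]
  exact contMDiffAt_iff_contDiffAt.2 hX

theorem differentiableAt_chartField {X : ∀ x : M, TangentSpace I x} {x₀ : M}
    (hX : MDifferentiableAt I I.tangent (fun x => (⟨x, X x⟩ : TangentBundle I M)) x₀) :
    DifferentiableAt ℝ (chartField I x₀ X) (extChartAt I x₀ x₀) := by
  have h := (mdifferentiableAt_section (F := E) (E := TangentSpace I) I X).1 hX
  have h' := h.congr_of_eventuallyEq (trivializationAt_tangent_eventuallyEq X x₀).symm
  exact differentiableAt_comp_extChartAt_symm (mem_chart_source H x₀) h'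

end ChartFieldSmooth

/-! ### The orbit projection and the horizontal lift in charts. -/

namespace ChaplyginSystem

variable {n k r : ℕ} {Q G S : Type*}
  [TopologicalSpace Q] [ChartedSpace (EuclideanSpace ℝ (Fin n)) Q] [IsManifold (𝓡 n) ∞ Q]
  [TopologicalSpace G] [ChartedSpace (EuclideanSpace ℝ (Fin k)) G] [Group G]
  [LieGroup (𝓡 k) ∞ G]
  [TopologicalSpace S] [ChartedSpace (EuclideanSpace ℝ (Fin r)) S] [IsManifold (𝓡 r) ∞ S]
  [MulAction G Q] [ContMDiffSMul (𝓡 k) (𝓡 n) ∞ G Q] [ProperSMul G Q]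
  (C : ChaplyginSystem n k r Q G S)

theorem mfderiv_proj_hor (q : Q) (v : TangentSpace (𝓡 r) (C.proj q)) :
    mfderiv (𝓡 n) (𝓡 r) C.proj q (C.hor q v : TangentSpace (𝓡 n) q) = v :=
  (LinearEquiv.ofBijective (C.projD q) (C.bijective_projD q)).apply_symm_apply v

theorem hor_mfderiv_proj {q : Q} {u : TangentSpace (𝓡 n) q} (hu : u ∈ C.D q) :
    (C.hor q (mfderiv (𝓡 n) (𝓡 r) C.proj q u) : TangentSpace (𝓡 n) q) = u :=
  congrArg Subtype.val
    ((LinearEquiv.ofBijective (C.projD q) (C.bijective_projD q)).symm_apply_apply ⟨u, hu⟩)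

theorem mdifferentiableAt_proj (q : Q) : MDifferentiableAt (𝓡 n) (𝓡 r) C.proj q :=
  C.contMDiff_proj.mdifferentiableAt (by simp)

/-- The orbit projection in the preferred charts at `q₀` and `s₀`. -/
def projChart (q₀ : Q) (s₀ : S) (x : EuclideanSpace ℝ (Fin n)) : EuclideanSpace ℝ (Fin r) :=
  extChartAt (𝓡 r) s₀ (C.proj ((extChartAt (𝓡 n) q₀).symm x))

/-- The horizontal lift at `q`, read in the preferred charts at `q₀` and `s₀`. -/
def horAt (q₀ : Q) (s₀ : S) (q : Q) : EuclideanSpace ℝ (Fin r) →L[ℝ] EuclideanSpace ℝ (Fin n) :=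
  (chartDeriv (𝓡 n) q₀ q).comp ((C.D q).subtypeL.comp
    ((C.hor q).comp (chartDeriv (𝓡 r) s₀ (C.proj q)).inverse))

/-- The horizontal lift in the preferred charts at `q₀` and `s₀`. -/
def horChart (q₀ : Q) (s₀ : S) (x : EuclideanSpace ℝ (Fin n)) :
    EuclideanSpace ℝ (Fin r) →L[ℝ] EuclideanSpace ℝ (Fin n) :=
  C.horAt q₀ s₀ ((extChartAt (𝓡 n) q₀).symm x)

theorem projChart_extChartAt {q₀ q : Q} (s₀ : S)
    (hq : q ∈ (chartAt (EuclideanSpace ℝ (Fin n)) q₀).source) :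
    C.projChart q₀ s₀ (extChartAt (𝓡 n) q₀ q) = extChartAt (𝓡 r) s₀ (C.proj q) := by
  rw [projChart, (extChartAt (𝓡 n) q₀).left_inv (by rwa [extChartAt_source])]

theorem horAt_chartDeriv (q₀ : Q) {s₀ : S} {q : Q}
    (hs : C.proj q ∈ (chartAt (EuclideanSpace ℝ (Fin r)) s₀).source)
    (v : TangentSpace (𝓡 r) (C.proj q)) :
    C.horAt q₀ s₀ q (chartDeriv (𝓡 r) s₀ (C.proj q) v) = chartDeriv (𝓡 n) q₀ q (C.hor q v) := by
  change chartDeriv (𝓡 n) q₀ q (C.hor q ((chartDeriv (𝓡 r) s₀ (C.proj q)).inverse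
    (chartDeriv (𝓡 r) s₀ (C.proj q) v))) = _
  rw [(isInvertible_chartDeriv hs).inverse_apply_self]

theorem horChart_chartDeriv {q₀ : Q} {s₀ : S} {q : Q}
    (hq : q ∈ (chartAt (EuclideanSpace ℝ (Fin n)) q₀).source)
    (hs : C.proj q ∈ (chartAt (EuclideanSpace ℝ (Fin r)) s₀).source)
    (v : TangentSpace (𝓡 r) (C.proj q)) :
    C.horChart q₀ s₀ (extChartAt (𝓡 n) q₀ q) (chartDeriv (𝓡 r) s₀ (C.proj q) v) =
      chartDeriv (𝓡 n) q₀ q (C.hor q v) := by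
  rw [horChart, (extChartAt (𝓡 n) q₀).left_inv (by rwa [extChartAt_source])]
  exact C.horAt_chartDeriv q₀ hs v

theorem fderiv_projChart {q₀ : Q} {s₀ : S} {q : Q}
    (hq : q ∈ (chartAt (EuclideanSpace ℝ (Fin n)) q₀).source)
    (hs : C.proj q ∈ (chartAt (EuclideanSpace ℝ (Fin r)) s₀).source)
    (v : TangentSpace (𝓡 n) q) :
    fderiv ℝ (C.projChart q₀ s₀) (extChartAt (𝓡 n) q₀ q) (chartDeriv (𝓡 n) q₀ q v) =
      chartDeriv (𝓡 r) s₀ (C.proj q) (mfderiv (𝓡 n) (𝓡 r) C.proj q v) :=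
  (chartDeriv_mfderiv hq hs (C.mdifferentiableAt_proj q) v).symm

theorem fderiv_projChart_horChart {q₀ : Q} {s₀ : S} {q : Q}
    (hq : q ∈ (chartAt (EuclideanSpace ℝ (Fin n)) q₀).source)
    (hs : C.proj q ∈ (chartAt (EuclideanSpace ℝ (Fin r)) s₀).source)
    (v : EuclideanSpace ℝ (Fin r)) :
    fderiv ℝ (C.projChart q₀ s₀) (extChartAt (𝓡 n) q₀ q)
      (C.horChart q₀ s₀ (extChartAt (𝓡 n) q₀ q) v) = v := by
  obtain ⟨v, rfl⟩ := chartDeriv_surjective (I := 𝓡 r) hs v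
  rw [C.horChart_chartDeriv hq hs, C.fderiv_projChart hq hs, C.mfderiv_proj_hor]

theorem contDiffAt_projChart {q : Q} {s₀ : S}
    (hs : C.proj q ∈ (chartAt (EuclideanSpace ℝ (Fin r)) s₀).source) :
    ContDiffAt ℝ ∞ (C.projChart q s₀) (extChartAt (𝓡 n) q q) := by
  have h : ContMDiffAt (𝓡 n) 𝓘(ℝ, EuclideanSpace ℝ (Fin r)) ∞
      (extChartAt (𝓡 r) s₀ ∘ C.proj) q :=
    (contMDiffAt_extChartAt' hs).comp q C.contMDiff_proj.contMDiffAt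
  have h2 := (contMDiffAt_iff_source (x := q)).1 h
  rw [(𝓡 n).range_eq_univ, contMDiffWithinAt_univ] at h2
  exact contMDiffAt_iff_contDiffAt.1 h2

theorem eventually_mem_source {q : Q} {s₀ : S}
    (hs : C.proj q ∈ (chartAt (EuclideanSpace ℝ (Fin r)) s₀).source) :
    ∀ᶠ q' in 𝓝 q, q' ∈ (chartAt (EuclideanSpace ℝ (Fin n)) q).source ∧
      C.proj q' ∈ (chartAt (EuclideanSpace ℝ (Fin r)) s₀).source :=
  Filter.Eventually.and ((chartAt _ q).open_source.mem_nhds (mem_chart_source _ q))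
    (C.contMDiff_proj.continuous.continuousAt.preimage_mem_nhds
      ((chartAt _ s₀).open_source.mem_nhds hs))

end ChaplyginSystem

section EventuallyChart

variable {E H M : Type*} [NormedAddCommGroup E] [NormedSpace ℝ E] [TopologicalSpace H]
  {I : ModelWithCorners ℝ E H} [I.Boundaryless] [TopologicalSpace M] [ChartedSpace H M]

theorem eventually_extChartAt_of_eventually {x₀ : M} {p : E → Prop} {P : M → Prop}
    (h : ∀ᶠ x in 𝓝 x₀, P x)
    (hp : ∀ x ∈ (extChartAt I x₀).source, P x → p (extChartAt I x₀ x)) :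
    ∀ᶠ z in 𝓝 (extChartAt I x₀ x₀), p z := by
  have h1 := (continuousAt_extChartAt_symm (I := I) x₀).eventually
    ((extChartAt_to_inv (I := I) x₀).symm ▸ h)
  filter_upwards [h1, extChartAt_target_mem_nhds (I := I) x₀] with z hz hz'
  have := hp _ ((extChartAt I x₀).map_target hz') hz
  rwa [(extChartAt I x₀).right_inv hz'] at this

end EventuallyChart

namespace ChaplyginSystem

variable {n k r : ℕ} {Q G S : Type*}
  [TopologicalSpace Q] [ChartedSpace (EuclideanSpace ℝ (Fin n)) Q] [IsManifold (𝓡 n) ∞ Q]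
  [TopologicalSpace G] [ChartedSpace (EuclideanSpace ℝ (Fin k)) G] [Group G]
  [LieGroup (𝓡 k) ∞ G]
  [TopologicalSpace S] [ChartedSpace (EuclideanSpace ℝ (Fin r)) S] [IsManifold (𝓡 r) ∞ S]
  [MulAction G Q] [ContMDiffSMul (𝓡 k) (𝓡 n) ∞ G Q] [ProperSMul G Q]
  (C : ChaplyginSystem n k r Q G S)

/-- If the columns of `A` form a local frame of `D` and `B` is the derivative of the projection,
then the lift is `A (B A)⁻¹`. The square matrix `B A` is invertible because the projection is
injective on `D`, and inversion is smooth. -/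
theorem contDiffAt_horChart {q : Q} {s₀ : S}
    (hs : C.proj q ∈ (chartAt (EuclideanSpace ℝ (Fin r)) s₀).source) :
    ContDiffAt ℝ ∞ (C.horChart q s₀) (extChartAt (𝓡 n) q q) := by
  obtain ⟨W, hW, hqW, V, hV, hVW⟩ := C.exists_frame q
  let A : EuclideanSpace ℝ (Fin n) → EuclideanSpace ℝ (Fin r) →L[ℝ] EuclideanSpace ℝ (Fin n) :=
    fun x => ∑ j, (EuclideanSpace.proj j : EuclideanSpace ℝ (Fin r) →L[ℝ] ℝ).smulRight
      (chartField (𝓡 n) q (V j) x)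
  let B := fderiv ℝ (C.projChart q s₀)
  have hA : ContDiffAt ℝ ∞ A (extChartAt (𝓡 n) q q) := by
    refine ContDiffAt.sum fun j _ => contDiffAt_const.smulRight ?_
    exact contDiffAt_chartField (n := ∞) ((hV j).contMDiffAt (hW.mem_nhds hqW))
  have hB : ContDiffAt ℝ ∞ B (extChartAt (𝓡 n) q q) :=
    (C.contDiffAt_projChart hs).fderiv_right (by simp)
  have hBA : ContDiffAt ℝ ∞ (fun x => (B x).comp (A x)) (extChartAt (𝓡 n) q q) := hB.clm_comp hA
  have key : ∀ q' ∈ (chartAt (EuclideanSpace ℝ (Fin n)) q).source,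
      C.proj q' ∈ (chartAt (EuclideanSpace ℝ (Fin r)) s₀).source → q' ∈ W →
      ((B (extChartAt (𝓡 n) q q')).comp (A (extChartAt (𝓡 n) q q'))).IsInvertible ∧
        C.horChart q s₀ (extChartAt (𝓡 n) q q') = (A (extChartAt (𝓡 n) q q')).comp
          ((B (extChartAt (𝓡 n) q q')).comp (A (extChartAt (𝓡 n) q q'))).inverse := by
    intro q' hq' hs' hW'
    set x := extChartAt (𝓡 n) q q' with hx
    have hAx : ∀ c : EuclideanSpace ℝ (Fin r), A x c =
        chartDeriv (𝓡 n) q q' (∑ j, c j • V j q') := by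
      intro c
      have hl : (extChartAt (𝓡 n) q).symm x = q' :=
        (extChartAt (𝓡 n) q).left_inv (by rwa [extChartAt_source])
      have hf : ∀ j, chartField (𝓡 n) q (V j) x = chartDeriv (𝓡 n) q q' (V j q') := fun j => by
        rw [chartField, hl]
      simp only [A, hf, FunLike.coe_sum, Finset.sum_apply, map_sum, map_smul]
      rfl
    have hmem : ∀ c : EuclideanSpace ℝ (Fin r), ∑ j, c j • V j q' ∈ C.D q' := fun c => by
      rw [← (hVW q' hW').2]
      exact Submodule.sum_mem _ fun j _ =>
        Submodule.smul_mem _ _ (Submodule.subset_span (Set.mem_range_self j))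
    have hhor : ∀ c, C.horChart q s₀ x (B x (A x c)) = A x c := fun c => by
      rw [hAx, C.fderiv_projChart hq' hs', C.horChart_chartDeriv hq' hs',
        C.hor_mfderiv_proj (hmem c)]
    have hinj : Function.Injective ((B x).comp (A x)) := by
      refine (injective_iff_map_eq_zero _).2 fun c hc => ?_
      have h0 : A x c = 0 := by
        rw [← hhor]
        exact (congrArg (C.horChart q s₀ x) hc).trans (map_zero _)
      rw [hAx] at h0
      have h1 := chartDeriv_injective hq' (h0.trans (map_zero _).symm)
      have h2 := Fintype.linearIndependent_iff.1 (hVW q' hW').1 (fun j => c j) h1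
      exact PiLp.ext h2
    have hinv : ((B x).comp (A x)).IsInvertible :=
      ⟨(LinearEquiv.ofInjectiveEndo ((B x).comp (A x)).toLinearMap hinj).toContinuousLinearEquiv,
        ContinuousLinearMap.ext fun _ => rfl⟩
    refine ⟨hinv, ContinuousLinearMap.ext fun v => ?_⟩
    obtain ⟨c, rfl⟩ := hinv.surjective v
    change C.horChart q s₀ x (B x (A x c)) = A x (((B x).comp (A x)).inverse ((B x).comp (A x) c))
    rw [hinv.inverse_apply_self, hhor]
  have hinv := (key q (mem_chart_source _ q) hs hqW).1
  have hsm := hA.clm_comp (ContDiffAt.comp (extChartAt (𝓡 n) q q)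
    (g := ContinuousLinearMap.inverse) (f := fun x => (B x).comp (A x))
    hinv.contDiffAt_map_inverse hBA)
  refine hsm.congr_of_eventuallyEq ?_
  refine eventually_extChartAt_of_eventually (I := 𝓡 n)
    ((C.eventually_mem_source hs).and (hW.mem_nhds hqW)) fun q' _ h => ?_
  exact (key q' h.1.1 h.1.2 h.2).2

theorem chartField_horField {q : Q} {s₀ : S}
    (hs : C.proj q ∈ (chartAt (EuclideanSpace ℝ (Fin r)) s₀).source)
    (Y : ∀ s : S, TangentSpace (𝓡 r) s) :
    chartField (𝓡 n) q (C.horField Y) =ᶠ[𝓝 (extChartAt (𝓡 n) q q)]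
      fun x => C.horChart q s₀ x (chartField (𝓡 r) s₀ Y (C.projChart q s₀ x)) := by
  refine eventually_extChartAt_of_eventually (I := 𝓡 n) (C.eventually_mem_source hs)
    fun q' hq' h => ?_
  have hs' : C.proj q' ∈ (extChartAt (𝓡 r) s₀).source := by rw [extChartAt_source]; exact h.2
  have h1 : chartField (𝓡 n) q (C.horField Y) (extChartAt (𝓡 n) q q') =
      chartDeriv (𝓡 n) q q' (C.horField Y q') := by
    rw [chartField, (extChartAt (𝓡 n) q).left_inv hq']
  have h2 : chartField (𝓡 r) s₀ Y (C.projChart q s₀ (extChartAt (𝓡 n) q q')) =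
      chartDeriv (𝓡 r) s₀ (C.proj q') (Y (C.proj q')) := by
    rw [C.projChart_extChartAt _ h.1, chartField, (extChartAt (𝓡 r) s₀).left_inv hs']
  rw [h1]
  beta_reduce
  rw [h2, C.horChart_chartDeriv h.1 h.2]
  rfl

end ChaplyginSystem

/-! ### Brackets of horizontal lifts and tensoriality of the gyroscopic expression. -/

namespace ChaplyginSystem

variable {n k r : ℕ} {Q G S : Type*}
  [TopologicalSpace Q] [ChartedSpace (EuclideanSpace ℝ (Fin n)) Q] [IsManifold (𝓡 n) ∞ Q]
  [TopologicalSpace G] [ChartedSpace (EuclideanSpace ℝ (Fin k)) G] [Group G]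
  [LieGroup (𝓡 k) ∞ G]
  [TopologicalSpace S] [ChartedSpace (EuclideanSpace ℝ (Fin r)) S] [IsManifold (𝓡 r) ∞ S]
  [MulAction G Q] [ContMDiffSMul (𝓡 k) (𝓡 n) ∞ G Q] [ProperSMul G Q]
  (C : ChaplyginSystem n k r Q G S)

/-- `T_q π ∘ P`. -/
def projOrth (q : Q) : TangentSpace (𝓡 n) q →L[ℝ] TangentSpace (𝓡 r) (C.proj q) :=
  (mfderiv (𝓡 n) (𝓡 r) C.proj q).comp ((C.D q).subtypeL.comp (C.orthProj q))

theorem orthProj_of_mem {q : Q} {u : TangentSpace (𝓡 n) q} (hu : u ∈ C.D q) :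
    (C.orthProj q u : TangentSpace (𝓡 n) q) = u :=
  congrArg Subtype.val (Submodule.projectionOnto_apply_left (C.isCompl_Dperp q) ⟨u, hu⟩)

theorem orthProj_of_mem_Dperp {q : Q} {u : TangentSpace (𝓡 n) q} (hu : u ∈ C.Dperp q) :
    C.orthProj q u = 0 :=
  Submodule.projectionOnto_apply_right (C.isCompl_Dperp q) ⟨u, hu⟩

theorem projOrth_of_mem {q : Q} {u : TangentSpace (𝓡 n) q} (hu : u ∈ C.D q) :
    C.projOrth q u = mfderiv (𝓡 n) (𝓡 r) C.proj q u :=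
  congrArg (mfderiv (𝓡 n) (𝓡 r) C.proj q) (C.orthProj_of_mem hu)

theorem projOrth_of_mem_Dperp {q : Q} {u : TangentSpace (𝓡 n) q} (hu : u ∈ C.Dperp q) :
    C.projOrth q u = 0 :=
  (congrArg (fun d : C.D q => mfderiv (𝓡 n) (𝓡 r) C.proj q (d : TangentSpace (𝓡 n) q))
    (C.orthProj_of_mem_Dperp hu)).trans (map_zero _)

theorem projOrth_hor (q : Q) (v : TangentSpace (𝓡 r) (C.proj q)) :
    C.projOrth q (C.hor q v) = v :=
  (C.projOrth_of_mem (C.hor q v).2).trans (C.mfderiv_proj_hor q v)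

theorem hor_projOrth (q : Q) (u : TangentSpace (𝓡 n) q) :
    C.hor q (C.projOrth q u) = C.orthProj q u :=
  Subtype.ext (C.hor_mfderiv_proj (C.orthProj q u).2)

/-- The derivative of the horizontal lift, antisymmetrized: the bracket of the horizontal lifts of
the coordinate fields, in the preferred charts at `q` and `s₀`. -/
def curvature (q : Q) (s₀ : S) : EuclideanSpace ℝ (Fin r) →ₗ[ℝ] EuclideanSpace ℝ (Fin r) →ₗ[ℝ]
    EuclideanSpace ℝ (Fin n) :=
  LinearMap.mk₂ ℝ (fun y z => fderiv ℝ (C.horChart q s₀) (extChartAt (𝓡 n) q q)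
      (C.horChart q s₀ (extChartAt (𝓡 n) q q) y) z -
    fderiv ℝ (C.horChart q s₀) (extChartAt (𝓡 n) q q)
      (C.horChart q s₀ (extChartAt (𝓡 n) q q) z) y)
    (fun _ _ _ => by simp only [map_add, add_apply]; abel)
    (fun _ _ _ => by simp only [map_smul, smul_apply, smul_sub])
    (fun _ _ _ => by simp only [map_add, add_apply]; abel)
    (fun _ _ _ => by simp only [map_smul, smul_apply, smul_sub])

theorem curvature_apply (q : Q) (s₀ : S) (y z : EuclideanSpace ℝ (Fin r)) :
    C.curvature q s₀ y z = fderiv ℝ (C.horChart q s₀) (extChartAt (𝓡 n) q q)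
      (C.horChart q s₀ (extChartAt (𝓡 n) q q) y) z -
    fderiv ℝ (C.horChart q s₀) (extChartAt (𝓡 n) q q)
      (C.horChart q s₀ (extChartAt (𝓡 n) q q) z) y := rfl

theorem differentiableAt_projChart {q : Q} {s₀ : S}
    (hs : C.proj q ∈ (chartAt (EuclideanSpace ℝ (Fin r)) s₀).source) :
    DifferentiableAt ℝ (C.projChart q s₀) (extChartAt (𝓡 n) q q) :=
  (C.contDiffAt_projChart hs).differentiableAt (by simp)

theorem differentiableAt_horChart {q : Q} {s₀ : S}
    (hs : C.proj q ∈ (chartAt (EuclideanSpace ℝ (Fin r)) s₀).source) :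
    DifferentiableAt ℝ (C.horChart q s₀) (extChartAt (𝓡 n) q q) :=
  (C.contDiffAt_horChart hs).differentiableAt (by simp)

theorem hasFDerivAt_chartField_horField {q : Q} {s₀ : S}
    (hs : C.proj q ∈ (chartAt (EuclideanSpace ℝ (Fin r)) s₀).source)
    {Y : ∀ s : S, TangentSpace (𝓡 r) s}
    (hY : DifferentiableAt ℝ (chartField (𝓡 r) s₀ Y) (extChartAt (𝓡 r) s₀ (C.proj q)))
    (u : EuclideanSpace ℝ (Fin n)) :
    fderiv ℝ (chartField (𝓡 n) q (C.horField Y)) (extChartAt (𝓡 n) q q) u =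
      fderiv ℝ (C.horChart q s₀) (extChartAt (𝓡 n) q q) u
        (chartField (𝓡 r) s₀ Y (extChartAt (𝓡 r) s₀ (C.proj q))) +
      C.horChart q s₀ (extChartAt (𝓡 n) q q)
        (fderiv ℝ (chartField (𝓡 r) s₀ Y) (extChartAt (𝓡 r) s₀ (C.proj q))
          (fderiv ℝ (C.projChart q s₀) (extChartAt (𝓡 n) q q) u)) := by
  have hq := mem_chart_source (EuclideanSpace ℝ (Fin n)) q
  rw [(C.chartField_horField hs Y).fderiv_eq]
  have hpq := C.projChart_extChartAt s₀ hq
  have hY' := hY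
  rw [← hpq] at hY'
  have h := (C.differentiableAt_horChart hs).hasFDerivAt.clm_apply
    (hY'.hasFDerivAt.comp _ (C.differentiableAt_projChart hs).hasFDerivAt)
  refine (congrArg (fun L => L u) h.fderiv).trans ?_
  rw [← hpq]
  exact add_comm _ _

/-- Write the lift of `Y` as `H(x) Y(π x)` and apply the product rule. Derivatives of `H` collect in
`curvature`; the others give the lift of `[Y, Z]`, because `Dπ` composed with `H` is the identity.
-/
theorem chartDeriv_mlieBracket_horField {q : Q} {s₀ : S}
    (hs : C.proj q ∈ (chartAt (EuclideanSpace ℝ (Fin r)) s₀).source)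
    {Y Z : ∀ s : S, TangentSpace (𝓡 r) s}
    (hY : DifferentiableAt ℝ (chartField (𝓡 r) s₀ Y) (extChartAt (𝓡 r) s₀ (C.proj q)))
    (hZ : DifferentiableAt ℝ (chartField (𝓡 r) s₀ Z) (extChartAt (𝓡 r) s₀ (C.proj q))) :
    (VectorField.mlieBracket (𝓡 n) (C.horField Y) (C.horField Z) q : EuclideanSpace ℝ (Fin n)) =
      C.curvature q s₀ (chartDeriv (𝓡 r) s₀ (C.proj q) (Y (C.proj q)))
        (chartDeriv (𝓡 r) s₀ (C.proj q) (Z (C.proj q))) +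
      C.horChart q s₀ (extChartAt (𝓡 n) q q)
        (VectorField.lieBracket ℝ (chartField (𝓡 r) s₀ Y) (chartField (𝓡 r) s₀ Z)
          (extChartAt (𝓡 r) s₀ (C.proj q))) := by
  have hq := mem_chart_source (EuclideanSpace ℝ (Fin n)) q
  have hs' : C.proj q ∈ (extChartAt (𝓡 r) s₀).source := by rwa [extChartAt_source]
  have hc : ∀ Y : ∀ s : S, TangentSpace (𝓡 r) s,
      chartField (𝓡 r) s₀ Y (extChartAt (𝓡 r) s₀ (C.proj q)) =
        chartDeriv (𝓡 r) s₀ (C.proj q) (Y (C.proj q)) := fun Y => by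
    rw [chartField, (extChartAt (𝓡 r) s₀).left_inv hs']
  have hv : ∀ Y : ∀ s : S, TangentSpace (𝓡 r) s,
      chartField (𝓡 n) q (C.horField Y) (extChartAt (𝓡 n) q q) =
      C.horChart q s₀ (extChartAt (𝓡 n) q q)
        (chartDeriv (𝓡 r) s₀ (C.proj q) (Y (C.proj q))) := fun Y => by
    have := (C.chartField_horField hs Y).eq_of_nhds
    rw [this, ← hc, C.projChart_extChartAt s₀ hq]
  have h := chartDeriv_mlieBracket (I := 𝓡 n) q (C.horField Y) (C.horField Z)
  rw [chartDeriv_self] at h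
  refine h.trans ?_
  rw [VectorField.lieBracket, C.hasFDerivAt_chartField_horField hs hZ,
    C.hasFDerivAt_chartField_horField hs hY, hv, hv, C.fderiv_projChart_horChart hq hs,
    C.fderiv_projChart_horChart hq hs, VectorField.lieBracket, map_sub, hc, hc, curvature_apply]
  abel

/-- The value at a point `q` over `s` of the gyroscopic tensor. -/
def gyroBilin (q : Q) : TangentSpace (𝓡 r) (C.proj q) →ₗ[ℝ] TangentSpace (𝓡 r) (C.proj q) →ₗ[ℝ]
    TangentSpace (𝓡 r) (C.proj q) :=
  (C.curvature q (C.proj q)).compr₂ (C.projOrth q).toLinearMap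

/-- Tensoriality: `T_q π ∘ P` sends the lift of `[Y, Z]` back to `[Y, Z]`, which is subtracted, and
the curvature term involves only the values of the fields. -/
theorem gyroBilin_eq {q : Q} {Y Z : ∀ s : S, TangentSpace (𝓡 r) s}
    (hY : MDifferentiableAt (𝓡 r) (𝓡 r).tangent
      (fun s => (⟨s, Y s⟩ : TangentBundle (𝓡 r) S)) (C.proj q))
    (hZ : MDifferentiableAt (𝓡 r) (𝓡 r).tangent
      (fun s => (⟨s, Z s⟩ : TangentBundle (𝓡 r) S)) (C.proj q)) :
    C.projOrth q (VectorField.mlieBracket (𝓡 n) (C.horField Y) (C.horField Z) q) -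
      VectorField.mlieBracket (𝓡 r) Y Z (C.proj q) =
    C.gyroBilin q (Y (C.proj q)) (Z (C.proj q)) := by
  have hs := mem_chart_source (EuclideanSpace ℝ (Fin r)) (C.proj q)
  have hq := mem_chart_source (EuclideanSpace ℝ (Fin n)) q
  have h := C.chartDeriv_mlieBracket_horField hs (differentiableAt_chartField hY)
    (differentiableAt_chartField hZ)
  rw [← chartDeriv_mlieBracket (I := 𝓡 r), C.horChart_chartDeriv hq hs, chartDeriv_self,
    chartDeriv_self, chartDeriv_self] at h
  have h2 := congrArg (C.projOrth q) h
  refine (congrArg (· - VectorField.mlieBracket (𝓡 r) Y Z (C.proj q)) (h2.trans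
    (map_add (C.projOrth q) _ _))).trans ?_
  refine (congrArg (fun w => C.gyroBilin q (Y (C.proj q)) (Z (C.proj q)) + w -
    VectorField.mlieBracket (𝓡 r) Y Z (C.proj q)) (C.projOrth_hor q _)).trans ?_
  exact add_sub_cancel_right _ _

/-- The gyroscopic tensor as a bilinear map on each tangent space. -/
def gyroTensor (s : S) : TangentSpace (𝓡 r) s →ₗ[ℝ] TangentSpace (𝓡 r) s →ₗ[ℝ]
    TangentSpace (𝓡 r) s :=
  C.gyroBilin (Function.surjInv C.surjective_proj s)

theorem gyro_eq_gyroTensor {s : S} {Y Z : ∀ s : S, TangentSpace (𝓡 r) s}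
    (hY : MDifferentiableAt (𝓡 r) (𝓡 r).tangent
      (fun s => (⟨s, Y s⟩ : TangentBundle (𝓡 r) S)) s)
    (hZ : MDifferentiableAt (𝓡 r) (𝓡 r).tangent
      (fun s => (⟨s, Z s⟩ : TangentBundle (𝓡 r) S)) s) :
    C.gyro Y Z s = C.gyroTensor s (Y s) (Z s) := by
  -- The chosen preimage lies over `s` only by a propositional equality; quantifying over both
  -- points allows the substitution.
  have key : ∀ q : Q, ∀ s : S, C.proj q = s →
      MDifferentiableAt (𝓡 r) (𝓡 r).tangent (fun s => (⟨s, Y s⟩ : TangentBundle (𝓡 r) S)) s →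
      MDifferentiableAt (𝓡 r) (𝓡 r).tangent (fun s => (⟨s, Z s⟩ : TangentBundle (𝓡 r) S)) s →
      (show TangentSpace (𝓡 r) s from
        C.projOrth q (VectorField.mlieBracket (𝓡 n) (C.horField Y) (C.horField Z) q)) -
        VectorField.mlieBracket (𝓡 r) Y Z s =
      (show TangentSpace (𝓡 r) s →ₗ[ℝ] TangentSpace (𝓡 r) s →ₗ[ℝ] TangentSpace (𝓡 r) s from
        C.gyroBilin q) (Y s) (Z s) := by
    rintro q _ rfl hY hZ
    exact C.gyroBilin_eq hY hZ
  exact key _ s (Function.surjInv_eq C.surjective_proj s) hY hZ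

theorem gyroTensor_swap (s : S) (y z : TangentSpace (𝓡 r) s) :
    C.gyroTensor s y z = -C.gyroTensor s z y := by
  refine Eq.trans ?_ (map_neg (C.projOrth (Function.surjInv C.surjective_proj s)) _)
  exact congrArg (C.projOrth (Function.surjInv C.surjective_proj s)) (neg_sub _ _).symm

end ChaplyginSystem

/-! ### Invariance under the group: the gyroscopic tensor does not depend on the point of the fibre.
-/

section SMul

variable {n : ℕ} {Q G : Type*}
  [TopologicalSpace Q] [ChartedSpace (EuclideanSpace ℝ (Fin n)) Q]
  [TopologicalSpace G] [Group G] [MulAction G Q]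

theorem contMDiff_smul_left (k : ℕ) [ChartedSpace (EuclideanSpace ℝ (Fin k)) G]
    [ContMDiffSMul (𝓡 k) (𝓡 n) ∞ G Q] (g : G) :
    ContMDiff (𝓡 n) (𝓡 n) ∞ (fun x : Q => g • x) :=
  (ContMDiffSMul.contMDiff_smul (I := 𝓡 k) (I' := 𝓡 n) (n := ∞) (G := G) (M := Q)).comp
    (contMDiff_const.prodMk contMDiff_id)

theorem isInvertible_mfderiv_smul (k : ℕ) [ChartedSpace (EuclideanSpace ℝ (Fin k)) G]
    [ContMDiffSMul (𝓡 k) (𝓡 n) ∞ G Q] (g : G) (q : Q) :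
    (mfderiv (𝓡 n) (𝓡 n) (fun x : Q => g • x) q).IsInvertible := by
  have h1 : MDifferentiableAt (𝓡 n) (𝓡 n) (fun x : Q => g • x) q :=
    (contMDiff_smul_left k g).mdifferentiableAt (by simp)
  have h2 : MDifferentiableAt (𝓡 n) (𝓡 n) (fun x : Q => g⁻¹ • x) (g • q) :=
    (contMDiff_smul_left k g⁻¹).mdifferentiableAt (by simp)
  have h := mfderiv_comp q h2 h1
  have hid : (fun x : Q => g⁻¹ • x) ∘ (fun x : Q => g • x) = id := by
    funext x
    simp
  rw [hid, mfderiv_id] at h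
  let L : EuclideanSpace ℝ (Fin n) →L[ℝ] EuclideanSpace ℝ (Fin n) :=
    mfderiv (𝓡 n) (𝓡 n) (fun x : Q => g • x) q
  let L' : EuclideanSpace ℝ (Fin n) →L[ℝ] EuclideanSpace ℝ (Fin n) :=
    mfderiv (𝓡 n) (𝓡 n) (fun x : Q => g⁻¹ • x) (g • q)
  have hinj : Function.Injective L.toLinearMap :=
    Function.LeftInverse.injective (g := L') fun v =>
      (congrArg (fun L : EuclideanSpace ℝ (Fin n) →L[ℝ] EuclideanSpace ℝ (Fin n) => L v) h).symm
  exact ⟨(LinearEquiv.ofInjectiveEndo L.toLinearMap hinj).toContinuousLinearEquiv,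
    ContinuousLinearMap.ext fun _ => rfl⟩

end SMul


namespace ChaplyginSystem

variable {n k r : ℕ} {Q G S : Type*}
  [TopologicalSpace Q] [ChartedSpace (EuclideanSpace ℝ (Fin n)) Q] [IsManifold (𝓡 n) ∞ Q]
  [TopologicalSpace G] [ChartedSpace (EuclideanSpace ℝ (Fin k)) G] [Group G]
  [LieGroup (𝓡 k) ∞ G]
  [TopologicalSpace S] [ChartedSpace (EuclideanSpace ℝ (Fin r)) S] [IsManifold (𝓡 r) ∞ S]
  [MulAction G Q] [ContMDiffSMul (𝓡 k) (𝓡 n) ∞ G Q] [ProperSMul G Q]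
  (C : ChaplyginSystem n k r Q G S)

theorem mfderiv_proj_smul (g : G) (q : Q) (u : TangentSpace (𝓡 n) q) :
    (mfderiv (𝓡 n) (𝓡 r) C.proj (g • q) (mfderiv (𝓡 n) (𝓡 n) (fun x : Q => g • x) q u) :
      EuclideanSpace ℝ (Fin r)) = mfderiv (𝓡 n) (𝓡 r) C.proj q u := by
  have h := mfderiv_comp q (C.mdifferentiableAt_proj (g • q))
    ((contMDiff_smul_left k g (Q := Q)).mdifferentiableAt (x := q) (by simp))
  have hc : C.proj ∘ (fun x : Q => g • x) = C.proj := by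
    funext x
    exact ((C.proj_eq_iff x (g • x)).2 ⟨g, rfl⟩).symm
  rw [hc] at h
  exact (congrArg (fun L : EuclideanSpace ℝ (Fin n) →L[ℝ] EuclideanSpace ℝ (Fin r) => L u) h).symm

theorem mfderiv_smul_mem {g : G} {q : Q} {u : TangentSpace (𝓡 n) q} (hu : u ∈ C.D q) :
    mfderiv (𝓡 n) (𝓡 n) (fun x : Q => g • x) q u ∈ C.D (g • q) := by
  rw [← C.D_smul]
  exact ⟨u, hu, rfl⟩

theorem mfderiv_smul_mem_Dperp {g : G} {q : Q} {u : TangentSpace (𝓡 n) q} (hu : u ∈ C.Dperp q) :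
    mfderiv (𝓡 n) (𝓡 n) (fun x : Q => g • x) q u ∈ C.Dperp (g • q) := by
  intro w hw
  rw [← C.D_smul] at hw
  obtain ⟨w, hw, rfl⟩ := hw
  exact (C.metric_smul g q u w).trans (hu w hw)

/-- The horizontal lift is equivariant. -/
theorem mfderiv_smul_hor (g : G) (q : Q) (v : TangentSpace (𝓡 r) (C.proj q)) :
    mfderiv (𝓡 n) (𝓡 n) (fun x : Q => g • x) q (C.hor q v) =
      C.hor (g • q) (show TangentSpace (𝓡 r) (C.proj (g • q)) from v) := by
  rw [← C.hor_mfderiv_proj (C.mfderiv_smul_mem (g := g) (C.hor q v).2)]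
  exact congrArg (fun w : EuclideanSpace ℝ (Fin r) => (C.hor (g • q) w : TangentSpace (𝓡 n) (g • q)))
    ((C.mfderiv_proj_smul g q _).trans (C.mfderiv_proj_hor q v))

/-- The action preserves `D` and, being isometric, its orthogonal complement, so it commutes with
`P`; and it covers the identity of `S`. -/
theorem projOrth_mfderiv_smul (g : G) (q : Q) (u : TangentSpace (𝓡 n) q) :
    (C.projOrth (g • q) (mfderiv (𝓡 n) (𝓡 n) (fun x : Q => g • x) q u) :
      EuclideanSpace ℝ (Fin r)) = C.projOrth q u := by
  have hu : u ∈ C.D q ⊔ C.Dperp q := by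
    rw [(C.isCompl_Dperp q).sup_eq_top]
    trivial
  obtain ⟨d, hd, e, he, rfl⟩ := Submodule.mem_sup.1 hu
  rw [map_add, map_add, map_add, C.projOrth_of_mem hd, C.projOrth_of_mem_Dperp he,
    C.projOrth_of_mem (C.mfderiv_smul_mem hd),
    C.projOrth_of_mem_Dperp (C.mfderiv_smul_mem_Dperp he)]
  refine (add_zero _).trans (Eq.trans ?_ (add_zero _).symm)
  exact C.mfderiv_proj_smul g q d

theorem mfderiv_smul_horField (g : G) (Y : ∀ s : S, TangentSpace (𝓡 r) s) (q : Q) :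
    mfderiv (𝓡 n) (𝓡 n) (fun x : Q => g • x) q (C.horField Y q) = C.horField Y (g • q) := by
  refine (C.mfderiv_smul_hor g q _).trans ?_
  have h : ∀ s s' : S, s = s' → (Y s : EuclideanSpace ℝ (Fin r)) = Y s' := by
    rintro s _ rfl
    rfl
  exact congrArg (fun w : EuclideanSpace ℝ (Fin r) => (C.hor (g • q) w : TangentSpace (𝓡 n) (g • q)))
    (h _ _ ((C.proj_eq_iff q (g • q)).2 ⟨g, rfl⟩))

theorem contMDiffAt_horField {Y : ∀ s : S, TangentSpace (𝓡 r) s} {q : Q}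
    (hY : ContMDiffAt (𝓡 r) (𝓡 r).tangent ∞
      (fun s => (⟨s, Y s⟩ : TangentBundle (𝓡 r) S)) (C.proj q)) :
    ContMDiffAt (𝓡 n) (𝓡 n).tangent ∞
      (fun q => (⟨q, C.horField Y q⟩ : TangentBundle (𝓡 n) Q)) q := by
  have hs := mem_chart_source (EuclideanSpace ℝ (Fin r)) (C.proj q)
  have hq := mem_chart_source (EuclideanSpace ℝ (Fin n)) q
  refine contMDiffAt_of_contDiffAt_chartField ?_
  refine ContDiffAt.congr_of_eventuallyEq ?_ (C.chartField_horField hs Y)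
  refine (C.contDiffAt_horChart hs).clm_apply ?_
  have h := contDiffAt_chartField (n := ∞) hY
  rw [← C.projChart_extChartAt (C.proj q) hq] at h
  exact h.comp _ (C.contDiffAt_projChart hs)

/-- After extending `y` and `z` to global fields, their horizontal lifts are `G`-invariant, hence so
is the bracket of the lifts, and `T_q π ∘ P` is invariant as well. -/
theorem gyroBilin_smul [T2Space S] (g : G) (q : Q) (y z : EuclideanSpace ℝ (Fin r)) :
    (C.gyroBilin (g • q) y z : EuclideanSpace ℝ (Fin r)) = C.gyroBilin q y z := by
  have := isManifold_minSmoothness (r := n) (S := Q)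
  obtain ⟨Y, hY, rfl⟩ := exists_isSmoothField_eq (C.proj q) y
  obtain ⟨Z, hZ, rfl⟩ := exists_isSmoothField_eq (C.proj q) z
  have hpq : C.proj q = C.proj (g • q) := (C.proj_eq_iff q (g • q)).2 ⟨g, rfl⟩
  have h : ∀ Y : (∀ s : S, TangentSpace (𝓡 r) s), ∀ s s' : S, s = s' →
      (Y s : EuclideanSpace ℝ (Fin r)) = Y s' := by
    rintro Y s _ rfl
    rfl
  have h1 := C.gyroBilin_eq (q := q) (hY.mdifferentiableAt (by simp))
    (hZ.mdifferentiableAt (by simp))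
  have h2 := C.gyroBilin_eq (q := g • q) (hY.mdifferentiableAt (by simp))
    (hZ.mdifferentiableAt (by simp))
  have hpull : ∀ Y : ∀ s : S, TangentSpace (𝓡 r) s,
      VectorField.mpullback (𝓡 n) (𝓡 n) (fun x : Q => g • x) (C.horField Y) = C.horField Y := by
    intro Y
    funext x
    rw [VectorField.mpullback_apply, ← C.mfderiv_smul_horField,
      (isInvertible_mfderiv_smul k g x).inverse_apply_self]
  have hbr := VectorField.mpullback_mlieBracket (I := 𝓡 n) (I' := 𝓡 n) (n := ∞) (x₀ := q)
    (f := fun x : Q => g • x)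
    ((C.contMDiffAt_horField hY.contMDiffAt).mdifferentiableAt (x := g • q) (by simp))
    ((C.contMDiffAt_horField hZ.contMDiffAt).mdifferentiableAt (x := g • q) (by simp))
    (contMDiff_smul_left k g).contMDiffAt minSmoothness_two_le
  rw [hpull, hpull, VectorField.mpullback_apply] at hbr
  have hbr2 : VectorField.mlieBracket (𝓡 n) (C.horField Y) (C.horField Z) (g • q) =
      mfderiv (𝓡 n) (𝓡 n) (fun x : Q => g • x) q
        (VectorField.mlieBracket (𝓡 n) (C.horField Y) (C.horField Z) q) := by
    rw [← hbr, (isInvertible_mfderiv_smul k g q).self_apply_inverse]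
  rw [hbr2] at h2
  have hb := h (VectorField.mlieBracket (𝓡 r) Y Z) _ _ hpq
  have h3 := (congrArg₂ (fun a b : EuclideanSpace ℝ (Fin r) => a - b)
    (C.projOrth_mfderiv_smul g q _) hb.symm).symm.trans h2
  have h4 := h1.symm.trans h3
  refine Eq.trans ?_ h4.symm
  exact congrArg₂ (fun a b : EuclideanSpace ℝ (Fin r) =>
    (C.gyroBilin (g • q) a b : EuclideanSpace ℝ (Fin r))) (h Y _ _ hpq) (h Z _ _ hpq)

/-- The gyroscopic tensor can be computed at any point of the fibre. -/
theorem gyroTensor_proj [T2Space S] (q : Q) : C.gyroTensor (C.proj q) = C.gyroBilin q := by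
  obtain ⟨g, hg⟩ := (C.proj_eq_iff q _).1 (Function.surjInv_eq C.surjective_proj (C.proj q)).symm
  refine LinearMap.ext fun y => LinearMap.ext fun z => ?_
  rw [gyroTensor, ← hg]
  exact C.gyroBilin_smul g q y z

end ChaplyginSystem

/-! ### Hypothesis (H), the trace formula and `φ`-simplicity as pointwise conditions. -/

namespace ChaplyginSystem

variable {n k r : ℕ} {Q G S : Type*}
  [TopologicalSpace Q] [ChartedSpace (EuclideanSpace ℝ (Fin n)) Q] [IsManifold (𝓡 n) ∞ Q]
  [TopologicalSpace G] [ChartedSpace (EuclideanSpace ℝ (Fin k)) G] [Group G]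
  [LieGroup (𝓡 k) ∞ G]
  [TopologicalSpace S] [ChartedSpace (EuclideanSpace ℝ (Fin r)) S] [IsManifold (𝓡 r) ∞ S]
  [MulAction G Q] [ContMDiffSMul (𝓡 k) (𝓡 n) ∞ G Q] [ProperSMul G Q]
  (C : ChaplyginSystem n k r Q G S)

theorem gyroCoeff_eq_repr {e : OpenPartialHomeomorph S (EuclideanSpace ℝ (Fin r))}
    (he : e ∈ IsManifold.maximalAtlas (𝓡 r) ∞ S) {s : S} (hs : s ∈ e.source) (i j l : Fin r) :
    C.gyroCoeff e i j l s = (coordBasis he hs).repr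
      (C.gyroTensor s (coordBasis he hs i) (coordBasis he hs j)) l := by
  rw [coordBasis_repr, coordBasis_apply, coordBasis_apply, gyroCoeff, C.gyro_eq_gyroTensor
    ((contMDiffAt_coordField he hs i).mdifferentiableAt (by simp))
    ((contMDiffAt_coordField he hs j).mdifferentiableAt (by simp))]

theorem theta_eq_trace {Y : ∀ s : S, TangentSpace (𝓡 r) s} {s : S}
    (hY : MDifferentiableAt (𝓡 r) (𝓡 r).tangent
      (fun s => (⟨s, Y s⟩ : TangentBundle (𝓡 r) S)) s) :
    C.theta Y s = LinearMap.trace ℝ (TangentSpace (𝓡 r) s) ((C.gyroTensor s).flip (Y s)) := by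
  have he := IsManifold.chart_mem_maximalAtlas (I := 𝓡 r) (n := ∞) s
  have hs := mem_chart_source (EuclideanSpace ℝ (Fin r)) s
  rw [LinearMap.trace_eq_matrix_trace ℝ (coordBasis he hs), Matrix.trace, theta]
  refine Finset.sum_congr rfl fun j _ => ?_
  rw [Matrix.diag_apply, LinearMap.toMatrix_apply, LinearMap.flip_apply, coordBasis_repr,
    coordBasis_apply, C.gyro_eq_gyroTensor
      ((contMDiffAt_coordField he hs j).mdifferentiableAt (by simp)) hY]

/-- The linear algebra applies in each coordinate basis, and the resulting condition refers to no
chart. One chart around each point is therefore enough, and all charts of the collection then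
satisfy (H). -/
theorem forall_hypHIn_iff (hr : 2 ≤ r)
    {𝒜 : Set (OpenPartialHomeomorph S (EuclideanSpace ℝ (Fin r)))}
    (h𝒜 : 𝒜 ⊆ IsManifold.maximalAtlas (𝓡 r) ∞ S) (hcover : ∀ s : S, ∃ e ∈ 𝒜, s ∈ e.source) :
    (∀ e ∈ 𝒜, C.HypHIn e) ↔ ∀ (s : S) (y z : TangentSpace (𝓡 r) s), C.gyroTensor s y z =
      (1 / ((r : ℝ) - 1)) • (LinearMap.trace ℝ _ ((C.gyroTensor s).flip z) • y -
        LinearMap.trace ℝ _ ((C.gyroTensor s).flip y) • z) := by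
  have key : ∀ e (he : e ∈ 𝒜) s (hs : s ∈ e.source),
      ((∀ i j l : Fin r, l ≠ i → i ≠ j → j ≠ l → C.gyroCoeff e i j l s = 0) ∧
        (∀ i j l : Fin r, j ≠ i → l ≠ i → C.gyroCoeff e i j j s = C.gyroCoeff e i l l s)) ↔
      ∀ y z : TangentSpace (𝓡 r) s, C.gyroTensor s y z =
      (1 / ((r : ℝ) - 1)) • (LinearMap.trace ℝ _ ((C.gyroTensor s).flip z) • y -
        LinearMap.trace ℝ _ ((C.gyroTensor s).flip y) • z) := by
    intro e he s hs
    simp_rw [C.gyroCoeff_eq_repr (h𝒜 he) hs]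
    exact coeff_conditions_iff_eq_trace hr (coordBasis (h𝒜 he) hs) (C.gyroTensor s)
      (C.gyroTensor_swap s)
  constructor
  · intro h s
    obtain ⟨e, he, hs⟩ := hcover s
    exact (key e he s hs).1 (h e he s hs)
  · intro h e he s hs
    exact (key e he s hs).2 (h s)

/-- Both sides of the identity depend only on the values of the fields at `s`, and those values are
arbitrary because tangent vectors extend to global smooth fields. -/
theorem hypH'_iff [T2Space S] :
    C.HypH' ↔ ∀ (s : S) (y z : TangentSpace (𝓡 r) s), C.gyroTensor s y z =
      (1 / ((r : ℝ) - 1)) • (LinearMap.trace ℝ _ ((C.gyroTensor s).flip z) • y -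
        LinearMap.trace ℝ _ ((C.gyroTensor s).flip y) • z) := by
  have hd : ∀ {Y : ∀ s : S, TangentSpace (𝓡 r) s} (s : S), IsSmoothField Y →
      MDifferentiableAt (𝓡 r) (𝓡 r).tangent
        (fun s => (⟨s, Y s⟩ : TangentBundle (𝓡 r) S)) s := fun s hY =>
    hY.mdifferentiableAt (by simp)
  constructor
  · intro h s y z
    obtain ⟨Y, hY, rfl⟩ := exists_isSmoothField_eq s y
    obtain ⟨Z, hZ, rfl⟩ := exists_isSmoothField_eq s z
    rw [← C.theta_eq_trace (hd s hY), ← C.theta_eq_trace (hd s hZ),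
      ← C.gyro_eq_gyroTensor (hd s hY) (hd s hZ)]
    exact h Y Z hY hZ s
  · intro h Y Z hY hZ s
    rw [C.theta_eq_trace (hd s hY), C.theta_eq_trace (hd s hZ),
      C.gyro_eq_gyroTensor (hd s hY) (hd s hZ)]
    exact h s _ _

theorem isSimple_iff [T2Space S] (φ : S → ℝ) :
    C.IsSimple φ ↔ ∀ (s : S) (y z : TangentSpace (𝓡 r) s), C.gyroTensor s y z =
      (show ℝ from mfderiv (𝓡 r) 𝓘(ℝ, ℝ) φ s z) • y -
        (show ℝ from mfderiv (𝓡 r) 𝓘(ℝ, ℝ) φ s y) • z := by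
  have hd : ∀ {Y : ∀ s : S, TangentSpace (𝓡 r) s} (s : S), IsSmoothField Y →
      MDifferentiableAt (𝓡 r) (𝓡 r).tangent
        (fun s => (⟨s, Y s⟩ : TangentBundle (𝓡 r) S)) s := fun s hY =>
    hY.mdifferentiableAt (by simp)
  constructor
  · intro h s y z
    obtain ⟨Y, hY, rfl⟩ := exists_isSmoothField_eq s y
    obtain ⟨Z, hZ, rfl⟩ := exists_isSmoothField_eq s z
    rw [← C.gyro_eq_gyroTensor (hd s hY) (hd s hZ)]
    exact h Y Z hY hZ s
  · intro h Y Z hY hZ s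
    rw [C.gyro_eq_gyroTensor (hd s hY) (hd s hZ)]
    exact h s _ _

end ChaplyginSystem

/-! ### Vector fields with constant components in a chart. -/

section ConstField

variable {r : ℕ} {S : Type*} [TopologicalSpace S] [ChartedSpace (EuclideanSpace ℝ (Fin r)) S]
  [IsManifold (𝓡 r) ∞ S]

/-- The vector field which is constant, equal to `u`, in the preferred chart at `s₀`. -/
def chartConstField (s₀ : S) (u : EuclideanSpace ℝ (Fin r)) (s : S) : TangentSpace (𝓡 r) s :=
  (chartDeriv (𝓡 r) s₀ s).inverse u

theorem chartDeriv_chartConstField {s₀ s : S}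
    (hs : s ∈ (chartAt (EuclideanSpace ℝ (Fin r)) s₀).source) (u : EuclideanSpace ℝ (Fin r)) :
    chartDeriv (𝓡 r) s₀ s (chartConstField s₀ u s) = u :=
  (isInvertible_chartDeriv (I := 𝓡 r) hs).self_apply_inverse u

theorem chartConstField_chartDeriv {s₀ s : S}
    (hs : s ∈ (chartAt (EuclideanSpace ℝ (Fin r)) s₀).source) (v : TangentSpace (𝓡 r) s) :
    chartConstField s₀ (chartDeriv (𝓡 r) s₀ s v) s = v :=
  (isInvertible_chartDeriv (I := 𝓡 r) hs).inverse_apply_self v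

theorem chartField_chartConstField (s₀ : S) (u : EuclideanSpace ℝ (Fin r)) {s : S}
    (hs : s ∈ (chartAt (EuclideanSpace ℝ (Fin r)) s₀).source) :
    chartField (𝓡 r) s₀ (chartConstField s₀ u) =ᶠ[𝓝 (extChartAt (𝓡 r) s₀ s)] fun _ => u := by
  filter_upwards [extChartAt_target_mem_nhds' ((extChartAt (𝓡 r) s₀).map_source
    (x := s) (by rwa [extChartAt_source]))] with z hz
  have := (extChartAt (𝓡 r) s₀).map_target hz
  rw [extChartAt_source] at this
  exact chartDeriv_chartConstField this u

theorem contMDiffAt_chartConstField {s₀ s : S}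
    (hs : s ∈ (chartAt (EuclideanSpace ℝ (Fin r)) s₀).source) (u : EuclideanSpace ℝ (Fin r)) :
    ContMDiffAt (𝓡 r) (𝓡 r).tangent ∞
      (fun s => (⟨s, chartConstField s₀ u s⟩ : TangentBundle (𝓡 r) S)) s := by
  have h1 : ContMDiffAt (𝓡 r) (𝓡 r).tangent ∞ (fun y : EuclideanSpace ℝ (Fin r) =>
      (⟨y, u⟩ : TangentBundle (𝓡 r) (EuclideanSpace ℝ (Fin r)))) (extChartAt (𝓡 r) s₀ s) := by
    exact contMDiffAt_vectorSpace_iff_contDiffAt.2 contDiffAt_const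
  exact h1.mpullback_vectorField_preimage (contMDiffAt_extChartAt' (n := ∞) hs)
    (isInvertible_chartDeriv (I := 𝓡 r) hs) (by simp)

/-- These fields are pullbacks of constant fields, which commute. With them the gyroscopic tensor is
the projected bracket of lifts, with no correction term. -/
theorem mlieBracket_chartConstField {s₀ s : S}
    (hs : s ∈ (chartAt (EuclideanSpace ℝ (Fin r)) s₀).source) (u v : EuclideanSpace ℝ (Fin r)) :
    VectorField.mlieBracket (𝓡 r) (chartConstField s₀ u) (chartConstField s₀ v) s = 0 := by
  have h1 : ∀ u : EuclideanSpace ℝ (Fin r), MDifferentiableAt (𝓡 r) (𝓡 r).tangent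
      (fun y : EuclideanSpace ℝ (Fin r) =>
        (⟨y, u⟩ : TangentBundle (𝓡 r) (EuclideanSpace ℝ (Fin r)))) (extChartAt (𝓡 r) s₀ s) :=
    fun u => (contMDiffAt_vectorSpace_iff_contDiffAt.2 contDiffAt_const :
      ContMDiffAt (𝓡 r) (𝓡 r).tangent ∞ _ _).mdifferentiableAt (by simp)
  have hm := isManifold_minSmoothness (r := r) (S := S)
  have hm' := isManifold_minSmoothness (r := r) (S := EuclideanSpace ℝ (Fin r))
  have h2 := VectorField.mpullback_mlieBracket (I := 𝓡 r) (n := ∞) (h1 u) (h1 v)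
    (contMDiffAt_extChartAt' hs) minSmoothness_two_le
  refine h2.symm.trans ?_
  rw [VectorField.mpullback_apply]
  have h3 : VectorField.mlieBracket (𝓡 r) (fun _ : EuclideanSpace ℝ (Fin r) => u)
      (fun _ : EuclideanSpace ℝ (Fin r) => v) (extChartAt (𝓡 r) s₀ s) = 0 := by
    refine (congrFun VectorField.mlieBracketWithin_eq_lieBracketWithin _).trans ?_
    simp [VectorField.lieBracketWithin]
    rfl
  exact (congrArg _ h3).trans (map_zero _)

end ConstField


/-! ### The reduced metric and its smoothness. -/

namespace ChaplyginSystem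

variable {n k r : ℕ} {Q G S : Type*}
  [TopologicalSpace Q] [ChartedSpace (EuclideanSpace ℝ (Fin n)) Q] [IsManifold (𝓡 n) ∞ Q]
  [TopologicalSpace G] [ChartedSpace (EuclideanSpace ℝ (Fin k)) G] [Group G]
  [LieGroup (𝓡 k) ∞ G]
  [TopologicalSpace S] [ChartedSpace (EuclideanSpace ℝ (Fin r)) S] [IsManifold (𝓡 r) ∞ S]
  [MulAction G Q] [ContMDiffSMul (𝓡 k) (𝓡 n) ∞ G Q] [ProperSMul G Q]
  (C : ChaplyginSystem n k r Q G S)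

/-- The horizontal lift of a vector, given by its components in the preferred chart at `s₀`. -/
def liftAt (s₀ : S) (q : Q) : EuclideanSpace ℝ (Fin r) →L[ℝ] EuclideanSpace ℝ (Fin n) :=
  (C.D q).subtypeL.comp ((C.hor q).comp (chartDeriv (𝓡 r) s₀ (C.proj q)).inverse)

/-- The kinetic energy metric on horizontal lifts, in the preferred chart at `s₀`. -/
def metricAt (s₀ : S) (q : Q) :
    EuclideanSpace ℝ (Fin r) →L[ℝ] EuclideanSpace ℝ (Fin r) →L[ℝ] ℝ :=
  ContinuousLinearMap.bilinearComp
    (show EuclideanSpace ℝ (Fin n) →L[ℝ] EuclideanSpace ℝ (Fin n) →L[ℝ] ℝ from C.metric.inner q)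
    (C.liftAt s₀ q) (C.liftAt s₀ q)

theorem metricAt_apply (s₀ : S) (q : Q) (u v : EuclideanSpace ℝ (Fin r)) :
    C.metricAt s₀ q u v = C.metric.inner q (C.horField (chartConstField s₀ u) q)
      (C.horField (chartConstField s₀ v) q) := rfl

theorem metricAt_smul (s₀ : S) (g : G) (q : Q) : C.metricAt s₀ (g • q) = C.metricAt s₀ q := by
  refine ContinuousLinearMap.ext fun u => ContinuousLinearMap.ext fun v => ?_
  rw [metricAt_apply, metricAt_apply, ← C.mfderiv_smul_horField, ← C.mfderiv_smul_horField,
    C.metric_smul]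

/-- The reduced metric on `S`, in the preferred chart at `s₀`. -/
def reducedMetric (s₀ s : S) :
    EuclideanSpace ℝ (Fin r) →L[ℝ] EuclideanSpace ℝ (Fin r) →L[ℝ] ℝ :=
  C.metricAt s₀ (Function.surjInv C.surjective_proj s)

theorem reducedMetric_proj (s₀ : S) (q : Q) : C.reducedMetric s₀ (C.proj q) = C.metricAt s₀ q := by
  obtain ⟨g, hg⟩ := (C.proj_eq_iff q _).1 (Function.surjInv_eq C.surjective_proj (C.proj q)).symm
  rw [reducedMetric, ← hg, metricAt_smul]

theorem reducedMetric_symm (s₀ s : S) (u v : EuclideanSpace ℝ (Fin r)) :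
    C.reducedMetric s₀ s u v = C.reducedMetric s₀ s v u :=
  C.metric.symm _ _ _

theorem reducedMetric_injective {s₀ s : S}
    (hs : s ∈ (chartAt (EuclideanSpace ℝ (Fin r)) s₀).source) :
    Function.Injective (C.reducedMetric s₀ s) := by
  obtain ⟨q, rfl⟩ := C.surjective_proj s
  rw [C.reducedMetric_proj]
  refine (injective_iff_map_eq_zero _).2 fun u hu => ?_
  have h : C.metric.inner q (C.horField (chartConstField s₀ u) q)
    (C.horField (chartConstField s₀ u) q) = 0 := congrArg (fun L => L u) hu
  have h0 : C.horField (chartConstField s₀ u) q = 0 := by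
    by_contra hne
    exact (C.metric.pos q _ hne).ne' h
  rw [← chartDeriv_chartConstField hs u, ← C.mfderiv_proj_hor q (chartConstField s₀ u (C.proj q))]
  exact (congrArg (fun w => chartDeriv (𝓡 r) s₀ (C.proj q)
    (mfderiv (𝓡 n) (𝓡 r) C.proj q w)) h0).trans (by rw [map_zero, map_zero])

theorem isInvertible_reducedMetric {s₀ s : S}
    (hs : s ∈ (chartAt (EuclideanSpace ℝ (Fin r)) s₀).source) :
    (C.reducedMetric s₀ s).IsInvertible := by
  have hf : Module.finrank ℝ (EuclideanSpace ℝ (Fin r)) =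
      Module.finrank ℝ (EuclideanSpace ℝ (Fin r) →L[ℝ] ℝ) := by
    rw [← (LinearMap.toContinuousLinearMap (𝕜 := ℝ) (E := EuclideanSpace ℝ (Fin r))
      (F' := ℝ)).finrank_eq]
    exact (Subspace.dual_finrank_eq (K := ℝ)).symm
  exact ⟨(LinearEquiv.ofInjectiveOfFinrankEq (C.reducedMetric s₀ s).toLinearMap
    (C.reducedMetric_injective hs) hf).toContinuousLinearEquiv,
    ContinuousLinearMap.ext fun _ => rfl⟩

theorem contMDiffAt_metric_inner {X Y : ∀ q : Q, TangentSpace (𝓡 n) q} {q : Q}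
    (hX : ContMDiffAt (𝓡 n) (𝓡 n).tangent ∞ (fun q => (⟨q, X q⟩ : TangentBundle (𝓡 n) Q)) q)
    (hY : ContMDiffAt (𝓡 n) (𝓡 n).tangent ∞ (fun q => (⟨q, Y q⟩ : TangentBundle (𝓡 n) Q)) q) :
    ContMDiffAt (𝓡 n) 𝓘(ℝ, ℝ) ∞ (fun q => C.metric.inner q (X q) (Y q)) q := by
  have : ContMDiffAt (𝓡 n) ((𝓡 n).prod 𝓘(ℝ, ℝ)) ∞ (fun q => Bundle.TotalSpace.mk' ℝ
      (E := Bundle.Trivial Q ℝ) q (C.metric.inner q (X q) (Y q))) q := by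
    apply ContMDiffAt.clm_bundle_apply₂ (F₁ := EuclideanSpace ℝ (Fin n))
      (F₂ := EuclideanSpace ℝ (Fin n))
    · exact C.metric.contMDiff.contMDiffAt
    · exact hX
    · exact hY
  exact (Bundle.contMDiffAt_totalSpace.1 this).2

theorem contMDiffAt_horField_chartConstField {s₀ : S} {q : Q}
    (hs : C.proj q ∈ (chartAt (EuclideanSpace ℝ (Fin r)) s₀).source)
    (u : EuclideanSpace ℝ (Fin r)) :
    ContMDiffAt (𝓡 n) (𝓡 n).tangent ∞
      (fun q => (⟨q, C.horField (chartConstField s₀ u) q⟩ : TangentBundle (𝓡 n) Q)) q :=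
  C.contMDiffAt_horField (contMDiffAt_chartConstField hs u)

/-- Smoothness of functions on `S` descends from `Q`. -/
theorem contMDiffAt_of_comp_proj {F : Type*} [NormedAddCommGroup F] [NormedSpace ℝ F] {f : S → F}
    {q : Q} (hf : ContMDiffAt (𝓡 n) 𝓘(ℝ, F) ∞ (f ∘ C.proj) q) :
    ContMDiffAt (𝓡 r) 𝓘(ℝ, F) ∞ f (C.proj q) :=
  contMDiffAt_of_comp_submersion C.contMDiff_proj.contMDiffAt (C.surjective_mfderiv_proj q) hf

/-- The definition picks a preimage by choice, so smoothness cannot be read off from it. By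
invariance the pullback to `Q` is the inner product of two smooth horizontal fields, and smoothness
descends along the submersion. -/
theorem contMDiffAt_reducedMetric {s₀ s : S}
    (hs : s ∈ (chartAt (EuclideanSpace ℝ (Fin r)) s₀).source) (u v : EuclideanSpace ℝ (Fin r)) :
    ContMDiffAt (𝓡 r) 𝓘(ℝ, ℝ) ∞ (fun s => C.reducedMetric s₀ s u v) s := by
  obtain ⟨q, rfl⟩ := C.surjective_proj s
  refine C.contMDiffAt_of_comp_proj ?_
  have h := C.contMDiffAt_metric_inner (C.contMDiffAt_horField_chartConstField hs u)
    (C.contMDiffAt_horField_chartConstField hs v)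
  refine h.congr_of_eventuallyEq (Filter.Eventually.of_forall fun q' => ?_)
  rw [Function.comp_apply, C.reducedMetric_proj, metricAt_apply]

/-- The gyroscopic tensor in the preferred chart at `s₀`. -/
def gyroChart (s₀ s : S) : EuclideanSpace ℝ (Fin r) →L[ℝ] EuclideanSpace ℝ (Fin r) →L[ℝ]
    EuclideanSpace ℝ (Fin r) :=
  LinearMap.toContinuousBilinearMap
    (((C.gyroTensor s).compl₁₂ (chartDeriv (𝓡 r) s₀ s).inverse.toLinearMap
      (chartDeriv (𝓡 r) s₀ s).inverse.toLinearMap).compr₂ (chartDeriv (𝓡 r) s₀ s).toLinearMap)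

theorem gyroChart_apply (s₀ s : S) (y z : EuclideanSpace ℝ (Fin r)) :
    C.gyroChart s₀ s y z = chartDeriv (𝓡 r) s₀ s
      (C.gyroTensor s (chartConstField s₀ y s) (chartConstField s₀ z s)) := rfl

end ChaplyginSystem

/-! ### Smoothness of the coordinate expressions of the gyroscopic tensor, cometric and potential.
-/

namespace ChaplyginSystem

variable {n k r : ℕ} {Q G S : Type*}
  [TopologicalSpace Q] [ChartedSpace (EuclideanSpace ℝ (Fin n)) Q] [IsManifold (𝓡 n) ∞ Q]
  [TopologicalSpace G] [ChartedSpace (EuclideanSpace ℝ (Fin k)) G] [Group G]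
  [LieGroup (𝓡 k) ∞ G]
  [TopologicalSpace S] [ChartedSpace (EuclideanSpace ℝ (Fin r)) S] [IsManifold (𝓡 r) ∞ S]
  [MulAction G Q] [ContMDiffSMul (𝓡 k) (𝓡 n) ∞ G Q] [ProperSMul G Q]
  (C : ChaplyginSystem n k r Q G S)

theorem inner_orthProj (q : Q) (u : TangentSpace (𝓡 n) q) {d : TangentSpace (𝓡 n) q}
    (hd : d ∈ C.D q) :
    C.metric.inner q (C.orthProj q u : TangentSpace (𝓡 n) q) d = C.metric.inner q u d := by
  have hu : u ∈ C.D q ⊔ C.Dperp q := by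
    rw [(C.isCompl_Dperp q).sup_eq_top]
    trivial
  obtain ⟨d', hd', e, he, rfl⟩ := Submodule.mem_sup.1 hu
  have h : (C.orthProj q (d' + e) : TangentSpace (𝓡 n) q) = d' := by
    rw [map_add, C.orthProj_of_mem_Dperp he, add_zero, C.orthProj_of_mem hd']
  rw [h, map_add, add_apply, he d hd, add_zero]

theorem gyroTensor_chartConstField [T2Space S] {s₀ : S} {q : Q}
    (hs : C.proj q ∈ (chartAt (EuclideanSpace ℝ (Fin r)) s₀).source)
    (y z : EuclideanSpace ℝ (Fin r)) :
    C.gyroTensor (C.proj q) (chartConstField s₀ y (C.proj q)) (chartConstField s₀ z (C.proj q)) =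
      C.projOrth q (VectorField.mlieBracket (𝓡 n) (C.horField (chartConstField s₀ y))
        (C.horField (chartConstField s₀ z)) q) := by
  have h := C.gyroBilin_eq (q := q)
    ((contMDiffAt_chartConstField hs y).mdifferentiableAt (by simp))
    ((contMDiffAt_chartConstField hs z).mdifferentiableAt (by simp))
  rw [mlieBracket_chartConstField hs, sub_zero] at h
  rw [C.gyroTensor_proj, h]

theorem gyroChart_proj [T2Space S] {s₀ : S} {q : Q}
    (hs : C.proj q ∈ (chartAt (EuclideanSpace ℝ (Fin r)) s₀).source)
    (y z : EuclideanSpace ℝ (Fin r)) :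
    C.gyroChart s₀ (C.proj q) y z =
      chartDeriv (𝓡 r) s₀ (C.proj q) (C.projOrth q (C.curvature q s₀ y z)) := by
  have hf := fun u => chartField_chartConstField s₀ u hs
  have hd := fun u => (hf u).differentiableAt_iff.2 (differentiableAt_const (𝕜 := ℝ) _)
  have h := C.chartDeriv_mlieBracket_horField hs (hd y) (hd z)
  rw [(hf y).lieBracket_vectorField_eq (hf z), chartDeriv_chartConstField hs,
    chartDeriv_chartConstField hs] at h
  have h0 : VectorField.lieBracket ℝ (fun _ => y) (fun _ => z)
      (extChartAt (𝓡 r) s₀ (C.proj q)) = 0 := by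
    simp [VectorField.lieBracket]
  rw [h0, map_zero, add_zero] at h
  rw [gyroChart_apply, C.gyroTensor_chartConstField hs, h]

/-- Pairing with a horizontal vector removes the orthogonal projector, so smoothness of `P` is not
needed: the right-hand side is built from the metric, a bracket and horizontal fields. -/
theorem metricAt_gyroChart [T2Space S] {s₀ : S} {q : Q}
    (hs : C.proj q ∈ (chartAt (EuclideanSpace ℝ (Fin r)) s₀).source)
    (y z v : EuclideanSpace ℝ (Fin r)) :
    C.metricAt s₀ q (C.gyroChart s₀ (C.proj q) y z) v =
      C.metric.inner q (VectorField.mlieBracket (𝓡 n) (C.horField (chartConstField s₀ y))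
        (C.horField (chartConstField s₀ z)) q) (C.horField (chartConstField s₀ v) q) := by
  rw [metricAt_apply, horField, gyroChart_apply, chartConstField_chartDeriv hs,
    C.gyroTensor_chartConstField hs, C.hor_projOrth]
  exact C.inner_orthProj q _ (C.hor q _).2

theorem contMDiffAt_reducedMetric_gyroChart [T2Space S] {s₀ s : S}
    (hs : s ∈ (chartAt (EuclideanSpace ℝ (Fin r)) s₀).source) (y z v : EuclideanSpace ℝ (Fin r)) :
    ContMDiffAt (𝓡 r) 𝓘(ℝ, ℝ) ∞
      (fun s => C.reducedMetric s₀ s (C.gyroChart s₀ s y z) v) s := by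
  have := isManifold_minSmoothness (r := n) (S := Q)
  have : IsManifold (𝓡 n) (((⊤ : ℕ∞) : WithTop ℕ∞) + 1) Q :=
    inferInstanceAs (IsManifold (𝓡 n) ∞ Q)
  obtain ⟨q, rfl⟩ := C.surjective_proj s
  refine C.contMDiffAt_of_comp_proj ?_
  have h := C.contMDiffAt_metric_inner
    ((C.contMDiffAt_horField_chartConstField hs y).mlieBracket_vectorField (m := ⊤) (n := ⊤)
      (C.contMDiffAt_horField_chartConstField hs z)
      (by rw [minSmoothness_of_isRCLikeNormedField]; rfl))
    (C.contMDiffAt_horField_chartConstField hs v)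
  refine h.congr_of_eventuallyEq ?_
  filter_upwards [C.eventually_mem_source hs] with q' hq'
  rw [Function.comp_apply, C.reducedMetric_proj, C.metricAt_gyroChart hq'.2]

/-- The reduced metric in the preferred chart at `s₀`. -/
def metricChart (s₀ : S) (x : EuclideanSpace ℝ (Fin r)) :
    EuclideanSpace ℝ (Fin r) →L[ℝ] EuclideanSpace ℝ (Fin r) →L[ℝ] ℝ :=
  C.reducedMetric s₀ ((extChartAt (𝓡 r) s₀).symm x)

/-- The reduced cometric in the preferred chart at `s₀`. -/
def cometricChart (s₀ : S) (x : EuclideanSpace ℝ (Fin r)) :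
    (EuclideanSpace ℝ (Fin r) →L[ℝ] ℝ) →L[ℝ] EuclideanSpace ℝ (Fin r) :=
  (C.metricChart s₀ x).inverse

/-- The gyroscopic tensor in the preferred chart at `s₀`, as a function of the coordinates. -/
def gyroCoord (s₀ : S) (x : EuclideanSpace ℝ (Fin r)) :
    EuclideanSpace ℝ (Fin r) →L[ℝ] EuclideanSpace ℝ (Fin r) →L[ℝ] EuclideanSpace ℝ (Fin r) :=
  C.gyroChart s₀ ((extChartAt (𝓡 r) s₀).symm x)

/-- The potential in the preferred chart at `s₀`. -/
def potentialChart (s₀ : S) (x : EuclideanSpace ℝ (Fin r)) : ℝ :=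
  C.U (Function.surjInv C.surjective_proj ((extChartAt (𝓡 r) s₀).symm x))

end ChaplyginSystem

section ContDiffOnTarget

variable {r : ℕ} {S : Type*} [TopologicalSpace S] [ChartedSpace (EuclideanSpace ℝ (Fin r)) S]
  [IsManifold (𝓡 r) ∞ S]

omit [IsManifold (𝓡 r) ∞ S] in
theorem symm_mem_chartAt_source {s₀ : S} {x : EuclideanSpace ℝ (Fin r)}
    (hx : x ∈ (extChartAt (𝓡 r) s₀).target) :
    (extChartAt (𝓡 r) s₀).symm x ∈ (chartAt (EuclideanSpace ℝ (Fin r)) s₀).source := by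
  rw [← extChartAt_source (𝓡 r)]
  exact (extChartAt (𝓡 r) s₀).map_target hx

theorem contDiffOn_comp_extChartAt_symm {F : Type*} [NormedAddCommGroup F] [NormedSpace ℝ F]
    {s₀ : S} {f : S → F} (hf : ∀ s ∈ (chartAt (EuclideanSpace ℝ (Fin r)) s₀).source,
      ContMDiffAt (𝓡 r) 𝓘(ℝ, F) ∞ f s) :
    ContDiffOn ℝ ∞ (fun x => f ((extChartAt (𝓡 r) s₀).symm x)) (extChartAt (𝓡 r) s₀).target := by
  rw [← contMDiffOn_iff_contDiffOn]
  intro x hx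
  exact (hf _ (symm_mem_chartAt_source hx)).comp_contMDiffWithinAt x
    (contMDiffOn_extChartAt_symm s₀ x hx)

end ContDiffOnTarget

namespace ChaplyginSystem

variable {n k r : ℕ} {Q G S : Type*}
  [TopologicalSpace Q] [ChartedSpace (EuclideanSpace ℝ (Fin n)) Q] [IsManifold (𝓡 n) ∞ Q]
  [TopologicalSpace G] [ChartedSpace (EuclideanSpace ℝ (Fin k)) G] [Group G]
  [LieGroup (𝓡 k) ∞ G]
  [TopologicalSpace S] [ChartedSpace (EuclideanSpace ℝ (Fin r)) S] [IsManifold (𝓡 r) ∞ S]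
  [MulAction G Q] [ContMDiffSMul (𝓡 k) (𝓡 n) ∞ G Q] [ProperSMul G Q]
  (C : ChaplyginSystem n k r Q G S)

theorem isInvertible_metricChart {s₀ : S} {x : EuclideanSpace ℝ (Fin r)}
    (hx : x ∈ (extChartAt (𝓡 r) s₀).target) : (C.metricChart s₀ x).IsInvertible :=
  C.isInvertible_reducedMetric (symm_mem_chartAt_source hx)

theorem contDiffOn_metricChart (s₀ : S) :
    ContDiffOn ℝ ∞ (C.metricChart s₀) (extChartAt (𝓡 r) s₀).target := by
  refine contDiffOn_clm_apply.2 fun u => contDiffOn_clm_apply.2 fun v => ?_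
  exact contDiffOn_comp_extChartAt_symm (f := fun s => C.reducedMetric s₀ s u v)
    fun s hs => C.contMDiffAt_reducedMetric hs u v

theorem contDiffOn_cometricChart (s₀ : S) :
    ContDiffOn ℝ ∞ (C.cometricChart s₀) (extChartAt (𝓡 r) s₀).target := fun x hx =>
  ContDiffAt.comp_contDiffWithinAt (g := ContinuousLinearMap.inverse) x
    (C.isInvertible_metricChart hx).contDiffAt_map_inverse (C.contDiffOn_metricChart s₀ x hx)

/-- The components of the tensor are recovered from its smooth pairings by applying the smooth
cometric. -/
theorem contDiffOn_gyroCoord [T2Space S] (s₀ : S) :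
    ContDiffOn ℝ ∞ (C.gyroCoord s₀) (extChartAt (𝓡 r) s₀).target := by
  refine contDiffOn_clm_apply.2 fun y => contDiffOn_clm_apply.2 fun z => ?_
  have h : ContDiffOn ℝ ∞ (fun x => C.metricChart s₀ x (C.gyroCoord s₀ x y z))
      (extChartAt (𝓡 r) s₀).target := by
    refine contDiffOn_clm_apply.2 fun v => ?_
    exact contDiffOn_comp_extChartAt_symm
      (f := fun s => C.reducedMetric s₀ s (C.gyroChart s₀ s y z) v)
      fun s hs => C.contMDiffAt_reducedMetric_gyroChart hs y z v
  refine ((C.contDiffOn_cometricChart s₀).clm_apply h).congr fun x hx => ?_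
  exact ((C.isInvertible_metricChart hx).inverse_apply_self _).symm

theorem U_surjInv (q : Q) : C.U (Function.surjInv C.surjective_proj (C.proj q)) = C.U q := by
  obtain ⟨g, hg⟩ := (C.proj_eq_iff q _).1 (Function.surjInv_eq C.surjective_proj (C.proj q)).symm
  rw [← hg, C.U_smul]

theorem contDiffOn_potentialChart (s₀ : S) :
    ContDiffOn ℝ ∞ (C.potentialChart s₀) (extChartAt (𝓡 r) s₀).target := by
  refine contDiffOn_comp_extChartAt_symm
    (f := fun s => C.U (Function.surjInv C.surjective_proj s)) fun s _ => ?_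
  obtain ⟨q, rfl⟩ := C.surjective_proj s
  refine C.contMDiffAt_of_comp_proj (C.contMDiff_U.contMDiffAt.congr_of_eventuallyEq ?_)
  exact Filter.Eventually.of_forall fun q' => C.U_surjInv q'

end ChaplyginSystem

/-! ### Derivatives of cotangent lifts and of quadratic Hamiltonians. -/

section MFDerivChart

variable {E H M : Type*} [NormedAddCommGroup E] [NormedSpace ℝ E] [TopologicalSpace H]
  {I : ModelWithCorners ℝ E H} [TopologicalSpace M] [ChartedSpace H M]
  [IsManifold I 1 M] {F : Type*} [NormedAddCommGroup F] [NormedSpace ℝ F]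

theorem mfderiv_eq_of_eventuallyEq_comp_extChartAt {f : M → F} {g : E → F} {L : E →L[ℝ] F}
    {x₀ x : M} (hx : x ∈ (chartAt H x₀).source) (hf : f =ᶠ[𝓝 x] g ∘ extChartAt I x₀)
    (hg : HasFDerivAt g L (extChartAt I x₀ x)) (v : TangentSpace I x) :
    (mfderiv I 𝓘(ℝ, F) f x v : F) = L (chartDeriv I x₀ x v) := by
  have h := (hg.hasMFDerivAt.comp x (mdifferentiableAt_extChartAt hx).hasMFDerivAt
    ).congr_of_eventuallyEq hf
  rw [h.mfderiv]
  rfl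

end MFDerivChart

section LiftDual

variable {E F : Type*} [NormedAddCommGroup E] [NormedSpace ℝ E] [NormedAddCommGroup F]
  [NormedSpace ℝ F]

/-- The map `(x, p) ↦ (f x, p ∘ h x)` and its derivative. -/
theorem exists_hasFDerivAt_prod_comp {f : E → F} {h : E → F →L[ℝ] E} {z : E × (E →L[ℝ] ℝ)}
    (hf : DifferentiableAt ℝ f z.1) (hh : DifferentiableAt ℝ h z.1) :
    ∃ L : E × (E →L[ℝ] ℝ) →L[ℝ] F × (F →L[ℝ] ℝ),
      HasFDerivAt (fun z : E × (E →L[ℝ] ℝ) => (f z.1, z.2.comp (h z.1))) L z ∧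
      ∀ u w, L (u, w) = (fderiv ℝ f z.1 u, w.comp (h z.1) + z.2.comp (fderiv ℝ h z.1 u)) := by
  refine ⟨_, HasFDerivAt.prodMk (hf.hasFDerivAt.comp z hasFDerivAt_fst)
    (HasFDerivAt.clm_comp hasFDerivAt_snd (hh.hasFDerivAt.comp z hasFDerivAt_fst)),
    fun u w => ?_⟩
  refine Prod.ext rfl ?_
  exact add_comm _ _

/-- The derivative of the Hamiltonian `(x, p) ↦ ½ p (K x p) + U x`, for symmetric `K x`. -/
theorem exists_hasFDerivAt_quadratic {K : E → (E →L[ℝ] ℝ) →L[ℝ] E} {U : E → ℝ}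
    {z : E × (E →L[ℝ] ℝ)} (hK : DifferentiableAt ℝ K z.1) (hU : DifferentiableAt ℝ U z.1)
    (hsymm : ∀ p p' : E →L[ℝ] ℝ, p (K z.1 p') = p' (K z.1 p)) :
    ∃ L : E × (E →L[ℝ] ℝ) →L[ℝ] ℝ,
      HasFDerivAt (fun z : E × (E →L[ℝ] ℝ) => (1 / 2 : ℝ) * z.2 (K z.1 z.2) + U z.1) L z ∧
      ∀ u w, L (u, w) = w (K z.1 z.2) +
        ((1 / 2 : ℝ) * z.2 (fderiv ℝ K z.1 u z.2) + fderiv ℝ U z.1 u) := by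
  have h1 : HasFDerivAt (fun z : E × (E →L[ℝ] ℝ) => K z.1 z.2) _ z :=
    (hK.hasFDerivAt.comp z hasFDerivAt_fst).clm_apply hasFDerivAt_snd
  have h2 : HasFDerivAt (fun z : E × (E →L[ℝ] ℝ) => z.2 (K z.1 z.2)) _ z :=
    HasFDerivAt.clm_apply hasFDerivAt_snd h1
  refine ⟨_, (h2.const_mul (1 / 2 : ℝ)).add (hU.hasFDerivAt.comp z hasFDerivAt_fst),
    fun u w => ?_⟩
  have h3 : z.2 (K z.1 w) = w (K z.1 z.2) := hsymm _ _
  change (1 / 2 : ℝ) * (z.2 (K z.1 w + fderiv ℝ K z.1 u z.2) + w (K z.1 z.2)) +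
    fderiv ℝ U z.1 u = _
  rw [map_add, h3]
  ring

end LiftDual

/-! ### The constrained Hamiltonian as a function on `T*S`. -/

namespace ChaplyginSystem

variable {n k r : ℕ} {Q G S : Type*}
  [TopologicalSpace Q] [ChartedSpace (EuclideanSpace ℝ (Fin n)) Q] [IsManifold (𝓡 n) ∞ Q]
  [TopologicalSpace G] [ChartedSpace (EuclideanSpace ℝ (Fin k)) G] [Group G]
  [LieGroup (𝓡 k) ∞ G]
  [TopologicalSpace S] [ChartedSpace (EuclideanSpace ℝ (Fin r)) S] [IsManifold (𝓡 r) ∞ S]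
  [MulAction G Q] [ContMDiffSMul (𝓡 k) (𝓡 n) ∞ G Q] [ProperSMul G Q]
  (C : ChaplyginSystem n k r Q G S)

theorem isInvertible_metric_inner (q : Q) : (C.metric.inner q).IsInvertible := by
  have hinj : Function.Injective (C.metric.inner q) := by
    refine (injective_iff_map_eq_zero _).2 fun u hu => ?_
    by_contra hne
    exact (C.metric.pos q u hne).ne' (congrArg (fun L => L u) hu)
  have hf : Module.finrank ℝ (TangentSpace (𝓡 n) q) =
      Module.finrank ℝ (TangentSpace (𝓡 n) q →L[ℝ] ℝ) := by
    rw [← (LinearMap.toContinuousLinearMap (𝕜 := ℝ) (E := TangentSpace (𝓡 n) q)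
      (F' := ℝ)).finrank_eq]
    exact (Subspace.dual_finrank_eq (K := ℝ)).symm
  exact ⟨(LinearEquiv.ofInjectiveOfFinrankEq (C.metric.inner q).toLinearMap
    hinj hf).toContinuousLinearEquiv, ContinuousLinearMap.ext fun _ => rfl⟩

theorem cov_extendD (β : C.DualD) (u : TangentSpace (𝓡 n) β.pt) :
    (C.extendD β).cov u = (C.reduceD β).cov (C.projOrth β.pt u) :=
  congrArg β.cov (C.hor_projOrth β.pt u).symm

theorem restrictD_extendD (β : C.DualD) : C.restrictD (C.extendD β) = β := by
  obtain ⟨q, b⟩ := β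
  refine congrArg (DualD.mk q) (ContinuousLinearMap.ext fun d => ?_)
  exact congrArg b (Subtype.ext (C.orthProj_of_mem d.2))

theorem surjective_reduceD : Function.Surjective C.reduceD := by
  rintro ⟨s, p⟩
  obtain ⟨q, rfl⟩ := C.surjective_proj s
  refine ⟨⟨q, ContinuousLinearMap.comp (show TangentSpace (𝓡 r) (C.proj q) →L[ℝ] ℝ from p)
    (LinearMap.toContinuousLinearMap (C.projD q))⟩, ?_⟩
  refine congrArg (Bundle.TotalSpace.mk (C.proj q)) (ContinuousLinearMap.ext fun v => ?_)
  exact congrArg p (C.mfderiv_proj_hor q v)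

theorem metricChart_extChartAt_proj {s₀ : S} {q : Q}
    (hs : C.proj q ∈ (chartAt (EuclideanSpace ℝ (Fin r)) s₀).source) :
    C.metricChart s₀ (extChartAt (𝓡 r) s₀ (C.proj q)) = C.metricAt s₀ q := by
  rw [metricChart, (extChartAt (𝓡 r) s₀).left_inv (by rwa [extChartAt_source]),
    C.reducedMetric_proj]

omit [IsManifold (𝓡 r) ∞ S] in
theorem extChartAt_mem_target {s₀ s : S}
    (hs : s ∈ (chartAt (EuclideanSpace ℝ (Fin r)) s₀).source) :
    extChartAt (𝓡 r) s₀ s ∈ (extChartAt (𝓡 r) s₀).target :=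
  (extChartAt (𝓡 r) s₀).map_source (by rwa [extChartAt_source])

/-- The vector dual to the extended covector is the horizontal lift of the reduced velocity. -/
theorem inner_horField_cometricChart {a₀ : CotangentBundle r S} {β : C.DualD}
    (hs : C.proj β.pt ∈ (chartAt (EuclideanSpace ℝ (Fin r)) a₀.1).source)
    (u : TangentSpace (𝓡 n) β.pt) :
    C.metric.inner β.pt (C.horField (chartConstField a₀.1 (C.cometricChart a₀.1
      (extChartAt (𝓡 r) a₀.1 (C.proj β.pt))
      (extChartAt (cotangentModel r) a₀ (C.reduceD β)).2)) β.pt) u = (C.extendD β).cov u := by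
  set w := C.cometricChart a₀.1 (extChartAt (𝓡 r) a₀.1 (C.proj β.pt))
      (extChartAt (cotangentModel r) a₀ (C.reduceD β)).2 with hw
  have h1 : C.metric.inner β.pt (C.horField (chartConstField a₀.1 w) β.pt) u =
      C.metric.inner β.pt (C.horField (chartConstField a₀.1 w) β.pt)
        (C.hor β.pt (C.projOrth β.pt u)) := by
    rw [C.metric.symm, C.metric.symm _ _ (C.hor β.pt _ : TangentSpace (𝓡 n) β.pt), C.hor_projOrth]
    exact (C.inner_orthProj β.pt u (C.hor β.pt _).2).symm
  have h2 : (C.hor β.pt (C.projOrth β.pt u) : TangentSpace (𝓡 n) β.pt) =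
      C.horField (chartConstField a₀.1
        (chartDeriv (𝓡 r) a₀.1 (C.proj β.pt) (C.projOrth β.pt u))) β.pt := by
    rw [horField, chartConstField_chartDeriv hs]
  have h3 : C.metricAt a₀.1 β.pt w = (extChartAt (cotangentModel r) a₀ (C.reduceD β)).2 := by
    rw [← C.metricChart_extChartAt_proj hs, hw]
    exact (C.isInvertible_metricChart (extChartAt_mem_target hs)).self_apply_inverse _
  rw [h1, h2, ← metricAt_apply, h3]
  refine Eq.trans ?_ (C.cov_extendD β u).symm
  exact (cov_eq_extChartAt_cotangent_snd (a₀ := a₀) (a := C.reduceD β) hs _).symm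

/-- The reduced Hamiltonian in cotangent coordinates. -/
def hamChart (s₀ : S) (z : EuclideanSpace ℝ (Fin r) × (EuclideanSpace ℝ (Fin r) →L[ℝ] ℝ)) : ℝ :=
  (1 / 2 : ℝ) * z.2 (C.cometricChart s₀ z.1 z.2) + C.potentialChart s₀ z.1

/-- The vector dual to `P^* β` is the horizontal lift of `K p`, so its kinetic energy is `½ p(K p)`;
the potential is invariant and descends. -/
theorem constrainedHamiltonian_eq_hamChart {a₀ : CotangentBundle r S} {β : C.DualD}
    (hs : C.proj β.pt ∈ (chartAt (EuclideanSpace ℝ (Fin r)) a₀.1).source) :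
    C.constrainedHamiltonian β =
      C.hamChart a₀.1 (extChartAt (cotangentModel r) a₀ (C.reduceD β)) := by
  have hfst : (extChartAt (cotangentModel r) a₀ (C.reduceD β)).1 =
      extChartAt (𝓡 r) a₀.1 (C.proj β.pt) := extChartAt_cotangent_fst a₀ _
  have hα : (C.metric.inner β.pt (C.horField (chartConstField a₀.1 (C.cometricChart a₀.1
      (extChartAt (𝓡 r) a₀.1 (C.proj β.pt))
      (extChartAt (cotangentModel r) a₀ (C.reduceD β)).2)) β.pt)) = (C.extendD β).cov :=
    ContinuousLinearMap.ext fun u => C.inner_horField_cometricChart hs u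
  rw [hamChart, hfst]
  set w := C.cometricChart a₀.1 (extChartAt (𝓡 r) a₀.1 (C.proj β.pt))
      (extChartAt (cotangentModel r) a₀ (C.reduceD β)).2
  have hinv : (C.metric.inner β.pt).inverse (C.extendD β).cov =
      C.horField (chartConstField a₀.1 w) β.pt := by
    rw [← hα]
    exact (C.isInvertible_metric_inner β.pt).inverse_apply_self _
  have hval : (C.extendD β).cov (C.horField (chartConstField a₀.1 w) β.pt) =
      (extChartAt (cotangentModel r) a₀ (C.reduceD β)).2 w := by
    refine (C.cov_extendD β _).trans ?_
    refine (congrArg (C.reduceD β).cov (C.projOrth_hor β.pt _)).trans ?_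
    refine (cov_eq_extChartAt_cotangent_snd (a₀ := a₀) (a := C.reduceD β) hs _).trans ?_
    exact congrArg _ (chartDeriv_chartConstField hs w)
  have hU : C.potentialChart a₀.1 (extChartAt (𝓡 r) a₀.1 (C.proj β.pt)) = C.U β.pt := by
    rw [potentialChart, (extChartAt (𝓡 r) a₀.1).left_inv (by rwa [extChartAt_source]),
      C.U_surjInv]
  rw [hU, ← hval, ← hinv]
  rfl

end ChaplyginSystem

/-! ### The reduced equations of motion in cotangent coordinates. -/

namespace ChaplyginSystem

variable {n k r : ℕ} {Q G S : Type*}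
  [TopologicalSpace Q] [ChartedSpace (EuclideanSpace ℝ (Fin n)) Q] [IsManifold (𝓡 n) ∞ Q]
  [TopologicalSpace G] [ChartedSpace (EuclideanSpace ℝ (Fin k)) G] [Group G]
  [LieGroup (𝓡 k) ∞ G]
  [TopologicalSpace S] [ChartedSpace (EuclideanSpace ℝ (Fin r)) S] [IsManifold (𝓡 r) ∞ S]
  [MulAction G Q] [ContMDiffSMul (𝓡 k) (𝓡 n) ∞ G Q] [ProperSMul G Q]
  (C : ChaplyginSystem n k r Q G S)

theorem cometricChart_symm {s₀ : S} {x : EuclideanSpace ℝ (Fin r)}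
    (hx : x ∈ (extChartAt (𝓡 r) s₀).target) (p p' : EuclideanSpace ℝ (Fin r) →L[ℝ] ℝ) :
    p (C.cometricChart s₀ x p') = p' (C.cometricChart s₀ x p) := by
  have hinv := C.isInvertible_metricChart hx
  obtain ⟨u, rfl⟩ := hinv.surjective p
  obtain ⟨v, rfl⟩ := hinv.surjective p'
  rw [cometricChart, hinv.inverse_apply_self, hinv.inverse_apply_self]
  exact C.reducedMetric_symm _ _ u v

theorem surjective_cometricChart {s₀ : S} {x : EuclideanSpace ℝ (Fin r)}
    (hx : x ∈ (extChartAt (𝓡 r) s₀).target) :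
    Function.Surjective (C.cometricChart s₀ x) := fun u =>
  ⟨_, (C.isInvertible_metricChart hx).inverse_apply_self u⟩

/-- The derivative of the reduced Hamiltonian in the directions of the base. -/
def forceChart (s₀ : S) (z : EuclideanSpace ℝ (Fin r) × (EuclideanSpace ℝ (Fin r) →L[ℝ] ℝ)) :
    EuclideanSpace ℝ (Fin r) →L[ℝ] ℝ :=
  (1 / 2 : ℝ) • z.2.comp ((fderiv ℝ (C.cometricChart s₀) z.1).flip z.2) +
    fderiv ℝ (C.potentialChart s₀) z.1

/-- The reduced vector field in cotangent coordinates. -/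
def reducedChart (s₀ : S) (z : EuclideanSpace ℝ (Fin r) × (EuclideanSpace ℝ (Fin r) →L[ℝ] ℝ)) :
    EuclideanSpace ℝ (Fin r) × (EuclideanSpace ℝ (Fin r) →L[ℝ] ℝ) :=
  (C.cometricChart s₀ z.1 z.2, -C.forceChart s₀ z -
    z.2.comp ((C.gyroCoord s₀ z.1).flip (C.cometricChart s₀ z.1 z.2)))

theorem exists_hasFDerivAt_hamChart {s₀ : S}
    {z : EuclideanSpace ℝ (Fin r) × (EuclideanSpace ℝ (Fin r) →L[ℝ] ℝ)}
    (hz : z.1 ∈ (extChartAt (𝓡 r) s₀).target) :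
    ∃ L : EuclideanSpace ℝ (Fin r) × (EuclideanSpace ℝ (Fin r) →L[ℝ] ℝ) →L[ℝ] ℝ,
      HasFDerivAt (C.hamChart s₀) L z ∧
      ∀ u w, L (u, w) = w (C.cometricChart s₀ z.1 z.2) + C.forceChart s₀ z u := by
  have hmem := (isOpen_extChartAt_target (I := 𝓡 r) s₀).mem_nhds hz
  exact exists_hasFDerivAt_quadratic
    (((C.contDiffOn_cometricChart s₀).contDiffAt hmem).differentiableAt (by simp))
    (((C.contDiffOn_potentialChart s₀).contDiffAt hmem).differentiableAt (by simp))
    (C.cometricChart_symm hz)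

/-- The map `T*Q → T*S` in cotangent coordinates. -/
def reduceChart (q : Q) (s₀ : S)
    (z : EuclideanSpace ℝ (Fin n) × (EuclideanSpace ℝ (Fin n) →L[ℝ] ℝ)) :
    EuclideanSpace ℝ (Fin r) × (EuclideanSpace ℝ (Fin r) →L[ℝ] ℝ) :=
  (C.projChart q s₀ z.1, z.2.comp (C.horChart q s₀ z.1))

/-- Restricting a covector to `D` and reducing it means evaluating it on horizontal lifts; in
coordinates this is `(x, ξ) ↦ (π x, ξ ∘ H(x))`. -/
theorem extChartAt_reduceD_restrictD {α γ : CotangentBundle n Q} {a₀ : CotangentBundle r S}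
    (hγ : γ.1 ∈ (chartAt (EuclideanSpace ℝ (Fin n)) α.1).source)
    (hs : C.proj γ.1 ∈ (chartAt (EuclideanSpace ℝ (Fin r)) a₀.1).source) :
    extChartAt (cotangentModel r) a₀ (C.reduceD (C.restrictD γ)) =
      C.reduceChart α.1 a₀.1 (extChartAt (cotangentModel n) α γ) := by
  refine Prod.ext ?_ (ContinuousLinearMap.ext fun v => ?_)
  · rw [extChartAt_cotangent_fst, reduceChart, extChartAt_cotangent_fst,
      C.projChart_extChartAt _ hγ]
    rfl
  · obtain ⟨v, rfl⟩ := chartDeriv_surjective (I := 𝓡 r) hs v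
    refine (cov_eq_extChartAt_cotangent_snd (a₀ := a₀) (a := C.reduceD (C.restrictD γ))
      hs v).symm.trans ?_
    refine (cov_eq_extChartAt_cotangent_snd (a₀ := α) (a := γ) hγ (C.hor γ.1 v)).trans ?_
    rw [← C.horChart_chartDeriv hγ hs, ← extChartAt_cotangent_fst]
    rfl

theorem eventually_reduceChart {α : CotangentBundle n Q} {a₀ : CotangentBundle r S}
    (hs : C.proj α.1 ∈ (chartAt (EuclideanSpace ℝ (Fin r)) a₀.1).source) :
    ∀ᶠ γ in 𝓝 α, C.proj γ.1 ∈ (chartAt (EuclideanSpace ℝ (Fin r)) a₀.1).source ∧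
      extChartAt (cotangentModel r) a₀ (C.reduceD (C.restrictD γ)) =
        C.reduceChart α.1 a₀.1 (extChartAt (cotangentModel n) α γ) := by
  have hc : ContinuousAt (fun γ : CotangentBundle n Q => γ.1) α :=
    (Bundle.contMDiff_proj (n := ∞) (IB := 𝓡 n) (F := EuclideanSpace ℝ (Fin n) →L[ℝ] ℝ)
      (fun x : Q => TangentSpace (𝓡 n) x →L[ℝ] Bundle.Trivial Q ℝ x)).continuous.continuousAt
  filter_upwards [hc.eventually (C.eventually_mem_source hs)] with γ hγ
  exact ⟨hγ.2, C.extChartAt_reduceD_restrictD hγ.1 hγ.2⟩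

theorem exists_hasFDerivAt_reduceChart {q : Q} {s₀ : S}
    (hs : C.proj q ∈ (chartAt (EuclideanSpace ℝ (Fin r)) s₀).source)
    {z : EuclideanSpace ℝ (Fin n) × (EuclideanSpace ℝ (Fin n) →L[ℝ] ℝ)}
    (hz : z.1 = extChartAt (𝓡 n) q q) :
    ∃ L : EuclideanSpace ℝ (Fin n) × (EuclideanSpace ℝ (Fin n) →L[ℝ] ℝ) →L[ℝ]
        EuclideanSpace ℝ (Fin r) × (EuclideanSpace ℝ (Fin r) →L[ℝ] ℝ),
      HasFDerivAt (C.reduceChart q s₀) L z ∧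
      ∀ u w, L (u, w) = (fderiv ℝ (C.projChart q s₀) z.1 u,
        w.comp (C.horChart q s₀ z.1) + z.2.comp (fderiv ℝ (C.horChart q s₀) z.1 u)) :=
  exists_hasFDerivAt_prod_comp (hz ▸ C.differentiableAt_projChart hs)
    (hz ▸ C.differentiableAt_horChart hs)

theorem stdForm_left_injective {m : ℕ}
    {U V : EuclideanSpace ℝ (Fin m) × (EuclideanSpace ℝ (Fin m) →L[ℝ] ℝ)}
    (h : ∀ W, stdForm m U W = stdForm m V W) : U = V := by
  refine Prod.ext ?_ (ContinuousLinearMap.ext fun w => ?_)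
  · refine PiLp.ext fun i => ?_
    have := h (0, EuclideanSpace.proj i)
    simpa [stdForm_apply] using this
  · have := h (w, 0)
    simpa [stdForm_apply] using this

/-- The Hamiltonian vector of a function with a given derivative in cotangent coordinates. -/
theorem chartDeriv_hamiltonianVector {f : CotangentBundle n Q → ℝ} {α : CotangentBundle n Q}
    {W : EuclideanSpace ℝ (Fin n) × (EuclideanSpace ℝ (Fin n) →L[ℝ] ℝ)}
    (hW : ∀ v : TangentSpace (cotangentModel n) α,
      (show ℝ from mfderiv (cotangentModel n) 𝓘(ℝ, ℝ) f α v) =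
        stdForm n W (chartDeriv (cotangentModel n) α α v)) :
    chartDeriv (cotangentModel n) α α (hamiltonianVector f α) = W := by
  have hα := mem_chart_source (EuclideanSpace ℝ (Fin n)) α.1
  have hα' := mem_chartAt_cotangent_source.2 hα
  obtain ⟨w, hw⟩ := chartDeriv_surjective (I := cotangentModel n) hα' W
  -- The Hamiltonian vector is defined by choice: `W` witnesses existence, and nondegeneracy of the
  -- standard form gives uniqueness.
  have hspec := Classical.epsilon_spec (p := fun w : TangentSpace (cotangentModel n) α =>
    ∀ v : TangentSpace (cotangentModel n) α, canonicalForm α w v =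
      (show ℝ from mfderiv (cotangentModel n) 𝓘(ℝ, ℝ) f α v)) ⟨w, fun v => by
      rw [canonicalForm_eq_stdForm hα, hw]
      exact (hW v).symm⟩
  refine stdForm_left_injective fun V => ?_
  obtain ⟨v, rfl⟩ := chartDeriv_surjective (I := cotangentModel n) hα' V
  rw [← hW v, ← canonicalForm_eq_stdForm hα]
  exact hspec v

end ChaplyginSystem

/-! ### The nonholonomic bracket with the energy and the reduced vector field. -/

namespace ChaplyginSystem

variable {n k r : ℕ} {Q G S : Type*}
  [TopologicalSpace Q] [ChartedSpace (EuclideanSpace ℝ (Fin n)) Q] [IsManifold (𝓡 n) ∞ Q]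
  [TopologicalSpace G] [ChartedSpace (EuclideanSpace ℝ (Fin k)) G] [Group G]
  [LieGroup (𝓡 k) ∞ G]
  [TopologicalSpace S] [ChartedSpace (EuclideanSpace ℝ (Fin r)) S] [IsManifold (𝓡 r) ∞ S]
  [MulAction G Q] [ContMDiffSMul (𝓡 k) (𝓡 n) ∞ G Q] [ProperSMul G Q]
  (C : ChaplyginSystem n k r Q G S)

/-- The Hamiltonian vector of the constrained Hamiltonian, in the preferred chart at `α`. -/
def hamVecChart (α : CotangentBundle n Q) (s₀ : S)
    (z : EuclideanSpace ℝ (Fin r) × (EuclideanSpace ℝ (Fin r) →L[ℝ] ℝ)) :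
    EuclideanSpace ℝ (Fin n) × (EuclideanSpace ℝ (Fin n) →L[ℝ] ℝ) :=
  (C.horChart α.1 s₀ (extChartAt (𝓡 n) α.1 α.1) (C.cometricChart s₀ z.1 z.2),
    -(C.forceChart s₀ z).comp (fderiv ℝ (C.projChart α.1 s₀) (extChartAt (𝓡 n) α.1 α.1)) -
      (extChartAt (cotangentModel n) α α).2.comp
        ((fderiv ℝ (C.horChart α.1 s₀) (extChartAt (𝓡 n) α.1 α.1)).flip
          (C.cometricChart s₀ z.1 z.2)))

/-- The function is `hamChart` composed with the coordinate map `(x, ξ) ↦ (π x, ξ ∘ H(x))`; the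
chain rule gives its differential, from which the Hamiltonian vector is read off. -/
theorem chartDeriv_hamiltonianVector_constrained {α : CotangentBundle n Q}
    {a₀ : CotangentBundle r S}
    (hs : C.proj α.1 ∈ (chartAt (EuclideanSpace ℝ (Fin r)) a₀.1).source) :
    chartDeriv (cotangentModel n) α α
      (hamiltonianVector (C.constrainedHamiltonian ∘ C.restrictD) α) =
    C.hamVecChart α a₀.1 (extChartAt (cotangentModel r) a₀ (C.reduceD (C.restrictD α))) := by
  have hα := mem_chart_source (EuclideanSpace ℝ (Fin n)) α.1
  have hα' := mem_chartAt_cotangent_source.2 hα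
  have hx : (extChartAt (cotangentModel n) α α).1 = extChartAt (𝓡 n) α.1 α.1 :=
    extChartAt_cotangent_fst α α
  have hz := C.extChartAt_reduceD_restrictD (α := α) hα hs
  have hz1 : (C.reduceChart α.1 a₀.1 (extChartAt (cotangentModel n) α α)).1 ∈
      (extChartAt (𝓡 r) a₀.1).target := by
    rw [← hz, extChartAt_cotangent_fst]
    exact extChartAt_mem_target hs
  obtain ⟨LF, hLF, hLF'⟩ := C.exists_hasFDerivAt_reduceChart hs hx
  obtain ⟨LH, hLH, hLH'⟩ := C.exists_hasFDerivAt_hamChart hz1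
  refine chartDeriv_hamiltonianVector fun v => ?_
  have hev : C.constrainedHamiltonian ∘ C.restrictD =ᶠ[𝓝 α]
      (C.hamChart a₀.1 ∘ C.reduceChart α.1 a₀.1) ∘ extChartAt (cotangentModel n) α := by
    filter_upwards [C.eventually_reduceChart hs] with γ hγ
    refine (C.constrainedHamiltonian_eq_hamChart (β := C.restrictD γ) hγ.1).trans ?_
    rw [hγ.2]
    rfl
  refine (mfderiv_eq_of_eventuallyEq_comp_extChartAt hα' hev (hLH.comp _ hLF) v).trans ?_
  set V := chartDeriv (cotangentModel n) α α v
  change LH (LF (V.1, V.2)) = _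
  rw [hLF', hLH', hz, hx, stdForm_apply, hamVecChart]
  simp only [add_apply, sub_apply, neg_apply, ContinuousLinearMap.comp_apply,
    ContinuousLinearMap.flip_apply]
  ring

/-- The derivative of `H` appears twice: in the momentum part of the Hamiltonian vector and in the
differential of `ξ ∘ H(x)` along its base part. Together these terms form the curvature evaluated by
`ξ`. -/
theorem poissonBracket_reduce {α : CotangentBundle n Q} {a₀ : CotangentBundle r S}
    (hs : C.proj α.1 ∈ (chartAt (EuclideanSpace ℝ (Fin r)) a₀.1).source)
    {φ : CotangentBundle r S → ℝ}
    {L : EuclideanSpace ℝ (Fin r) × (EuclideanSpace ℝ (Fin r) →L[ℝ] ℝ) →L[ℝ] ℝ}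
    (hφ : HasFDerivAt (φ ∘ (extChartAt (cotangentModel r) a₀).symm) L
      (extChartAt (cotangentModel r) a₀ (C.reduceD (C.restrictD α)))) :
    ∃ P : EuclideanSpace ℝ (Fin r) →L[ℝ] ℝ,
      poissonBracket ((φ ∘ C.reduceD) ∘ C.restrictD) (C.constrainedHamiltonian ∘ C.restrictD) α =
        L (C.cometricChart a₀.1 (extChartAt (cotangentModel r) a₀ (C.reduceD (C.restrictD α))).1
          (extChartAt (cotangentModel r) a₀ (C.reduceD (C.restrictD α))).2, P) ∧
      ∀ v, P v = -C.forceChart a₀.1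
          (extChartAt (cotangentModel r) a₀ (C.reduceD (C.restrictD α))) v -
        (extChartAt (cotangentModel n) α α).2 (C.curvature α.1 a₀.1 v
          (C.cometricChart a₀.1 (extChartAt (cotangentModel r) a₀ (C.reduceD (C.restrictD α))).1
          (extChartAt (cotangentModel r) a₀ (C.reduceD (C.restrictD α))).2)) := by
  have hα := mem_chart_source (EuclideanSpace ℝ (Fin n)) α.1
  have hα' := mem_chartAt_cotangent_source.2 hα
  have hx : (extChartAt (cotangentModel n) α α).1 = extChartAt (𝓡 n) α.1 α.1 :=
    extChartAt_cotangent_fst α α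
  have hz := C.extChartAt_reduceD_restrictD (α := α) hα hs
  obtain ⟨LF, hLF, hLF'⟩ := C.exists_hasFDerivAt_reduceChart hs hx
  have hev : (φ ∘ C.reduceD) ∘ C.restrictD =ᶠ[𝓝 α]
      ((φ ∘ (extChartAt (cotangentModel r) a₀).symm) ∘ C.reduceChart α.1 a₀.1) ∘
        extChartAt (cotangentModel n) α := by
    filter_upwards [C.eventually_reduceChart hs] with γ hγ
    have hmem : C.reduceD (C.restrictD γ) ∈ (extChartAt (cotangentModel r) a₀).source := by
      rw [extChartAt_source]
      exact mem_chartAt_cotangent_source.2 hγ.1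
    simp only [Function.comp_apply]
    rw [← hγ.2, (extChartAt (cotangentModel r) a₀).left_inv hmem]
  have hval := C.chartDeriv_hamiltonianVector_constrained (a₀ := a₀) hs
  set z := extChartAt (cotangentModel r) a₀ (C.reduceD (C.restrictD α)) with hzdef
  rw [hz] at hφ
  have h := mfderiv_eq_of_eventuallyEq_comp_extChartAt hα' hev (hφ.comp _ hLF)
    (hamiltonianVector (C.constrainedHamiltonian ∘ C.restrictD) α)
  rw [hval] at h
  have hW : LF (C.hamVecChart α a₀.1 z) = (C.cometricChart a₀.1 z.1 z.2,
      (LF (C.hamVecChart α a₀.1 z)).2) := by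
    refine Prod.ext ?_ rfl
    rw [hamVecChart, hLF', hx]
    exact C.fderiv_projChart_horChart hα hs _
  refine ⟨(LF (C.hamVecChart α a₀.1 z)).2, ?_, fun v => ?_⟩
  · rw [← hW]
    exact h
  · rw [hamVecChart, hLF', hx, curvature_apply, map_sub]
    simp only [add_apply, sub_apply, neg_apply, ContinuousLinearMap.comp_apply,
      ContinuousLinearMap.flip_apply]
    rw [C.fderiv_projChart_horChart hα hs]
    ring

/-- The nonholonomic dynamics of functions of the reduced variables. -/
theorem nhBracket_eq [T2Space S] {β : C.DualD} {a₀ : CotangentBundle r S}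
    (hs : C.proj β.pt ∈ (chartAt (EuclideanSpace ℝ (Fin r)) a₀.1).source)
    {φ : CotangentBundle r S → ℝ}
    {L : EuclideanSpace ℝ (Fin r) × (EuclideanSpace ℝ (Fin r) →L[ℝ] ℝ) →L[ℝ] ℝ}
    (hφ : HasFDerivAt (φ ∘ (extChartAt (cotangentModel r) a₀).symm) L
      (extChartAt (cotangentModel r) a₀ (C.reduceD β))) :
    C.nhBracket (φ ∘ C.reduceD) C.constrainedHamiltonian β =
      L (C.reducedChart a₀.1 (extChartAt (cotangentModel r) a₀ (C.reduceD β))) := by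
  have hβ := C.restrictD_extendD β
  obtain ⟨P, hP, hP'⟩ := C.poissonBracket_reduce (α := C.extendD β) (a₀ := a₀) hs (φ := φ) (L := L)
    (by rw [hβ]; exact hφ)
  rw [hβ] at hP hP'
  refine hP.trans (congrArg L (Prod.ext rfl (ContinuousLinearMap.ext fun v => ?_)))
  rw [hP']
  refine congrArg₂ (fun s t : ℝ => s - t) rfl ?_
  set w := C.cometricChart a₀.1 (extChartAt (cotangentModel r) a₀ (C.reduceD β)).1
    (extChartAt (cotangentModel r) a₀ (C.reduceD β)).2
  have h1 : ∀ e : TangentSpace (𝓡 n) β.pt, (C.extendD β).cov e =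
      (extChartAt (cotangentModel n) (C.extendD β) (C.extendD β)).2 e := by
    intro e
    refine (cov_eq_extChartAt_cotangent_snd (a₀ := C.extendD β) (a := C.extendD β)
      (mem_chart_source (EuclideanSpace ℝ (Fin n)) β.pt) e).trans ?_
    exact congrArg _ (chartDeriv_self (I := 𝓡 n) β.pt e)
  -- On the image of `P^*` the covector only sees `T_q π ∘ P` of its argument, so the curvature
  -- becomes the gyroscopic tensor.
  refine (h1 _).symm.trans ((C.cov_extendD β _).trans ?_)
  refine (cov_eq_extChartAt_cotangent_snd (a₀ := a₀) (a := C.reduceD β) hs _).trans ?_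
  refine congrArg (extChartAt (cotangentModel r) a₀ (C.reduceD β)).2 ?_
  refine (C.gyroChart_proj hs v w).symm.trans ?_
  change _ = C.gyroChart a₀.1 ((extChartAt (𝓡 r) a₀.1).symm
    (extChartAt (cotangentModel r) a₀ (C.reduceD β)).1) v w
  rw [extChartAt_cotangent_fst]
  have hl : (extChartAt (𝓡 r) a₀.1).symm (extChartAt (𝓡 r) a₀.1 (C.proj β.pt)) = C.proj β.pt :=
    (extChartAt (𝓡 r) a₀.1).left_inv (by rwa [extChartAt_source])
  exact (congrArg (fun s => C.gyroChart a₀.1 s v w) hl).symm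

/-- The reduced vector field in cotangent coordinates. -/
theorem chartDeriv_reducedField [T2Space S] {a₀ a : CotangentBundle r S}
    (ha : a.1 ∈ (chartAt (EuclideanSpace ℝ (Fin r)) a₀.1).source) :
    chartDeriv (cotangentModel r) a₀ a (C.reducedField a) =
      C.reducedChart a₀.1 (extChartAt (cotangentModel r) a₀ a) := by
  have ha' := mem_chartAt_cotangent_source.2 ha
  have hdiff : ∀ φ : CotangentBundle r S → ℝ, ContMDiffAt (cotangentModel r) 𝓘(ℝ, ℝ) ∞ φ a →
      MDifferentiableAt (cotangentModel r) 𝓘(ℝ, ℝ) φ a := fun φ hφ =>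
    hφ.mdifferentiableAt (by simp)
  have key : ∀ β : C.DualD, C.reduceD β = a → ∀ φ : CotangentBundle r S → ℝ,
      ContMDiffAt (cotangentModel r) 𝓘(ℝ, ℝ) ∞ φ a →
      C.nhBracket (φ ∘ C.reduceD) C.constrainedHamiltonian β =
        fderiv ℝ (φ ∘ (extChartAt (cotangentModel r) a₀).symm)
          (extChartAt (cotangentModel r) a₀ a)
          (C.reducedChart a₀.1 (extChartAt (cotangentModel r) a₀ a)) := by
    rintro β rfl φ hφ
    exact C.nhBracket_eq ha (differentiableAt_comp_extChartAt_symm ha' (hdiff φ hφ)).hasFDerivAt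
  obtain ⟨w, hw⟩ := chartDeriv_surjective (I := cotangentModel r) ha'
    (C.reducedChart a₀.1 (extChartAt (cotangentModel r) a₀ a))
  have hspec := Classical.epsilon_spec (p := fun w : TangentSpace (cotangentModel r) a =>
    ∀ β : C.DualD, C.reduceD β = a → ∀ φ : CotangentBundle r S → ℝ,
      ContMDiffAt (cotangentModel r) 𝓘(ℝ, ℝ) ∞ φ a →
      (show ℝ from mfderiv (cotangentModel r) 𝓘(ℝ, ℝ) φ a w) =
        C.nhBracket (φ ∘ C.reduceD) C.constrainedHamiltonian β) ⟨w, fun β hβ φ hφ => by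
      rw [key β hβ φ hφ, ← hw]
      exact mfderiv_eq_fderiv_chart ha' (hdiff φ hφ) w⟩
  obtain ⟨β, hβ⟩ := C.surjective_reduceD a
  -- Functions that are linear in the chart suffice to determine the chosen vector.
  refine (SeparatingDual.eq_iff_forall_dual_eq (R := ℝ)).2 fun l => ?_
  have hφ : ContMDiffAt (cotangentModel r) 𝓘(ℝ, ℝ) ∞ (l ∘ extChartAt (cotangentModel r) a₀) a :=
    (l.contDiff.contMDiff.contMDiffAt).comp a (contMDiffAt_extChartAt' ha')
  have hl : ∀ z, HasFDerivAt l l z := fun z => by apply ContinuousLinearMap.hasFDerivAt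
  have hev : (l ∘ extChartAt (cotangentModel r) a₀) ∘ (extChartAt (cotangentModel r) a₀).symm
      =ᶠ[𝓝 (extChartAt (cotangentModel r) a₀ a)] l := by
    filter_upwards [extChartAt_target_mem_nhds' ((extChartAt (cotangentModel r) a₀).map_source
      (x := a) (by rwa [extChartAt_source]))] with z hz
    simp only [Function.comp_apply]
    rw [(extChartAt (cotangentModel r) a₀).right_inv hz]
  have h1 := mfderiv_eq_of_eventuallyEq_comp_extChartAt (I := cotangentModel r) ha'
    (Filter.EventuallyEq.refl (𝓝 a) (l ∘ extChartAt (cotangentModel r) a₀)) (hl _)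
    (C.reducedField a)
  refine h1.symm.trans ((hspec β hβ _ hφ).trans ?_)
  subst hβ
  exact C.nhBracket_eq ha ((hl _).congr_of_eventuallyEq hev)

end ChaplyginSystem

/-! ### The Lie derivative of a density in a chart. -/

section LieDerivative

variable {E H M : Type*} [NormedAddCommGroup E] [NormedSpace ℝ E]
  [TopologicalSpace H]
  {I : ModelWithCorners ℝ E H} [I.Boundaryless] [TopologicalSpace M] [ChartedSpace H M]
  [IsManifold I 1 M]

omit [I.Boundaryless] [IsManifold I 1 M] in
theorem chartField_extChartAt {x₀ x : M} (hx : x ∈ (chartAt H x₀).source)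
    (X : ∀ x : M, TangentSpace I x) :
    chartField I x₀ X (extChartAt I x₀ x) = chartDeriv I x₀ x (X x) := by
  rw [chartField, (extChartAt I x₀).left_inv (by rwa [extChartAt_source])]

/-- The Lie derivative of a top-degree form which is a function times a constant form in a chart. -/
theorem lieDerivForm_eq_of_chart {ι : Type*} [Fintype ι] [DecidableEq ι] [IsManifold I 2 M]
    (b : Module.Basis ι ℝ E) (ν : E [⋀^ι]→ₗ[ℝ] ℝ) (hν : Continuous ν) {x₀ : M} {f : M → ℝ}
    {fh : E → ℝ} (hf : f =ᶠ[𝓝 x₀] fh ∘ extChartAt I x₀)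
    (hfh : DifferentiableAt ℝ fh (extChartAt I x₀ x₀))
    {μ : ∀ x : M, (ι → TangentSpace I x) → ℝ}
    (hμ : ∀ x ∈ (chartAt H x₀).source, ∀ v : ι → TangentSpace I x,
      μ x v = f x * ν fun i => chartDeriv I x₀ x (v i))
    {X : ∀ x : M, TangentSpace I x}
    {Y : ι → ∀ x : M, TangentSpace I x}
    (hY : ∀ i, DifferentiableAt ℝ (chartField I x₀ (Y i)) (extChartAt I x₀ x₀)) :
    lieDerivForm I X μ Y x₀ =
      (fderiv ℝ fh (extChartAt I x₀ x₀) (chartDeriv I x₀ x₀ (X x₀)) +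
        f x₀ * LinearMap.trace ℝ E
          (fderiv ℝ (chartField I x₀ X) (extChartAt I x₀ x₀)).toLinearMap) *
      ν fun i => chartDeriv I x₀ x₀ (Y i x₀) := by
  have hx₀ := mem_chart_source H x₀
  set z := extChartAt I x₀ x₀ with hz
  let νc : ContinuousMultilinearMap ℝ (fun _ : ι => E) ℝ := ⟨ν.toMultilinearMap, hν⟩
  have hYv : ∀ i, chartField I x₀ (Y i) z = chartDeriv I x₀ x₀ (Y i x₀) := fun i =>
    chartField_extChartAt hx₀ _
  have hXv : chartField I x₀ X z = chartDeriv I x₀ x₀ (X x₀) := chartField_extChartAt hx₀ _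
  have hev : (fun x => μ x fun i => Y i x) =ᶠ[𝓝 x₀]
      (fun z => fh z * νc fun i => chartField I x₀ (Y i) z) ∘ extChartAt I x₀ := by
    filter_upwards [hf, (chartAt H x₀).open_source.mem_nhds hx₀] with x hx hxs
    rw [hμ x hxs, hx]
    refine congrArg (fun v => fh (extChartAt I x₀ x) * ν v) (funext fun i => ?_)
    exact (chartField_extChartAt hxs (Y i)).symm
  have hνd := (νc.hasFDerivAt (fun i => chartField I x₀ (Y i) z)).comp z
    (hasFDerivAt_pi.2 fun i => (hY i).hasFDerivAt)
  have h1 := mfderiv_eq_of_eventuallyEq_comp_extChartAt hx₀ hev (hfh.hasFDerivAt.mul hνd) (X x₀)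
  have hfz : f x₀ = fh z := hf.eq_of_nhds
  -- The derivatives of `Y i` along `X` cancel those from differentiating `μ(Y)`; the derivatives of
  -- `X` remain and sum to its divergence.
  have h2 : ∀ i, μ x₀ (Function.update (fun j => Y j x₀) i (VectorField.mlieBracket I X (Y i) x₀)) =
      fh z * ν (Function.update (fun j => chartField I x₀ (Y j) z) i
        (fderiv ℝ (chartField I x₀ (Y i)) z (chartDeriv I x₀ x₀ (X x₀)))) -
      fh z * ν (Function.update (fun j => chartField I x₀ (Y j) z) i
        (fderiv ℝ (chartField I x₀ X) z (chartField I x₀ (Y i) z))) := by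
    intro i
    rw [hμ x₀ hx₀, hfz, ← mul_sub, ← AlternatingMap.map_update_sub]
    refine congrArg (fun v => fh z * ν v) (funext fun j => ?_)
    by_cases hij : j = i
    · subst hij
      rw [Function.update_self, Function.update_self, chartDeriv_mlieBracket,
        VectorField.lieBracket, ← hz, hXv]
    · rw [Function.update_of_ne hij, Function.update_of_ne hij, hYv]
  rw [lieDerivForm]
  refine (congrArg₂ (fun s t : ℝ => s - t) h1 (Finset.sum_congr rfl fun i _ => h2 i)).trans ?_
  rw [Finset.sum_sub_distrib, ← Finset.mul_sum, ← Finset.mul_sum]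
  have htr := AlternatingMap.sum_update_apply_eq_trace b ν
    (fderiv ℝ (chartField I x₀ X) z).toLinearMap (fun j => chartField I x₀ (Y j) z)
  have h3 : (νc.linearDeriv fun i => chartField I x₀ (Y i) z)
      (fun i => fderiv ℝ (chartField I x₀ (Y i)) z (chartDeriv I x₀ x₀ (X x₀))) =
      ∑ i, ν (Function.update (fun j => chartField I x₀ (Y j) z) i
        (fderiv ℝ (chartField I x₀ (Y i)) z (chartDeriv I x₀ x₀ (X x₀)))) :=
    ContinuousMultilinearMap.linearDeriv_apply _ _ _
  have h4 : (ν fun i => chartDeriv I x₀ x₀ (Y i x₀)) = ν fun i => chartField I x₀ (Y i) z :=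
    congrArg ν (funext fun i => (hYv i).symm)
  rw [h4, hfz]
  change fh z * (νc.linearDeriv fun i => chartField I x₀ (Y i) z)
      (fun i => fderiv ℝ (chartField I x₀ (Y i)) z (chartDeriv I x₀ x₀ (X x₀))) +
    ν (fun i => chartField I x₀ (Y i) z) * fderiv ℝ fh z (chartDeriv I x₀ x₀ (X x₀)) - _ = _
  rw [h3]
  have h5 : ∑ i, ν (Function.update (fun j => chartField I x₀ (Y j) z) i
        (fderiv ℝ (chartField I x₀ X) z (chartField I x₀ (Y i) z))) = _ := htr
  rw [h5]
  ring

end LieDerivative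

/-! ### Traces and the divergence of the reduced equations. -/

section Trace

theorem LinearMap.trace_prod {V W : Type*} [AddCommGroup V] [Module ℝ V] [FiniteDimensional ℝ V]
    [AddCommGroup W] [Module ℝ W] [FiniteDimensional ℝ W] (L : V × W →ₗ[ℝ] V × W) :
    LinearMap.trace ℝ (V × W) L =
      LinearMap.trace ℝ V (LinearMap.fst ℝ V W ∘ₗ L ∘ₗ LinearMap.inl ℝ V W) +
      LinearMap.trace ℝ W (LinearMap.snd ℝ V W ∘ₗ L ∘ₗ LinearMap.inr ℝ V W) := by
  have h : L = (L ∘ₗ LinearMap.inl ℝ V W) ∘ₗ LinearMap.fst ℝ V W +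
      (L ∘ₗ LinearMap.inr ℝ V W) ∘ₗ LinearMap.snd ℝ V W := by
    refine LinearMap.ext fun x => ?_
    simp [← map_add]
  conv_lhs => rw [h]
  rw [map_add, LinearMap.trace_comp_comm' (LinearMap.fst ℝ V W),
    LinearMap.trace_comp_comm' (LinearMap.snd ℝ V W)]

variable {E : Type*} [NormedAddCommGroup E] [NormedSpace ℝ E] [FiniteDimensional ℝ E]

theorem trace_precomp (A : E →ₗ[ℝ] E) (N : (E →L[ℝ] ℝ) →ₗ[ℝ] (E →L[ℝ] ℝ))
    (hN : ∀ p v, N p v = p (A v)) : LinearMap.trace ℝ _ N = LinearMap.trace ℝ E A := by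
  let e : (E →ₗ[ℝ] ℝ) ≃ₗ[ℝ] (E →L[ℝ] ℝ) := LinearMap.toContinuousLinearMap
  have h : N = e.conj (Module.Dual.transpose (R := ℝ) A) := by
    refine LinearMap.ext fun p => ContinuousLinearMap.ext fun v => ?_
    rw [hN]
    rfl
  rw [h, LinearMap.trace_conj', LinearMap.trace_transpose']

/-- The composition of a symmetric and an antisymmetric form has trace zero. -/
theorem trace_comp_eq_zero (K : (E →L[ℝ] ℝ) →ₗ[ℝ] E) (N : E →ₗ[ℝ] (E →L[ℝ] ℝ))
    (hK : ∀ p p' : E →L[ℝ] ℝ, p (K p') = p' (K p)) (hN : ∀ u v, N u v = -N v u) :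
    LinearMap.trace ℝ _ (N ∘ₗ K) = 0 := by
  let b := Module.finBasis ℝ E
  let c : Fin (Module.finrank ℝ E) → (E →L[ℝ] ℝ) := fun i =>
    LinearMap.toContinuousLinearMap (b.coord i)
  have hc : ∀ i u, b.repr u i = c i u := fun i u => rfl
  rw [LinearMap.trace_comp_comm', LinearMap.trace_eq_matrix_trace ℝ b, Matrix.trace]
  simp only [Matrix.diag_apply, LinearMap.toMatrix_apply, hc, LinearMap.comp_apply]
  have h1 : ∀ i, c i (K (N (b i))) = ∑ j, c j (K (c i)) * N (b i) (b j) := by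
    intro i
    rw [hK]
    conv_lhs => rw [← b.sum_repr (K (c i))]
    rw [map_sum]
    refine Finset.sum_congr rfl fun j _ => ?_
    rw [map_smul, smul_eq_mul, hc]
  simp_rw [h1]
  have h2 : ∑ i, ∑ j, c j (K (c i)) * N (b i) (b j) =
      -∑ i, ∑ j, c j (K (c i)) * N (b i) (b j) := by
    conv_lhs => rw [Finset.sum_comm]
    rw [← Finset.sum_neg_distrib]
    refine Finset.sum_congr rfl fun i _ => ?_
    rw [← Finset.sum_neg_distrib]
    refine Finset.sum_congr rfl fun j _ => ?_
    rw [hK, hN]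
    ring
  linarith

end Trace

theorem LinearMap.trace_neg_sub_add {W : Type*} [AddCommGroup W] [Module ℝ W] (A B D : W →ₗ[ℝ] W) :
    LinearMap.trace ℝ W (-A - (B + D)) =
      -LinearMap.trace ℝ W A - (LinearMap.trace ℝ W B + LinearMap.trace ℝ W D) := by
  rw [map_sub, map_add, map_neg]

section ReducedEquations

variable {E : Type*} [NormedAddCommGroup E] [NormedSpace ℝ E] [FiniteDimensional ℝ E]
  {K : E → (E →L[ℝ] ℝ) →L[ℝ] E} {U : E → ℝ} {T : E → E →L[ℝ] E →L[ℝ] E}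
  {f : E × (E →L[ℝ] ℝ) → E × (E →L[ℝ] ℝ)} {s : Set E}

theorem contDiffOn_of_reduced_equations (hs : IsOpen s) (hK : ContDiffOn ℝ ∞ K s)
    (hU : ContDiffOn ℝ ∞ U s) (hT : ContDiffOn ℝ ∞ T s) (hf₁ : ∀ z, (f z).1 = K z.1 z.2)
    (hf₂ : ∀ z v, (f z).2 v = -((1 / 2 : ℝ) * z.2 (fderiv ℝ K z.1 v z.2) + fderiv ℝ U z.1 v) -
      z.2 (T z.1 v (K z.1 z.2))) :
    ContDiffOn ℝ ∞ f (s ×ˢ Set.univ) := by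
  have hfst : Set.MapsTo Prod.fst (s ×ˢ (Set.univ : Set (E →L[ℝ] ℝ))) s := fun z hz => hz.1
  have hK' := hK.comp contDiffOn_fst hfst
  have hDK := (hK.fderiv_of_isOpen hs (m := ∞) (by simp)).comp contDiffOn_fst hfst
  have hDU := (hU.fderiv_of_isOpen hs (m := ∞) (by simp)).comp contDiffOn_fst hfst
  have hT' := hT.comp contDiffOn_fst hfst
  have hp : ContDiffOn ℝ ∞ (Prod.snd : E × (E →L[ℝ] ℝ) → _) (s ×ˢ Set.univ) := contDiffOn_snd
  have hKp : ContDiffOn ℝ ∞ (fun z : E × (E →L[ℝ] ℝ) => K z.1 z.2) (s ×ˢ Set.univ) :=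
    hK'.clm_apply hp
  have h1 : ContDiffOn ℝ ∞ (fun z => (f z).1) (s ×ˢ Set.univ) := hKp.congr fun z _ => hf₁ z
  have h2 : ContDiffOn ℝ ∞ (fun z => (f z).2) (s ×ˢ Set.univ) := by
    refine contDiffOn_clm_apply.2 fun v => ?_
    have h3 : ContDiffOn ℝ ∞ (fun z : E × (E →L[ℝ] ℝ) => fderiv ℝ K z.1 v z.2) (s ×ˢ Set.univ) :=
      (hDK.clm_apply (contDiffOn_const (c := v))).clm_apply hp
    have h4 : ContDiffOn ℝ ∞ (fun z : E × (E →L[ℝ] ℝ) => T z.1 v (K z.1 z.2)) (s ×ˢ Set.univ) :=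
      (hT'.clm_apply (contDiffOn_const (c := v))).clm_apply hKp
    have h5 : ContDiffOn ℝ ∞ (fun z : E × (E →L[ℝ] ℝ) => z.2 (fderiv ℝ K z.1 v z.2))
      (s ×ˢ Set.univ) := ContDiffOn.clm_apply hp h3
    have h6 : ContDiffOn ℝ ∞ (fun z : E × (E →L[ℝ] ℝ) => z.2 (T z.1 v (K z.1 z.2)))
      (s ×ˢ Set.univ) := ContDiffOn.clm_apply hp h4
    exact (((contDiffOn_const.mul h5).add (hDU.clm_apply contDiffOn_const)).neg.sub h6).congr
      fun z _ => hf₂ z v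
  exact h1.prodMk h2

/-- The divergence of the reduced equations of motion, with inverse kinetic energy tensor `K`,
potential `U` and gyroscopic tensor `T`. -/
theorem trace_fderiv_of_reduced_equations (hs : IsOpen s) (hK : ContDiffOn ℝ ∞ K s)
    (hU : ContDiffOn ℝ ∞ U s) (hT : ContDiffOn ℝ ∞ T s) (hf₁ : ∀ z, (f z).1 = K z.1 z.2)
    (hf₂ : ∀ z v, (f z).2 v = -((1 / 2 : ℝ) * z.2 (fderiv ℝ K z.1 v z.2) + fderiv ℝ U z.1 v) -
      z.2 (T z.1 v (K z.1 z.2))) (hsymm : ∀ x ∈ s, ∀ p p' : E →L[ℝ] ℝ, p (K x p') = p' (K x p))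
    (hskew : ∀ x u v, T x u v = -T x v u) {x : E} (hx : x ∈ s) (p : E →L[ℝ] ℝ) :
    LinearMap.trace ℝ _ (fderiv ℝ f (x, p)).toLinearMap =
      -LinearMap.trace ℝ E ((T x).flip (K x p)).toLinearMap := by
  have hX : HasFDerivAt f (fderiv ℝ f (x, p)) (x, p) :=
    (((contDiffOn_of_reduced_equations hs hK hU hT hf₁ hf₂).contDiffAt
      ((hs.prod isOpen_univ).mem_nhds ⟨hx, trivial⟩)).differentiableAt (by simp)).hasFDerivAt
  have hK' : DifferentiableAt ℝ K x :=
    (hK.contDiffAt (hs.mem_nhds hx)).differentiableAt (by simp)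
  set L := fderiv ℝ f (x, p)
  set DK := fderiv ℝ K x with hDK
  -- Symmetry of `K` on the open set `s` passes to its derivative; it turns the factor `½` into `1`
  -- in the momentum block.
  have hDsymm : ∀ u (p p' : E →L[ℝ] ℝ), p (DK u p') = p' (DK u p) := by
    intro u p p'
    have h1 : ∀ p p' : E →L[ℝ] ℝ, HasFDerivAt (fun x => p (K x p')) (p.comp (DK.flip p')) x :=
      fun p p' => p.hasFDerivAt.comp x
        ((hK'.hasFDerivAt.clm_apply (hasFDerivAt_const p' x)).congr_fderiv
        (ContinuousLinearMap.ext fun u => by simp [DK]))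
    have h2 := (h1 p p').congr_of_eventuallyEq (f₁ := fun x => p' (K x p)) (by
        filter_upwards [hs.mem_nhds hx] with y hy
        exact hsymm y hy p' p)
    exact congrArg (fun L : E →L[ℝ] ℝ => L u) (h2.unique (h1 p' p))
  have hfst : ∀ u, (L (u, 0)).1 = DK u p := by
    intro u
    have h0 : HasFDerivAt (fun x' => f (x', p)) (L.comp (ContinuousLinearMap.inl ℝ _ _)) x :=
      HasFDerivAt.comp (g := f) (f := fun x' => (x', p)) x hX (hasFDerivAt_prodMk_left x p)
    have h2 : HasFDerivAt (fun x => (f (x, p)).1) (DK.flip p) x :=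
      ((hK'.hasFDerivAt.clm_apply (hasFDerivAt_const p x)).congr_fderiv
        (ContinuousLinearMap.ext fun u => by simp [DK])).congr_of_eventuallyEq
        (Filter.Eventually.of_forall fun x => hf₁ (x, p))
    exact congrArg (fun L : E →L[ℝ] E => L u) (h0.fst.unique h2)
  have hsnd : ∀ w v, (L (0, w)).2 v = -w (DK v p) - (w (T x v (K x p)) + p (T x v (K x w))) := by
    intro w v
    have h0 : HasFDerivAt (fun p' => f (x, p')) (L.comp (ContinuousLinearMap.inr ℝ _ _)) p :=
      HasFDerivAt.comp (g := f) (f := fun p' => (x, p')) p hX (hasFDerivAt_prodMk_right x p)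
    have h1 : HasFDerivAt (fun p' => (f (x, p')).2 v) _ p :=
      h0.snd.clm_apply (hasFDerivAt_const v p)
    have hid := hasFDerivAt_id (𝕜 := ℝ) p
    have hc : ∀ A : (E →L[ℝ] ℝ) →L[ℝ] E, HasFDerivAt (fun p => A p) A p :=
      fun A => by apply ContinuousLinearMap.hasFDerivAt
    have h2 := ((((hid.clm_apply (hc (DK v))).const_mul (1 / 2 : ℝ)).add_const
      (fderiv ℝ U x v)).neg.sub (hid.clm_apply (hc ((T x v).comp (K x))))).congr_of_eventuallyEq
        (f₁ := fun p' => (f (x, p')).2 v) (Filter.Eventually.of_forall fun p' => hf₂ (x, p') v)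
    have h3 := congrArg (fun L : (E →L[ℝ] ℝ) →L[ℝ] ℝ => L w) (h1.unique h2)
    refine Eq.trans ?_ (h3.trans ?_)
    · change (L (0, w)).2 v = (f (x, p)).2 0 + (L (0, w)).2 v
      rw [map_zero, zero_add]
    · change -((1 / 2 : ℝ) * (p (DK v w) + w (DK v p))) -
        (p (T x v (K x w)) + w (T x v (K x p))) = _
      rw [hDsymm v p w]
      ring
  -- Only the diagonal blocks matter for the trace. `N1` is the transpose of the base block and
  -- cancels it; `N2` is the transpose of `T(·, K p)` and gives the answer; `N3 ∘ K` composes a skew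
  -- form with a symmetric one and has trace zero.
  let N1 : (E →L[ℝ] ℝ) →ₗ[ℝ] (E →L[ℝ] ℝ) :=
    ((ContinuousLinearMap.compL ℝ _ _ ℝ).flip (DK.flip p)).toLinearMap
  let N2 : (E →L[ℝ] ℝ) →ₗ[ℝ] (E →L[ℝ] ℝ) :=
    ((ContinuousLinearMap.compL ℝ _ _ ℝ).flip ((T x).flip (K x p))).toLinearMap
  let N3 : E →ₗ[ℝ] (E →L[ℝ] ℝ) :=
    ((ContinuousLinearMap.compL ℝ _ _ ℝ p).comp (T x).flip).toLinearMap
  have ht1 : LinearMap.fst ℝ _ _ ∘ₗ L.toLinearMap ∘ₗ LinearMap.inl ℝ E (E →L[ℝ] ℝ) =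
      (DK.flip p).toLinearMap := LinearMap.ext hfst
  have ht2 : LinearMap.snd ℝ _ _ ∘ₗ L.toLinearMap ∘ₗ LinearMap.inr ℝ E (E →L[ℝ] ℝ) =
      -N1 - (N2 + N3 ∘ₗ (K x).toLinearMap) :=
    LinearMap.ext fun w => ContinuousLinearMap.ext fun v => hsnd w v
  rw [LinearMap.trace_prod, ht1, ht2]
  refine (congrArg (_ + ·) (LinearMap.trace_neg_sub_add N1 N2 (N3 ∘ₗ (K x).toLinearMap))).trans ?_
  rw [trace_precomp (DK.flip p).toLinearMap N1 fun _ _ => rfl,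
    trace_precomp ((T x).flip (K x p)).toLinearMap N2 fun _ _ => rfl,
    trace_comp_eq_zero (K x).toLinearMap N3 (hsymm x hx) fun u v => ?_]
  · ring
  · change p (T x v u) = -p (T x u v)
    rw [← map_neg, hskew x v u]

end ReducedEquations

namespace ChaplyginSystem

variable {n k r : ℕ} {Q G S : Type*}
  [TopologicalSpace Q] [ChartedSpace (EuclideanSpace ℝ (Fin n)) Q] [IsManifold (𝓡 n) ∞ Q]
  [TopologicalSpace G] [ChartedSpace (EuclideanSpace ℝ (Fin k)) G] [Group G]
  [LieGroup (𝓡 k) ∞ G]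
  [TopologicalSpace S] [ChartedSpace (EuclideanSpace ℝ (Fin r)) S] [IsManifold (𝓡 r) ∞ S]
  [MulAction G Q] [ContMDiffSMul (𝓡 k) (𝓡 n) ∞ G Q] [ProperSMul G Q]
  (C : ChaplyginSystem n k r Q G S)

theorem gyroCoord_swap (s₀ : S) (x y z : EuclideanSpace ℝ (Fin r)) :
    C.gyroCoord s₀ x y z = -C.gyroCoord s₀ x z y := by
  rw [gyroCoord, gyroChart_apply, gyroChart_apply, C.gyroTensor_swap]
  exact map_neg (chartDeriv (𝓡 r) s₀ _) _

/-- The divergence of the reduced vector field. -/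
theorem trace_fderiv_reducedChart [T2Space S] {s₀ : S}
    {z : EuclideanSpace ℝ (Fin r) × (EuclideanSpace ℝ (Fin r) →L[ℝ] ℝ)}
    (hz : z.1 ∈ (extChartAt (𝓡 r) s₀).target) :
    LinearMap.trace ℝ _ (fderiv ℝ (C.reducedChart s₀) z).toLinearMap =
      -LinearMap.trace ℝ (EuclideanSpace ℝ (Fin r))
        ((C.gyroCoord s₀ z.1).flip (C.cometricChart s₀ z.1 z.2)).toLinearMap :=
  trace_fderiv_of_reduced_equations (f := C.reducedChart s₀)
    (isOpen_extChartAt_target (I := 𝓡 r) s₀)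
    (C.contDiffOn_cometricChart s₀) (C.contDiffOn_potentialChart s₀) (C.contDiffOn_gyroCoord s₀)
    (fun _ => rfl) (fun _ _ => rfl) (fun _ hx => C.cometricChart_symm hx) (C.gyroCoord_swap s₀)
    hz z.2

end ChaplyginSystem

section Exp

theorem hasFDerivAt_exp_comp_fst {E F : Type*} [NormedAddCommGroup E] [NormedSpace ℝ E]
    [NormedAddCommGroup F] [NormedSpace ℝ F] {g : E → ℝ} {D : E →L[ℝ] ℝ} {z : E × F}
    (hg : HasFDerivAt g D z.1) :
    HasFDerivAt (fun z : E × F => Real.exp (g z.1))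
      (Real.exp (g z.1) • D.comp (ContinuousLinearMap.fst ℝ E F)) z :=
  (hg.comp z hasFDerivAt_fst).exp

end Exp

/-! ### Continuity and nonvanishing of the standard volume form. -/

section StdForm

theorem continuous_wedgePower_stdForm (m : ℕ) : Continuous (wedgePower m (stdForm m)) := by
  change Continuous fun v => wedgePower m (stdForm m) v
  simp_rw [wedgePower_apply, stdForm_apply]
  refine continuous_const.mul (continuous_finsetSum _ fun σ _ => continuous_const.mul
    (continuous_finsetProd _ fun i _ => ?_))
  have h1 : ∀ i : Fin m × Fin 2, Continuous fun v : Fin m × Fin 2 → EuclideanSpace ℝ (Fin m) ×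
      (EuclideanSpace ℝ (Fin m) →L[ℝ] ℝ) => (v i).1 := fun i =>
    continuous_fst.comp (continuous_apply i)
  have h2 : ∀ i : Fin m × Fin 2, Continuous fun v : Fin m × Fin 2 → EuclideanSpace ℝ (Fin m) ×
      (EuclideanSpace ℝ (Fin m) →L[ℝ] ℝ) => (v i).2 := fun i =>
    continuous_snd.comp (continuous_apply i)
  exact ((h2 _).clm_apply (h1 _)).sub ((h2 _).clm_apply (h1 _))

/-- The standard symplectic frame of `V × V*`. -/
def stdFrame (m : ℕ) (i : Fin m × Fin 2) :
    EuclideanSpace ℝ (Fin m) × (EuclideanSpace ℝ (Fin m) →L[ℝ] ℝ) :=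
  if i.2 = 0 then (EuclideanSpace.single i.1 1, 0) else (0, EuclideanSpace.proj i.1)

theorem wedgePower_stdFrame_pos (m : ℕ) : 0 < wedgePower m (stdForm m) (stdFrame m) := by
  refine wedgePower_pos (fun i j => ?_) (fun i j => ?_) (fun i j => ?_) (fun i j => ?_)
  · simp [stdForm_apply, stdFrame, eq_comm]
  · by_cases h : i = j <;> simp [stdForm_apply, stdFrame, h]
  · simp [stdForm_apply, stdFrame]
  · simp [stdForm_apply, stdFrame]

/-- A basis of `V × V*` indexed like the arguments of its volume form. -/
def cotangentBasis (m : ℕ) : Module.Basis (Fin m × Fin 2) ℝ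
    (EuclideanSpace ℝ (Fin m) × (EuclideanSpace ℝ (Fin m) →L[ℝ] ℝ)) :=
  (Module.finBasis ℝ _).reindex (Fintype.equivOfCardEq (by
    have h : Module.finrank ℝ (EuclideanSpace ℝ (Fin m) →L[ℝ] ℝ) = m := by
      rw [← (LinearMap.toContinuousLinearMap (𝕜 := ℝ) (E := EuclideanSpace ℝ (Fin m))
        (F' := ℝ)).finrank_eq, Subspace.dual_finrank_eq, finrank_euclideanSpace_fin]
    rw [Fintype.card_fin, Module.finrank_prod, h, finrank_euclideanSpace_fin, Fintype.card_prod,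
      Fintype.card_fin, Fintype.card_fin]
    ring))

end StdForm

/-! ### Criterion for an invariant basic measure. -/

namespace ChaplyginSystem

variable {n k r : ℕ} {Q G S : Type*}
  [TopologicalSpace Q] [ChartedSpace (EuclideanSpace ℝ (Fin n)) Q] [IsManifold (𝓡 n) ∞ Q]
  [TopologicalSpace G] [ChartedSpace (EuclideanSpace ℝ (Fin k)) G] [Group G]
  [LieGroup (𝓡 k) ∞ G]
  [TopologicalSpace S] [ChartedSpace (EuclideanSpace ℝ (Fin r)) S] [IsManifold (𝓡 r) ∞ S]
  [MulAction G Q] [ContMDiffSMul (𝓡 k) (𝓡 n) ∞ G Q] [ProperSMul G Q]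
  (C : ChaplyginSystem n k r Q G S)

theorem gyroChart_self (s : S) (y z : TangentSpace (𝓡 r) s) :
    C.gyroChart s s y z = C.gyroTensor s y z := by
  have h : ∀ y : TangentSpace (𝓡 r) s, chartConstField s y s = y := fun y => by
    have := chartConstField_chartDeriv (mem_chart_source (EuclideanSpace ℝ (Fin r)) s) y
    rwa [chartDeriv_self] at this
  have h2 := C.gyroChart_apply s s y z
  rw [chartDeriv_self] at h2
  exact h2.trans (congrArg₂ (fun y z => C.gyroTensor s y z) (h y) (h z))

theorem gyroCoord_extChartAt_self (s : S) :
    C.gyroCoord s (extChartAt (𝓡 r) s s) = C.gyroChart s s := by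
  rw [gyroCoord, (extChartAt (𝓡 r) s).left_inv (mem_extChartAt_source s)]

/-- The velocity of the reduced motion through a point of `T*S`. -/
def reducedVelocity (a : CotangentBundle r S) : TangentSpace (𝓡 r) a.1 :=
  C.cometricChart a.1 (extChartAt (cotangentModel r) a a).1 (extChartAt (cotangentModel r) a a).2

/-- The velocity depends on the momentum through the invertible cometric, so an identity tested on
all motions holds for all tangent vectors. -/
theorem surjective_reducedVelocity (s : S) (y : TangentSpace (𝓡 r) s) :
    ∃ p : TangentSpace (𝓡 r) s →L[ℝ] ℝ,
      C.reducedVelocity (Bundle.TotalSpace.mk s p : CotangentBundle r S) = y := by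
  have hs := mem_chart_source (EuclideanSpace ℝ (Fin r)) s
  obtain ⟨p, hp⟩ := C.surjective_cometricChart (extChartAt_mem_target hs) y
  refine ⟨p, ?_⟩
  set a : CotangentBundle r S := Bundle.TotalSpace.mk s p
  have h2 : (extChartAt (cotangentModel r) a a).2 = p := by
    refine ContinuousLinearMap.ext fun v => ?_
    have := cov_eq_extChartAt_cotangent_snd (a₀ := a) (a := a) hs v
    exact (this.trans (congrArg (extChartAt (cotangentModel r) a a).2
      (chartDeriv_self (I := 𝓡 r) s v))).symm
  rw [reducedVelocity, extChartAt_cotangent_fst, h2]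
  exact hp

theorem trace_fderiv_chartField_reducedField [T2Space S] (a : CotangentBundle r S) :
    LinearMap.trace ℝ _ (fderiv ℝ (chartField (cotangentModel r) a C.reducedField)
      (extChartAt (cotangentModel r) a a)).toLinearMap =
      -LinearMap.trace ℝ _ ((C.gyroTensor a.1).flip (C.reducedVelocity a)) := by
  have hs := mem_chart_source (EuclideanSpace ℝ (Fin r)) a.1
  have hev : chartField (cotangentModel r) a C.reducedField
      =ᶠ[𝓝 (extChartAt (cotangentModel r) a a)] C.reducedChart a.1 := by
    filter_upwards [extChartAt_target_mem_nhds (I := cotangentModel r) a] with z hz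
    have h := (extChartAt (cotangentModel r) a).map_target hz
    rw [extChartAt_source, mem_chartAt_cotangent_source] at h
    refine (C.chartDeriv_reducedField h).trans ?_
    rw [(extChartAt (cotangentModel r) a).right_inv hz]
  have hz : (extChartAt (cotangentModel r) a a).1 = extChartAt (𝓡 r) a.1 a.1 :=
    extChartAt_cotangent_fst a a
  rw [hev.fderiv_eq, C.trace_fderiv_reducedChart (hz ▸ extChartAt_mem_target hs)]
  refine congrArg Neg.neg (congrArg (LinearMap.trace ℝ (EuclideanSpace ℝ (Fin r)))
    (LinearMap.ext fun y => ?_))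
  refine Eq.trans ?_ (C.gyroChart_self a.1 y (C.reducedVelocity a))
  rw [← gyroCoord_extChartAt_self, ← hz]
  rfl

/-- In the chart the form is a density times a constant form. The field differentiates `σ ∘ τ`
through its base component, the velocity, and its divergence is minus the trace of the gyroscopic
tensor in that velocity. -/
theorem lieDerivForm_reducedField [T2Space S] {σ : S → ℝ} (hσ : ContMDiff (𝓡 r) 𝓘(ℝ, ℝ) ∞ σ)
    (a : CotangentBundle r S)
    {Y : Fin r × Fin 2 → ∀ a : CotangentBundle r S, TangentSpace (cotangentModel r) a}
    (hY : ∀ i, ContMDiffAt (cotangentModel r) (cotangentModel r).tangent ∞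
      (fun a => (⟨a, Y i a⟩ : TangentBundle (cotangentModel r) (CotangentBundle r S))) a) :
    lieDerivForm (cotangentModel r) C.reducedField
      (fun a v => Real.exp (σ a.1) * liouvilleVolume a v) Y a =
      Real.exp (σ a.1) * ((show ℝ from mfderiv (𝓡 r) 𝓘(ℝ, ℝ) σ a.1 (C.reducedVelocity a)) -
        LinearMap.trace ℝ _ ((C.gyroTensor a.1).flip (C.reducedVelocity a))) *
      wedgePower r (stdForm r) fun i => chartDeriv (cotangentModel r) a a (Y i a) := by
  have hs := mem_chart_source (EuclideanSpace ℝ (Fin r)) a.1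
  have hz : (extChartAt (cotangentModel r) a a).1 = extChartAt (𝓡 r) a.1 a.1 :=
    extChartAt_cotangent_fst a a
  have hσd : MDifferentiableAt (𝓡 r) 𝓘(ℝ, ℝ) σ a.1 := hσ.mdifferentiableAt (by simp)
  have hg : HasFDerivAt (σ ∘ (extChartAt (𝓡 r) a.1).symm) _
      (extChartAt (cotangentModel r) a a).1 :=
    (hz ▸ differentiableAt_comp_extChartAt_symm hs hσd : DifferentiableAt ℝ
      (σ ∘ (extChartAt (𝓡 r) a.1).symm) (extChartAt (cotangentModel r) a a).1).hasFDerivAt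
  have hfh := hasFDerivAt_exp_comp_fst (F := EuclideanSpace ℝ (Fin r) →L[ℝ] ℝ) hg
  have hf : (fun a : CotangentBundle r S => Real.exp (σ a.1)) =ᶠ[𝓝 a]
      (fun z : EuclideanSpace ℝ (Fin r) × (EuclideanSpace ℝ (Fin r) →L[ℝ] ℝ) =>
        Real.exp ((σ ∘ (extChartAt (𝓡 r) a.1).symm) z.1)) ∘ extChartAt (cotangentModel r) a := by
    filter_upwards [extChartAt_source_mem_nhds (I := cotangentModel r) a] with b hb
    rw [extChartAt_source, mem_chartAt_cotangent_source] at hb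
    simp only [Function.comp_apply]
    rw [extChartAt_cotangent_fst, (extChartAt (𝓡 r) a.1).left_inv (by rwa [extChartAt_source])]
  have h := lieDerivForm_eq_of_chart (I := cotangentModel r) (cotangentBasis r)
    (wedgePower r (stdForm r)) (continuous_wedgePower_stdForm r) hf hfh.differentiableAt
    (μ := fun a v => Real.exp (σ a.1) * liouvilleVolume a v)
    (fun b hb v => congrArg (Real.exp (σ b.1) * ·)
      (liouvilleVolume_eq_wedgePower (mem_chartAt_cotangent_source.1 hb) v))
    (X := C.reducedField) (Y := Y)
    (fun i => (contDiffAt_chartField (hY i)).differentiableAt (by simp))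
  refine h.trans (congrArg (· * _) ?_)
  rw [C.trace_fderiv_chartField_reducedField, hfh.fderiv, C.chartDeriv_reducedField hs]
  have h3 := mfderiv_eq_fderiv_chart hs hσd (C.reducedVelocity a)
  rw [chartDeriv_self] at h3
  have h4 : (σ ∘ (extChartAt (𝓡 r) a.1).symm) (extChartAt (cotangentModel r) a a).1 = σ a.1 := by
    rw [hz, Function.comp_apply, (extChartAt (𝓡 r) a.1).left_inv (mem_extChartAt_source a.1)]
  rw [h4]
  have h5 : (show ℝ from mfderiv (𝓡 r) 𝓘(ℝ, ℝ) σ a.1 (C.reducedVelocity a)) =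
      fderiv ℝ (σ ∘ (extChartAt (𝓡 r) a.1).symm) (extChartAt (cotangentModel r) a a).1
        (C.reducedVelocity a) := by
    rw [hz]
    exact h3
  rw [h5, mul_sub, sub_eq_add_neg, mul_neg]
  rfl

/-- The reduced dynamics preserves `exp(σ ∘ τ) ν` if and only if `dσ` is the contraction of the
gyroscopic tensor. -/
theorem preservesBasic_iff [T2Space S] {σ : S → ℝ} (hσ : ContMDiff (𝓡 r) 𝓘(ℝ, ℝ) ∞ σ) :
    C.PreservesBasic σ ↔ ∀ (s : S) (y : TangentSpace (𝓡 r) s),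
      (show ℝ from mfderiv (𝓡 r) 𝓘(ℝ, ℝ) σ s y) =
        LinearMap.trace ℝ _ ((C.gyroTensor s).flip y) := by
  constructor
  · intro h s y
    obtain ⟨p, rfl⟩ := C.surjective_reducedVelocity s y
    set a : CotangentBundle r S := Bundle.TotalSpace.mk s p
    -- The test fields form the standard symplectic frame of the chart, on which the volume form is
    -- positive, so the scalar factor must vanish.
    let Y : Fin r × Fin 2 → ∀ b : CotangentBundle r S, TangentSpace (cotangentModel r) b :=
      fun i b => (chartDeriv (cotangentModel r) a b).inverse (stdFrame r i)
    have hYc : ∀ i, ∀ b ∈ (chartAt (ModelProd (EuclideanSpace ℝ (Fin r))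
        (EuclideanSpace ℝ (Fin r) →L[ℝ] ℝ)) a).source,
        chartDeriv (cotangentModel r) a b (Y i b) = stdFrame r i := fun i b hb =>
      (isInvertible_chartDeriv (I := cotangentModel r) hb).self_apply_inverse _
    have hY : ∀ i, ContMDiffAt (cotangentModel r) (cotangentModel r).tangent ∞
        (fun a => (⟨a, Y i a⟩ : TangentBundle (cotangentModel r) (CotangentBundle r S))) a := by
      intro i
      refine contMDiffAt_of_contDiffAt_chartField
        (contDiffAt_const (c := stdFrame r i) |>.congr_of_eventuallyEq ?_)
      filter_upwards [extChartAt_target_mem_nhds (I := cotangentModel r) a] with z hz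
      have h := (extChartAt (cotangentModel r) a).map_target hz
      rw [extChartAt_source] at h
      exact hYc i _ h
    have h0 := (C.lieDerivForm_reducedField hσ a hY).symm.trans (h a Y hY)
    have h1 : (fun i => chartDeriv (cotangentModel r) a a (Y i a)) = stdFrame r :=
      funext fun i => hYc i a (mem_chart_source _ a)
    rw [h1] at h0
    have h2 := (mul_eq_zero.1 h0).resolve_right (wedgePower_stdFrame_pos r).ne'
    exact sub_eq_zero.1 ((mul_eq_zero.1 h2).resolve_left (Real.exp_pos _).ne')
  · intro h a Y hY
    refine (C.lieDerivForm_reducedField hσ a hY).trans ?_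
    rw [h a.1 (C.reducedVelocity a), sub_self, mul_zero, zero_mul]

end ChaplyginSystem

end

/-! ### Conclusion. -/

theorem propositionP {n k r : ℕ} (hr : 2 ≤ r) {Q G S : Type*}
    [TopologicalSpace Q] [T2Space Q] [SecondCountableTopology Q]
    [ChartedSpace (EuclideanSpace ℝ (Fin n)) Q] [IsManifold (𝓡 n) ∞ Q]
    [TopologicalSpace G] [T2Space G] [SecondCountableTopology G]
    [ChartedSpace (EuclideanSpace ℝ (Fin k)) G] [Group G] [LieGroup (𝓡 k) ∞ G]
    [TopologicalSpace S] [T2Space S] [SecondCountableTopology S]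
    [ChartedSpace (EuclideanSpace ℝ (Fin r)) S] [IsManifold (𝓡 r) ∞ S]
    [MulAction G Q] [ContMDiffSMul (𝓡 k) (𝓡 n) ∞ G Q] [ProperSMul G Q]
    (C : ChaplyginSystem n k r Q G S)
    (𝒜 : Set (OpenPartialHomeomorph S (EuclideanSpace ℝ (Fin r))))
    (h𝒜 : 𝒜 ⊆ IsManifold.maximalAtlas (𝓡 r) ∞ S) (hcover : ∀ s : S, ∃ e ∈ 𝒜, s ∈ e.source) :
    ((∀ e ∈ 𝒜, C.HypHIn e) ↔ C.HypH') ∧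
    ∀ φ : S → ℝ, ContMDiff (𝓡 r) 𝓘(ℝ, ℝ) ∞ φ →
      (C.IsSimple φ ↔
        (∀ e ∈ 𝒜, C.HypHIn e) ∧ C.PreservesBasic (fun s => ((r : ℝ) - 1) * φ s)) := by
  refine ⟨(C.forall_hypHIn_iff hr h𝒜 hcover).trans C.hypH'_iff.symm, fun φ hφ => ?_⟩
  have hσ : ∀ (s : S) (y : TangentSpace (𝓡 r) s),
      (show ℝ from mfderiv (𝓡 r) 𝓘(ℝ, ℝ) (fun s => ((r : ℝ) - 1) * φ s) s y) =
        ((r : ℝ) - 1) * (show ℝ from mfderiv (𝓡 r) 𝓘(ℝ, ℝ) φ s y) := by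
    intro s y
    have h := const_smul_mfderiv (I := 𝓡 r) (z := s) (hφ.mdifferentiableAt (by simp)) ((r : ℝ) - 1)
    exact congrArg (fun L : EuclideanSpace ℝ (Fin r) →L[ℝ] ℝ => L y) h
  refine (C.isSimple_iff φ).trans (Iff.trans ?_ (and_congr (C.forall_hypHIn_iff hr h𝒜 hcover).symm
    (C.preservesBasic_iff (σ := fun s => ((r : ℝ) - 1) * φ s) (contMDiff_const.mul hφ)).symm))
  -- All three conditions are now pointwise on `S`, and the claim is the linear algebra statement
  -- with the 1-form `dφ`.
  rw [← forall_and]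
  refine forall_congr' fun s => ?_
  have he := IsManifold.chart_mem_maximalAtlas (I := 𝓡 r) (n := ∞) s
  have hs := mem_chart_source (EuclideanSpace ℝ (Fin r)) s
  refine (eq_smul_sub_smul_iff hr (coordBasis he hs) (C.gyroTensor s)
    (mfderiv (𝓡 r) 𝓘(ℝ, ℝ) φ s).toLinearMap).trans ?_
  exact and_congr Iff.rfl (forall_congr' fun y => eq_comm.trans
    ⟨fun h => (hσ s y).trans h, fun h => (hσ s y).symm.trans h⟩)
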